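/- **Notation.** Put $\Gamma_{\mathbf R}(s)=\pi^{-s/2}\Gamma(s/2)$, $\mathbf R_+=(0,\infty)$, and for $a\in\mathbf C^n$ put $|a|=a_1+\dots+a_n$. In $GL_n(\mathbf R)$ let $X_n$ be the group of upper triangular unipotent matrices, $\psi(x)=\exp\bigl(2\pi i\sum_{j=1}^{n-1}x_{j,j+1}\bigr)$ for $x\in X_n$, and $\alpha[y_1,\dots,y_n]=\mathrm{diag}(y_1\cdots y_n,\,y_2\cdots y_n,\dots,y_n)$ for $y_j>0$. *Whittaker functions.* For $a\in\mathbf C^n$ define $$W_{n,a}(\alpha[y_1,\dots,y_n])=\prod_{j=1}^{n-1}y_j^{j(n-j)/2}\cdot y_n^{|a|}\cdot\widehat W_{n,a}(y_1,\dots,y_{n-1}),$$ where $\widehat W_{1,a}=1$, $\widehat W_{2,a}(y_1)=2y_1^{(a_1+a_2)/2}K_{(a_1-a_2)/2}(2\pi y_1)$ with $K$ the modified Bessel function, and for $n\ge3$, with $\widetilde a=(a_2+\tfrac{a_1}{n-1},\dots,a_n+\tfrac{a_1}{n-1})$, $$\widehat W_{n,a}(y_1,\dots,y_{n-1})=\int_{\mathbf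 R_+^{n-1}}\widehat W_{n-1,\widetilde a}\Bigl(y_2\sqrt{\tfrac{t_2}{t_1}},\dots,y_{n-1}\sqrt{\tfrac{t_{n-1}}{t_{n-2}}}\Bigr)\prod_{j=1}^{n-1}\Bigl[e^{-(\pi y_j)^2t_j-1/t_j}(\pi y_j)^{\frac{(n-j)a_1}{n-1}}t_j^{\frac{na_1}{2(n-1)}}\Bigr](\pi t_{n-1})^{-|a|/2}\prod_{j=1}^{n-1}\frac{dt_j}{t_j}.$$ Extend to $GL_n(\mathbf R)$ by the Iwasawa decomposition $g=x\,\alpha[y]\,k$ ($x\in X_n$, $y_j>0$, $k\in O(n)$): $W_{n,a}(g)=\psi(x)W_{n,a}(\alpha[y])$ and $\overline W_{n,a}(g)=\psi(x)^{-1}W_{n,a}(\alpha[y])$. *Zeta integral.* For $m=n-2\ge1$, $a\in\mathbf C^n$, $a'\in\mathbf C^{m}$ let $$I_{n,n-2;a,a'}(s)=\int_{X_{m}\backslash GL_{m}(\mathbf R)}W_{n,a}\begin{pmatrix}g&\\&1_2\end{pmatrix}\overline W_{m,a'}(g)\,|\det g|^{s-1}\,dg,$$ where the invariant measure is, for $g=\alpha[y]k$,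 $dg=\prod_{j=1}^m y_j^{-j(m-j)}\frac{dy_j}{y_j}\,dk$, with $dk$ the Haar measure on $O(m)$ of total mass $2^m$. **Theorem.** Let $n\ge3$, $a\in\mathbf C^n$, $a'\in\mathbf C^{n-2}$, and let $c$ be any real number with $c>\operatorname{Re}a_j$ for all $j\le n$. 1. For every $s\in\mathbf C$ the integral $$B(s)=\frac1{4\pi i}\int_{\operatorname{Re}w=c}\frac{\prod_{j=1}^n\Gamma_{\mathbf R}(w-a_j)}{\prod_{j=1}^{n-2}\Gamma_{\mathbf R}(s+w+a'_j)}\,dw$$ converges absolutely, and $B$ is an entire function of $s$. 2. For every $s\in\mathbf C$ with $\operatorname{Re}(s+a_j+a'_k)>0$ for all $j\le n$, $k\le n-2$, the integral $I_{n,n-2;a,a'}(s)$ converges absolutely and $$I_{n,n-2;a,a'}(s)=\Bigl[\prod_{1\le j\le n,\ 1\le k\le n-2}\Gamma_{\mathbf R}(s+a_j+a'_k)\Bigr]\cdot B(s).$$ In particular the right-hand side is the meromorphic continuation of $I_{n,n-2;a,a'}$ to all $s\in\mathbf C$. -/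

import Mathlib

open MeasureTheory
open scoped Real

noncomputable section

namespace GLZeta

/-! ### The group `GL_n(ℝ)`: torus, unipotent radical, maximal compact, Iwasawa coordinates -/

/-- The diagonal entries of `α[y₁, …, y_n] = diag(y₁⋯y_n, y₂⋯y_n, …, y_n)`. -/
def torusEntry {n : ℕ} (y : Fin n → ℝ) (i : Fin n) : ℝ := ∏ k ∈ Finset.Ici i, y k

theorem det_torus_ne_zero {n : ℕ} (y : Fin n → ℝ) (hy : ∀ i, 0 < y i) :
    (Matrix.diagonal (torusEntry y)).det ≠ 0 := by
  rw [Matrix.det_diagonal]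
  exact (Finset.prod_pos fun i _ => Finset.prod_pos fun k _ => hy k).ne'

/-- The torus element `α[y₁, …, y_n] ∈ GL_n(ℝ)`; it is only used for positive coordinates. -/
def alpha {n : ℕ} (y : Fin n → ℝ) : GL (Fin n) ℝ :=
  open Classical in
  if hy : ∀ i, 0 < y i then
    Matrix.GeneralLinearGroup.mkOfDetNeZero (Matrix.diagonal (torusEntry y))
      (det_torus_ne_zero y hy)
  else 1

/-- Membership in the group `X` of upper triangular unipotent matrices. -/
def IsUpperUnipotent {n : ℕ} (x : GL (Fin n) ℝ) : Prop :=
  (∀ i, (x : Matrix (Fin n) (Fin n) ℝ) i i = 1) ∧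
    ∀ i j, j < i → (x : Matrix (Fin n) (Fin n) ℝ) i j = 0

/-- The character `ψ(x) = exp(2πi (x₁₂ + x₂₃ + ⋯ + x_{n-1,n}))`. -/
def psi {n : ℕ} (x : GL (Fin n) ℝ) : ℂ :=
  Complex.exp (2 * π * Complex.I *
    ∑ i : Fin n, if h : (i : ℕ) + 1 < n then
      (((x : Matrix (Fin n) (Fin n) ℝ) i ⟨(i : ℕ) + 1, h⟩ : ℝ) : ℂ) else 0)

/-- The inclusion of the orthogonal group `O(n)` in `GL_n(ℝ)`. -/
def orthToGL {n : ℕ} (k : Matrix.orthogonalGroup (Fin n) ℝ) : GL (Fin n) ℝ :=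
  Unitary.toUnits k

/-- `g = x · α[y] · k` is the Iwasawa decomposition of `g` (with `x` upper triangular unipotent,
`y` positive and `k` orthogonal). -/
def IsIwasawa {n : ℕ} (g x : GL (Fin n) ℝ) (y : Fin n → ℝ) : Prop :=
  IsUpperUnipotent x ∧ (∀ i, 0 < y i) ∧
    ∃ k : Matrix.orthogonalGroup (Fin n) ℝ, g = x * alpha y * orthToGL k

/-- The extension `g = x α[y] k ↦ χ(x) w(y)` of a function `w` of the torus coordinates to
`GL_n(ℝ)`. The Iwasawa decomposition always exists and determines `x` and `y`, so the last branch
is never reached. -/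
def radialExtension {n : ℕ} (χ : GL (Fin n) ℝ → ℂ) (w : (Fin n → ℝ) → ℂ) (g : GL (Fin n) ℝ) : ℂ :=
  open Classical in
  if h : ∃ p : GL (Fin n) ℝ × (Fin n → ℝ), IsIwasawa g p.1 p.2 then
    χ h.choose.1 * w h.choose.2
  else 0

/-! ### The class one Whittaker functions -/

/-- The set of vectors with positive coordinates, `(ℝ₊)^n`. -/
def posOrthant (n : ℕ) : Set (Fin n → ℝ) := {y | ∀ i, 0 < y i}

/-- The modified Bessel function `K_ν(x)`, for `x > 0`. -/
def besselK (ν : ℂ) (x : ℝ) : ℂ :=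
  (1 / 2) * ∫ t in Set.Ioi (0 : ℝ),
    (Real.exp (-(x / 2) * (t + 1 / t)) : ℂ) * (t : ℂ) ^ (ν - 1)

/-- The parameter `ã = (a₂ + a₁/(N-1), …, a_N + a₁/(N-1))`, where `N = n + 1`. -/
def tildeParam {n : ℕ} (a : Fin (n + 1) → ℂ) : Fin n → ℂ := fun j => a j.succ + a 0 / (n : ℂ)

/-- `whatW n a (y₁, …, y_n) = Ŵ_{N,a}(α[y₁, …, y_{N-1}, 1])` with `N = n + 1`: the constant `1` for
`N = 1`, a `K`-Bessel function for `N = 2`, and for `N ≥ 3` the recursive integral over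
`t ∈ (ℝ₊)^{N-1}`. The index `j : Fin (N-1)` stands for the `1`-based index `j + 1`. -/
def whatW : (n : ℕ) → (Fin (n + 1) → ℂ) → (Fin n → ℝ) → ℂ
  | 0, _, _ => 1
  | 1, a, y => 2 * ((y 0 : ℝ) : ℂ) ^ ((a 0 + a 1) / 2) * besselK ((a 0 - a 1) / 2) (2 * π * y 0)
  | n + 2, a, y =>
    ∫ t in posOrthant (n + 2),
      whatW (n + 1) (tildeParam a)
          (fun j : Fin (n + 1) => y j.succ * Real.sqrt (t j.succ / t j.castSucc)) *
        (∏ j : Fin (n + 2),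
          ((Real.exp (-((π * y j) ^ 2 * t j) - 1 / t j) : ℝ) : ℂ) *
            ((π * y j : ℝ) : ℂ) ^ (((n + 2 : ℂ) - (j : ℕ)) * a 0 / (n + 2 : ℂ)) *
            ((t j : ℝ) : ℂ) ^ ((n + 3 : ℂ) * a 0 / (2 * (n + 2 : ℂ)))) *
        ((π * t (Fin.last (n + 1)) : ℝ) : ℂ) ^ (-(∑ i, a i) / 2) *
        ∏ j : Fin (n + 2), ((1 / t j : ℝ) : ℂ)

/-- `W_{N,a}(α[y₁, …, y_N]) = y^ρ · y_N^{|a|} · Ŵ_{N,a}(α[y₁, …, y_{N-1}, 1])`, where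
`y^ρ = ∏_{j=1}^{N-1} y_j^{j(N-j)/2}` and `|a| = a₁ + ⋯ + a_N` (and the constant `1` for the trivial
group `N = 0`). -/
def whitRadial : (N : ℕ) → (Fin N → ℂ) → (Fin N → ℝ) → ℂ
  | 0, _, _ => 1
  | n + 1, a, y =>
    ((∏ j : Fin n, (y j.castSucc) ^ ((((j : ℕ) : ℝ) + 1) * ((n : ℝ) - (j : ℕ)) / 2) : ℝ) : ℂ) *
      ((y (Fin.last n) : ℝ) : ℂ) ^ (∑ i, a i) *
      whatW n a (fun j => y j.castSucc)

/-- The class one `ψ`-Whittaker function `W_{N,a}` on `GL_N(ℝ)`. -/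
def whittaker {N : ℕ} (a : Fin N → ℂ) : GL (Fin N) ℝ → ℂ :=
  radialExtension psi (whitRadial N a)

/-- The class one `ψ⁻¹`-Whittaker function with the same radial part as `W_{N,a}`. -/
def whittakerBar {N : ℕ} (a : Fin N → ℂ) : GL (Fin N) ℝ → ℂ :=
  radialExtension (fun x => (psi x)⁻¹) (whitRadial N a)

/-! ### The archimedean zeta integral -/

instance orthMeasurableSpace (n : ℕ) : MeasurableSpace (Matrix.orthogonalGroup (Fin n) ℝ) :=
  borel _

instance orthBorelSpace (n : ℕ) : BorelSpace (Matrix.orthogonalGroup (Fin n) ℝ) := ⟨rfl⟩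

instance orthCompactSpace (n : ℕ) : CompactSpace (Matrix.orthogonalGroup (Fin n) ℝ) := by
  have hK : IsCompact (Set.univ.pi fun _ : Fin n => Set.univ.pi fun _ : Fin n =>
      Metric.closedBall (0 : ℝ) 1) :=
    isCompact_univ_pi fun _ => isCompact_univ_pi fun _ => isCompact_closedBall _ _
  have hc : IsClosed (Matrix.orthogonalGroup (Fin n) ℝ : Set (Matrix (Fin n) (Fin n) ℝ)) := by
    have h : (Matrix.orthogonalGroup (Fin n) ℝ : Set (Matrix (Fin n) (Fin n) ℝ)) =
        {A | A * star A = 1} := by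
      ext A
      exact Matrix.mem_unitaryGroup_iff
    rw [h]
    exact isClosed_eq (continuous_id.mul continuous_star) continuous_const
  refine isCompact_iff_compactSpace.mp (IsCompact.of_isClosed_subset hK hc fun A hA i _ j _ => ?_)
  rw [mem_closedBall_zero_iff]
  exact entry_norm_bound_of_unitary hA i j

/-- The Haar probability measure on `O(n)`. -/
def orthHaar (n : ℕ) : Measure (Matrix.orthogonalGroup (Fin n) ℝ) :=
  Measure.haarMeasure ⊤

/-- The right `GL_m(ℝ)`-invariant measure on `X_m \ GL_m(ℝ)` in Iwasawa coordinates
`(y, k) ↦ X_m α[y] k`, namely `∏_j y_j^{-j(m-j)} dy_j/y_j · dk`, where `dk` is the Haar measure of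
total mass `2^m` on `O(m)`. -/
def quotientMeasure (m : ℕ) : Measure ((Fin m → ℝ) × Matrix.orthogonalGroup (Fin m) ℝ) :=
  ((volume.restrict (posOrthant m)).withDensity fun y =>
      ENNReal.ofReal (∏ j : Fin m,
        (y j) ^ (-((((j : ℕ) : ℝ) + 1) * ((m : ℝ) - ((j : ℕ) + 1)))) / y j)).prod
    ((2 : ENNReal) ^ m • orthHaar m)

/-- The point of `GL_m(ℝ)` representing the coset with Iwasawa coordinates `(y, k)`. -/
def cosetRep {m : ℕ} (p : (Fin m → ℝ) × Matrix.orthogonalGroup (Fin m) ℝ) : GL (Fin m) ℝ :=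
  alpha p.1 * orthToGL p.2

theorem det_blockEmbed_ne_zero {m : ℕ} (d : ℕ) (g : GL (Fin m) ℝ) :
    ((Matrix.fromBlocks (g : Matrix (Fin m) (Fin m) ℝ) 0 0
      (1 : Matrix (Fin d) (Fin d) ℝ)).reindex finSumFinEquiv finSumFinEquiv).det ≠ 0 := by
  rw [Matrix.det_reindex_self, Matrix.det_fromBlocks_zero₂₁, Matrix.det_one, mul_one]
  exact g.det_ne_zero

/-- The block matrix `diag(g, 1_d) ∈ GL_{m+d}(ℝ)`. -/
def blockEmbed {m : ℕ} (d : ℕ) (g : GL (Fin m) ℝ) : GL (Fin (m + d)) ℝ :=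
  Matrix.GeneralLinearGroup.mkOfDetNeZero _ (det_blockEmbed_ne_zero d g)

/-- The integrand `W(diag(g, 1_d)) W'(g) |det g|^{s - d/2}` of the zeta integral on
`GL_n × GL_m`, where `n = m + d`. -/
def zetaIntegrand {m d : ℕ} (W : GL (Fin (m + d)) ℝ → ℂ) (W' : GL (Fin m) ℝ → ℂ) (s : ℂ)
    (g : GL (Fin m) ℝ) : ℂ :=
  W (blockEmbed d g) * W' g *
    ((|(g : Matrix (Fin m) (Fin m) ℝ).det| : ℝ) : ℂ) ^ (s - (d : ℂ) / 2)

/-- The integral `I_{n,m;a,a'}(s)` converges absolutely, where `n = m + d`. -/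
def ZetaConverges {m d : ℕ} (a : Fin (m + d) → ℂ) (a' : Fin m → ℂ) (s : ℂ) : Prop :=
  Integrable (fun p => zetaIntegrand (whittaker a) (whittakerBar a') s (cosetRep p))
    (quotientMeasure m)

/-- The zeta integral
`I_{n,m;a,a'}(s) = ∫_{X_m \ GL_m(ℝ)} W_{n,a}(diag(g, 1_d)) W̄_{m,a'}(g) |det g|^{s - d/2} dg`,
where `n = m + d`. -/
def zetaIntegral {m d : ℕ} (a : Fin (m + d) → ℂ) (a' : Fin m → ℂ) (s : ℂ) : ℂ :=
  ∫ p, zetaIntegrand (whittaker a) (whittakerBar a') s (cosetRep p) ∂(quotientMeasure m)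

/-! ### The Barnes integral -/

/-- The integrand `∏_{j ≤ n} Γ_ℝ(w - a_j) / ∏_{j ≤ m} Γ_ℝ(s + w + a'_j)`. -/
def barnesIntegrand {n m : ℕ} (a : Fin n → ℂ) (a' : Fin m → ℂ) (s w : ℂ) : ℂ :=
  (∏ j, Complex.Gammaℝ (w - a j)) / ∏ j, Complex.Gammaℝ (s + w + a' j)

/-- The integral `(1/4πi) ∫ barnesIntegrand dw` over the upward vertical line `Re w = c`. -/
def barnesIntegral {n m : ℕ} (a : Fin n → ℂ) (a' : Fin m → ℂ) (c : ℝ) (s : ℂ) : ℂ :=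
  (1 / (4 * π * Complex.I)) *
    ∫ t : ℝ, barnesIntegrand a a' s ((c : ℂ) + t * Complex.I) * Complex.I

end GLZeta

end

/-! Strip the square root of the modular character from the class one Whittaker function, use the
coordinates x_i = log (y_i⋯y_n)² and halve the parameters. The recursive definition then becomes
`toda`, an iteration of raising operators, each of which increases the rank by one and inserts one
parameter (`whatW_eq`, `whitRadial_rootCoord`). The Baxter operator with parameter u passes through
the raising operator with parameter a at the cost of a factor `gammaInt (u + a)`, by an explicit
reflection of the integration variable (`exchange_pot`). Hence `toda` with parameters α is an
eigenfunction of every Baxter operator, with eigenvalue the product of the `gammaInt (u + α j)`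
(`integral_baxterKernel_mul_toda`).

The zeta integral is the value at ρ = 0 of `zetaLog`, in which the Whittaker function of rank m + 2
is evaluated at (x, 0, ρ). Its Laplace transform `zetaMellin` in ρ has a closed form, because the
frozen coordinate 0 lets the two kernels play each other's role. The raising kernel at (x, 0, ρ) is
a Baxter kernel in x times factors free of x (`raisePot_extendTwo`). The x-integral is then an
eigenvalue, the ρ-integral is a gamma function, and what remains is `companion`, with one α fewer.
Conversely, the Baxter kernel at (u, 0, q) is a raising kernel in u times elementary factors
(`baxterPot_extendTwo`), which expresses `companion` through a Laplace transform with one β fewer.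
Alternating the two steps gives `zetaMellin_mul_prod`, and Fourier inversion at ρ = 0 turns this
quotient of gamma products into the Barnes integral.

Convergence runs in parallel. The identities are first proved for nonnegative kernels with values in
`ENNReal`, where Tonelli needs no hypothesis. Finiteness is read off from these identities and
dominates the complex integrals. On the Barnes side, the two surplus gamma factors in the numerator
give exponential decay on vertical lines, locally uniformly in s, which yields both integrability
and holomorphy. -/

noncomputable section

namespace GLZeta

/-! ### Kernels in logarithmic coordinates -/

/-- The vector `(e^{-x₁}, …, e^{-x_n}, 0)`. -/
def expNegSnoc {n : ℕ} (x : Fin n → ℝ) : Fin (n + 1) → ℝ :=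
  Fin.snoc (α := fun _ => ℝ) (fun i => Real.exp (-x i)) 0

@[simp] theorem expNegSnoc_castSucc {n : ℕ} (x : Fin n → ℝ) (i : Fin n) :
    expNegSnoc x i.castSucc = Real.exp (-x i) := by simp [expNegSnoc]

@[simp] theorem expNegSnoc_last {n : ℕ} (x : Fin n → ℝ) : expNegSnoc x (Fin.last n) = 0 := by
  simp [expNegSnoc]

theorem expNegSnoc_nonneg {n : ℕ} (x : Fin n → ℝ) (i : Fin (n + 1)) : 0 ≤ expNegSnoc x i := by
  refine Fin.lastCases ?_ (fun j => ?_) i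
  · simp
  · simpa using (Real.exp_pos _).le

@[fun_prop] theorem continuous_expNegSnoc {n : ℕ} (i : Fin (n + 1)) :
    Continuous fun x : Fin n → ℝ => expNegSnoc x i := by
  refine Fin.lastCases ?_ (fun j => ?_) i
  · simpa using continuous_const
  · simp only [expNegSnoc_castSucc]
    fun_prop

/-- The potential of the raising operator `Fin n → ℝ` to `Fin (n + 1) → ℝ`. -/
def raisePot {n : ℕ} (x : Fin (n + 1) → ℝ) (t : Fin n → ℝ) : ℝ :=
  ∑ i, (Real.exp (x i.castSucc - t i) + Real.exp (t i - x i.succ))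

/-- The potential of the (transposed) Baxter operator. -/
def baxterPot {n : ℕ} (z x : Fin n → ℝ) : ℝ :=
  ∑ i, (Real.exp (x i - z i) + Real.exp (z i) * expNegSnoc x i.succ)

theorem baxterPot_succ {n : ℕ} (z x : Fin (n + 1) → ℝ) :
    baxterPot z x = ∑ i, Real.exp (x i - z i) +
      ∑ i : Fin n, Real.exp (z i.castSucc - x i.succ) := by
  rw [baxterPot, Finset.sum_add_distrib]
  congr 1
  rw [Fin.sum_univ_castSucc, Fin.succ_last, expNegSnoc_last, mul_zero, add_zero]
  refine Finset.sum_congr rfl fun i _ => ?_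
  rw [Fin.succ_castSucc, expNegSnoc_castSucc, ← Real.exp_add, sub_eq_add_neg]

@[fun_prop] theorem continuous_raisePot {n : ℕ} {X : Type*} [TopologicalSpace X]
    {f : X → Fin (n + 1) → ℝ} {g : X → Fin n → ℝ} (hf : Continuous f) (hg : Continuous g) :
    Continuous fun p => raisePot (f p) (g p) := by
  unfold raisePot
  fun_prop

@[fun_prop] theorem continuous_baxterPot {n : ℕ} {X : Type*} [TopologicalSpace X]
    {f : X → Fin n → ℝ} {g : X → Fin n → ℝ} (hf : Continuous f) (hg : Continuous g) :
    Continuous fun p => baxterPot (f p) (g p) := by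
  unfold baxterPot
  have h (i : Fin n) : Continuous fun p => expNegSnoc (g p) i.succ :=
    (continuous_expNegSnoc i.succ).comp hg
  fun_prop

/-! The change of variables which exchanges the two operators. -/

/-- `e^{-z_j} + e^{-t_j}`, with the second term absent for the last index. -/
def recipSum {n : ℕ} (z : Fin (n + 1) → ℝ) (t : Fin n → ℝ) (j : Fin (n + 1)) : ℝ :=
  Real.exp (-z j) + expNegSnoc t j

theorem recipSum_pos {n : ℕ} (z : Fin (n + 1) → ℝ) (t : Fin n → ℝ) (j : Fin (n + 1)) :
    0 < recipSum z t j :=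
  add_pos_of_pos_of_nonneg (Real.exp_pos _) (expNegSnoc_nonneg t j)

/-- The centre of the reflection exchanging the two operators. -/
def exchangeCentre {n : ℕ} (z : Fin (n + 1) → ℝ) (t : Fin n → ℝ) : Fin (n + 1) → ℝ :=
  Fin.cons (-Real.log (recipSum z t 0)) fun i : Fin n =>
    Real.log ((Real.exp (z i.castSucc) + Real.exp (t i)) / recipSum z t i.succ)

/-- The coordinates of x decouple: each occurs only through e^x and e^{-x}, with coefficients
depending on z and t alone. The zeroth coordinate has no e^{-x} term, so its integral will be a
gamma function rather than a Bessel function. -/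
theorem baxterPot_add_raisePot {n : ℕ} (z x : Fin (n + 1) → ℝ) (t : Fin n → ℝ) :
    baxterPot z x + raisePot x t = recipSum z t 0 * Real.exp (x 0) +
      ∑ i : Fin n, (recipSum z t i.succ * Real.exp (x i.succ) +
        (Real.exp (z i.castSucc) + Real.exp (t i)) * Real.exp (-x i.succ)) := by
  have h1 : raisePot x t = ∑ j, Real.exp (x j) * expNegSnoc t j +
      ∑ i : Fin n, Real.exp (t i - x i.succ) := by
    rw [raisePot, Finset.sum_add_distrib, Fin.sum_univ_castSucc, expNegSnoc_last, mul_zero,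
      add_zero]
    congr 1
    refine Finset.sum_congr rfl fun i _ => ?_
    rw [expNegSnoc_castSucc, ← Real.exp_add, sub_eq_add_neg]
  have h2 : ∑ j, recipSum z t j * Real.exp (x j) =
      ∑ i, Real.exp (x i - z i) + ∑ j, Real.exp (x j) * expNegSnoc t j := by
    rw [← Finset.sum_add_distrib]
    refine Finset.sum_congr rfl fun i _ => ?_
    rw [recipSum, sub_eq_add_neg, Real.exp_add]
    ring
  rw [Fin.sum_univ_succ] at h2
  rw [h1, baxterPot_succ, Finset.sum_add_distrib]
  simp only [add_mul, ← Real.exp_add, ← sub_eq_add_neg, Finset.sum_add_distrib] at h2 ⊢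
  linarith

/-- The coefficients are those attached to x_1, …, x_n in `baxterPot_add_raisePot`, but now attached
to p; this match makes the exchange possible. -/
theorem raisePot_add_baxterPot {n : ℕ} (z : Fin (n + 1) → ℝ) (p t : Fin n → ℝ) :
    raisePot z p + baxterPot p t = ∑ i : Fin n, (recipSum z t i.succ * Real.exp (p i) +
        (Real.exp (z i.castSucc) + Real.exp (t i)) * Real.exp (-p i)) := by
  rw [raisePot, baxterPot, ← Finset.sum_add_distrib]
  refine Finset.sum_congr rfl fun i _ => ?_
  simp only [recipSum, sub_eq_add_neg, Real.exp_add]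
  ring

/-- For A e^x + S e^{-x}, the reflection x = log (S/A) - p swaps the two terms and gives A e^p + S
e^{-p}. In the zeroth coordinate the shift by -log A normalises the coefficient to 1. -/
theorem exchange_pot {n : ℕ} (z : Fin (n + 1) → ℝ) (t p : Fin n → ℝ) (y : ℝ) :
    baxterPot z (exchangeCentre z t - Fin.cons (α := fun _ => ℝ) y p) +
      raisePot (exchangeCentre z t - Fin.cons (α := fun _ => ℝ) y p) t =
      Real.exp (-y) + (raisePot z p + baxterPot p t) := by
  rw [baxterPot_add_raisePot, raisePot_add_baxterPot]
  have hA := recipSum_pos z t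
  congr 1
  · simp only [exchangeCentre, Pi.sub_apply, Fin.cons_zero, sub_eq_add_neg, Real.exp_add]
    rw [Real.exp_neg, Real.exp_log (hA 0), mul_inv_cancel_left₀ (hA 0).ne']
  · refine Finset.sum_congr rfl fun i _ => ?_
    have hS : 0 < Real.exp (z i.castSucc) + Real.exp (t i) := by positivity
    simp only [exchangeCentre, Pi.sub_apply, Fin.cons_succ]
    rw [neg_sub, Real.exp_sub, Real.exp_sub, Real.exp_log (div_pos hS (hA _)), Real.exp_neg]
    have := (hA i.succ).ne'
    field_simp
    ring

/-- Since e^z + e^t = e^{z+t} (e^{-z} + e^{-t}), the logarithms of `recipSum` telescope, and the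
last of them is -z_last. -/
theorem sum_exchangeCentre {n : ℕ} (z : Fin (n + 1) → ℝ) (t : Fin n → ℝ) :
    ∑ i, exchangeCentre z t i = ∑ i, z i + ∑ i, t i := by
  have hA := recipSum_pos z t
  have hS (i : Fin n) : Real.log (Real.exp (z i.castSucc) + Real.exp (t i)) =
      Real.log (recipSum z t i.castSucc) + z i.castSucc + t i := by
    rw [add_assoc, ← Real.log_exp (z i.castSucc + t i), ← Real.log_mul (hA _).ne' (by positivity),
      recipSum, expNegSnoc_castSucc, add_mul, ← Real.exp_add, ← Real.exp_add]
    congr 1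
    rw [add_comm]
    congr 2 <;> ring
  have hd (i : Fin n) : Real.log ((Real.exp (z i.castSucc) + Real.exp (t i)) /
      recipSum z t i.succ) = Real.log (recipSum z t i.castSucc) + z i.castSucc + t i -
        Real.log (recipSum z t i.succ) := by
    rw [Real.log_div (by positivity) (hA _).ne', hS]
  have hl : Real.log (recipSum z t (Fin.last n)) = - z (Fin.last n) := by simp [recipSum]
  have e1 := Fin.sum_univ_succ fun j => Real.log (recipSum z t j)
  have e2 := Fin.sum_univ_castSucc fun j => Real.log (recipSum z t j)
  simp only [exchangeCentre, Fin.sum_univ_succ (n := n) (f := Fin.cons _ _), Fin.cons_zero,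
    Fin.cons_succ, hd, Finset.sum_add_distrib, Finset.sum_sub_distrib]
  rw [Fin.sum_univ_castSucc z]
  linarith

theorem sum_exchange {n : ℕ} (z : Fin (n + 1) → ℝ) (t p : Fin n → ℝ) (y : ℝ) :
    ∑ i, (exchangeCentre z t - Fin.cons (α := fun _ => ℝ) y p) i =
      ∑ i, z i + ∑ i, t i - ∑ i, p i - y := by
  simp only [Pi.sub_apply, Finset.sum_sub_distrib, sum_exchangeCentre,
    Fin.sum_univ_succ (f := Fin.cons (α := fun _ => ℝ) y p), Fin.cons_zero, Fin.cons_succ]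
  ring

/-! ### Integration over `Fin (n + 1) → ℝ` -/

theorem lintegral_cons {n : ℕ} (f : (Fin (n + 1) → ℝ) → ENNReal) :
    ∫⁻ x, f x = ∫⁻ q : ℝ × (Fin n → ℝ), f (Fin.cons (α := fun _ => ℝ) q.1 q.2) := by
  have h := (volume_preserving_piFinSuccAbove (fun _ : Fin (n + 1) => ℝ) 0).symm
  rw [← h.lintegral_comp_emb (MeasurableEquiv.measurableEmbedding _)]
  simp [MeasurableEquiv.piFinSuccAbove, Fin.insertNthEquiv]

theorem integral_cons {n : ℕ} (f : (Fin (n + 1) → ℝ) → ℂ) :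
    ∫ x, f x = ∫ q : ℝ × (Fin n → ℝ), f (Fin.cons (α := fun _ => ℝ) q.1 q.2) := by
  have h := (volume_preserving_piFinSuccAbove (fun _ : Fin (n + 1) => ℝ) 0).symm
  rw [← h.integral_comp (MeasurableEquiv.measurableEmbedding _)]
  simp [MeasurableEquiv.piFinSuccAbove, Fin.insertNthEquiv]

/-! ### Complex and real kernels -/

/-- The exponential of a real number, in `ℝ≥0∞`. -/
def ennexp (r : ℝ) : ENNReal := ENNReal.ofReal (Real.exp r)

theorem ennexp_add (r s : ℝ) : ennexp (r + s) = ennexp r * ennexp s := by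
  rw [ennexp, Real.exp_add, ENNReal.ofReal_mul (Real.exp_pos _).le, ennexp, ennexp]

theorem ennexp_zero : ennexp 0 = 1 := by simp [ennexp]

theorem ennexp_ne_zero (r : ℝ) : ennexp r ≠ 0 := by simp [ennexp, Real.exp_pos]

theorem ennexp_ne_top (r : ℝ) : ennexp r ≠ ⊤ := ENNReal.ofReal_ne_top

theorem ennexp_le_ennexp {r s : ℝ} (h : r ≤ s) : ennexp r ≤ ennexp s :=
  ENNReal.ofReal_le_ofReal (Real.exp_le_exp.mpr h)

@[fun_prop] theorem measurable_ennexp : Measurable ennexp :=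
  ENNReal.measurable_ofReal.comp Real.measurable_exp

theorem enorm_cexp (z : ℂ) : ‖Complex.exp z‖ₑ = ennexp z.re := by
  rw [← ofReal_norm, Complex.norm_exp, ennexp]

/-- `∫ e^{vx - πe^x} dx = Γ_ℝ(2v)`. -/
def gammaInt (v : ℂ) : ℂ := ∫ x : ℝ, Complex.exp (v * x - (π * Real.exp x : ℝ))

/-- The version of `gammaInt` with values in `ℝ≥0∞`. -/
def gammaLInt (v : ℝ) : ENNReal := ∫⁻ x : ℝ, ennexp (v * x - π * Real.exp x)

/-- Integrated against a function of t, this kernel raises the rank by one and inserts the spectral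
parameter a. -/
def raiseKernel {n : ℕ} (a : ℂ) (x : Fin (n + 1) → ℝ) (t : Fin n → ℝ) : ℂ :=
  Complex.exp (a * (∑ i, x i - ∑ i, t i : ℝ) - (π * raisePot x t : ℝ))

def raiseLKernel {n : ℕ} (a : ℝ) (x : Fin (n + 1) → ℝ) (t : Fin n → ℝ) : ENNReal :=
  ennexp (a * (∑ i, x i - ∑ i, t i) - π * raisePot x t)

/-- The operator integrates over the second argument x and keeps the rank; u is its spectral
parameter. -/
def baxterKernel {n : ℕ} (u : ℂ) (z x : Fin n → ℝ) : ℂ :=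
  Complex.exp (u * (∑ i, x i - ∑ i, z i : ℝ) - (π * baxterPot z x : ℝ))

def baxterLKernel {n : ℕ} (u : ℝ) (z x : Fin n → ℝ) : ENNReal :=
  ennexp (u * (∑ i, x i - ∑ i, z i) - π * baxterPot z x)

theorem enorm_raiseKernel {n : ℕ} (a : ℂ) (x : Fin (n + 1) → ℝ) (t : Fin n → ℝ) :
    ‖raiseKernel a x t‖ₑ = raiseLKernel a.re x t := by
  rw [raiseKernel, enorm_cexp, Complex.sub_re, Complex.re_mul_ofReal, Complex.ofReal_re,
    raiseLKernel]

theorem enorm_baxterKernel {n : ℕ} (u : ℂ) (z x : Fin n → ℝ) :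
    ‖baxterKernel u z x‖ₑ = baxterLKernel u.re z x := by
  rw [baxterKernel, enorm_cexp, Complex.sub_re, Complex.re_mul_ofReal, Complex.ofReal_re,
    baxterLKernel]

@[fun_prop] theorem continuous_raiseKernel {n : ℕ} (a : ℂ) {X : Type*} [TopologicalSpace X]
    {f : X → Fin (n + 1) → ℝ} {g : X → Fin n → ℝ} (hf : Continuous f) (hg : Continuous g) :
    Continuous fun p => raiseKernel a (f p) (g p) := by
  unfold raiseKernel
  fun_prop

@[fun_prop] theorem continuous_baxterKernel {n : ℕ} (a : ℂ) {X : Type*} [TopologicalSpace X]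
    {f : X → Fin n → ℝ} {g : X → Fin n → ℝ} (hf : Continuous f) (hg : Continuous g) :
    Continuous fun p => baxterKernel a (f p) (g p) := by
  unfold baxterKernel
  fun_prop

@[fun_prop] theorem measurable_raiseLKernel {n : ℕ} (a : ℝ) {X : Type*} [MeasurableSpace X]
    {f : X → Fin (n + 1) → ℝ} {g : X → Fin n → ℝ} (hf : Measurable f) (hg : Measurable g) :
    Measurable fun p => raiseLKernel a (f p) (g p) := by
  have h : Continuous fun q : (Fin (n + 1) → ℝ) × (Fin n → ℝ) =>
    a * (∑ i, q.1 i - ∑ i, q.2 i) - π * raisePot q.1 q.2 := by fun_prop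
  exact measurable_ennexp.comp (h.measurable.comp (hf.prodMk hg))

@[fun_prop] theorem measurable_baxterLKernel {n : ℕ} (a : ℝ) {X : Type*} [MeasurableSpace X]
    {f : X → Fin n → ℝ} {g : X → Fin n → ℝ} (hf : Measurable f) (hg : Measurable g) :
    Measurable fun p => baxterLKernel a (f p) (g p) := by
  have h : Continuous fun q : (Fin n → ℝ) × (Fin n → ℝ) =>
    a * (∑ i, q.2 i - ∑ i, q.1 i) - π * baxterPot q.1 q.2 := by fun_prop
  exact measurable_ennexp.comp (h.measurable.comp (hf.prodMk hg))

theorem gammaInt_neg (v : ℂ) :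
    gammaInt v = ∫ x : ℝ, Complex.exp (v * (-x : ℝ) - (π * Real.exp (-x) : ℝ)) :=
  (integral_neg_eq_self (fun x : ℝ => Complex.exp (v * x - (π * Real.exp x : ℝ))) volume).symm

theorem gammaLInt_neg (v : ℝ) :
    gammaLInt v = ∫⁻ x : ℝ, ennexp (v * (-x) - π * Real.exp (-x)) :=
  (lintegral_neg_eq_self (fun x : ℝ => ennexp (v * x - π * Real.exp x))).symm

/-- The Baxter operator intertwines the raising operators, up to a gamma factor. -/
theorem lintegral_baxterLKernel_mul_raiseLKernel {n : ℕ} (u a : ℝ) (z : Fin (n + 1) → ℝ)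
    (t : Fin n → ℝ) :
    ∫⁻ x, baxterLKernel u z x * raiseLKernel a x t =
      gammaLInt (u + a) * ∫⁻ p, raiseLKernel a z p * baxterLKernel u p t := by
  -- Reflect x about the centre and split off its zeroth coordinate y, whose integral is the gamma
  -- factor; the others become the variable p of the right-hand side.
  rw [← lintegral_sub_left_eq_self _ (exchangeCentre z t), lintegral_cons, gammaLInt_neg,
    ← lintegral_prod_mul (by fun_prop) (by fun_prop)]
  refine lintegral_congr fun ⟨y, p⟩ => ?_
  simp only [baxterLKernel, raiseLKernel, ← ennexp_add]
  congr 1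
  have h1 := exchange_pot z t p y
  have h2 := sum_exchange z t p y
  rw [h2]
  linear_combination (-π) * h1

/-- Reflection and factorisation of a product integral hold for the Bochner integral without
integrability, so u and a are unrestricted. -/
theorem integral_baxterKernel_mul_raiseKernel {n : ℕ} (u a : ℂ) (z : Fin (n + 1) → ℝ)
    (t : Fin n → ℝ) :
    ∫ x, baxterKernel u z x * raiseKernel a x t =
      gammaInt (u + a) * ∫ p, raiseKernel a z p * baxterKernel u p t := by
  rw [← integral_sub_left_eq_self _ _ (exchangeCentre z t), integral_cons, gammaInt_neg,
    ← integral_prod_mul]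
  refine integral_congr_ae (.of_forall fun ⟨y, p⟩ => ?_)
  simp only [baxterKernel, raiseKernel, ← Complex.exp_add]
  congr 1
  have h1 := congrArg (fun r : ℝ => (r : ℂ)) (exchange_pot z t p y)
  have h2 := sum_exchange z t p y
  rw [h2]
  push_cast at h1 ⊢
  linear_combination (-π) * h1

/-! ### The class one Whittaker function in logarithmic coordinates -/

/-- The class one Whittaker function without its `δ^{1/2}`-factor, in coordinates
`x_i = log (y_i ⋯ y_n)²` and with halved parameters. -/
def toda : (n : ℕ) → (Fin n → ℂ) → (Fin n → ℝ) → ℂ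
  | 0, _, _ => 1
  | n + 1, α, x => ∫ t, raiseKernel (α 0) x t * toda n (Fin.tail α) t

/-- The version of `toda` with real parameters and values in `ℝ≥0∞`. -/
def todaL : (n : ℕ) → (Fin n → ℝ) → (Fin n → ℝ) → ENNReal
  | 0, _, _ => 1
  | n + 1, α, x => ∫⁻ t, raiseLKernel (α 0) x t * todaL n (Fin.tail α) t

theorem todaL_succ {n : ℕ} (α : Fin (n + 1) → ℝ) (x : Fin (n + 1) → ℝ) :
    todaL (n + 1) α x = ∫⁻ t, raiseLKernel (α 0) x t * todaL n (Fin.tail α) t := rfl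

theorem toda_succ {n : ℕ} (α : Fin (n + 1) → ℂ) (x : Fin (n + 1) → ℝ) :
    toda (n + 1) α x = ∫ t, raiseKernel (α 0) x t * toda n (Fin.tail α) t := rfl

theorem measurable_todaL : ∀ (n : ℕ) (α : Fin n → ℝ), Measurable (todaL n α)
  | 0, _ => measurable_const
  | n + 1, α => by
    have h := measurable_todaL n (Fin.tail α)
    have h2 : Measurable fun q : (Fin (n + 1) → ℝ) × (Fin n → ℝ) =>
        raiseLKernel (α 0) q.1 q.2 * todaL n (Fin.tail α) q.2 := by fun_prop
    exact h2.lintegral_prod_right'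

theorem stronglyMeasurable_toda : ∀ (n : ℕ) (α : Fin n → ℂ), StronglyMeasurable (toda n α)
  | 0, _ => stronglyMeasurable_const
  | n + 1, α => by
    have h := stronglyMeasurable_toda n (Fin.tail α)
    have h1 : Continuous fun q : (Fin (n + 1) → ℝ) × (Fin n → ℝ) =>
        raiseKernel (α 0) q.1 q.2 := by fun_prop
    have h2 : StronglyMeasurable fun q : (Fin (n + 1) → ℝ) × (Fin n → ℝ) =>
        raiseKernel (α 0) q.1 q.2 * toda n (Fin.tail α) q.2 :=
      h1.stronglyMeasurable.mul (h.comp_measurable measurable_snd)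
    exact h2.integral_prod_right

@[fun_prop] theorem measurable_toda (n : ℕ) (α : Fin n → ℂ) : Measurable (toda n α) :=
  (stronglyMeasurable_toda n α).measurable

attribute [fun_prop] measurable_todaL

/-- Reduces convergence questions for complex parameters to the nonnegative integrals with the real
parts as parameters. -/
theorem enorm_toda_le : ∀ (n : ℕ) (α : Fin n → ℂ) (x : Fin n → ℝ),
    ‖toda n α x‖ₑ ≤ todaL n (fun i => (α i).re) x
  | 0, _, _ => by simp [toda, todaL]
  | n + 1, α, x => by
    refine (enorm_integral_le_lintegral_enorm _).trans (lintegral_mono fun t => ?_)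
    rw [enorm_mul, enorm_raiseKernel]
    exact mul_le_mul_right (enorm_toda_le n _ t) _

/-- Shifting all parameters by c twists by a power of the determinant: the factors e^{c(Σx - Σt)} of
successive raising kernels telescope. -/
theorem toda_add_const : ∀ (n : ℕ) (α : Fin n → ℂ) (c : ℂ) (x : Fin n → ℝ),
    toda n (fun i => α i + c) x = Complex.exp (c * (∑ i, x i : ℝ)) * toda n α x
  | 0, _, _, _ => by simp [toda]
  | n + 1, α, c, x => by
    rw [toda_succ, toda_succ, ← integral_const_mul]
    refine integral_congr_ae (.of_forall fun t => ?_)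
    have h := toda_add_const n (Fin.tail α) c t
    change raiseKernel _ x t * toda n (fun i => Fin.tail α i + c) t = _
    simp only [h, raiseKernel, ← mul_assoc, ← Complex.exp_add]
    congr 2
    push_cast
    ring

/-! ### The Baxter eigenvalue equation for nonnegative kernels -/

theorem lintegral_baxterLKernel_mul_todaL (u : ℝ) : ∀ (n : ℕ) (α : Fin n → ℝ) (z : Fin n → ℝ),
    ∫⁻ x, baxterLKernel u z x * todaL n α x = (∏ j, gammaLInt (u + α j)) * todaL n α z
  | 0, α, z => by simp [todaL, baxterLKernel, baxterPot, ennexp_zero, volume_pi]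
  | n + 1, α, z => by
    simp_rw [todaL_succ]
    calc ∫⁻ x, baxterLKernel u z x * ∫⁻ t, raiseLKernel (α 0) x t * todaL n (Fin.tail α) t
        = ∫⁻ x, ∫⁻ t, baxterLKernel u z x * (raiseLKernel (α 0) x t * todaL n (Fin.tail α) t) := by
          refine lintegral_congr fun x => ?_
          rw [lintegral_const_mul _ (by fun_prop)]
      _ = ∫⁻ t, ∫⁻ x, baxterLKernel u z x * (raiseLKernel (α 0) x t * todaL n (Fin.tail α) t) :=
          lintegral_lintegral_swap (by unfold Function.uncurry; fun_prop)
      _ = ∫⁻ t, gammaLInt (u + α 0) *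
            ((∫⁻ p, raiseLKernel (α 0) z p * baxterLKernel u p t) * todaL n (Fin.tail α) t) := by
          refine lintegral_congr fun t => ?_
          simp_rw [← mul_assoc]
          rw [lintegral_mul_const _ (by fun_prop), lintegral_baxterLKernel_mul_raiseLKernel]
      _ = gammaLInt (u + α 0) * ∫⁻ t, ∫⁻ p,
            (raiseLKernel (α 0) z p * baxterLKernel u p t) * todaL n (Fin.tail α) t := by
          rw [← lintegral_const_mul _ (Measurable.lintegral_prod_right (by fun_prop))]
          refine lintegral_congr fun t => ?_
          rw [lintegral_mul_const _ (by fun_prop)]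
      _ = gammaLInt (u + α 0) * ∫⁻ p, ∫⁻ t,
            (raiseLKernel (α 0) z p * baxterLKernel u p t) * todaL n (Fin.tail α) t := by
          rw [lintegral_lintegral_swap]
          unfold Function.uncurry; fun_prop
      _ = gammaLInt (u + α 0) * ∫⁻ p, (∏ j, gammaLInt (u + Fin.tail α j)) *
            (raiseLKernel (α 0) z p * todaL n (Fin.tail α) p) := by
          congr 1
          refine lintegral_congr fun p => ?_
          simp_rw [mul_assoc]
          rw [lintegral_const_mul _ (by fun_prop), lintegral_baxterLKernel_mul_todaL u n]
          ring
      _ = _ := by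
          rw [lintegral_const_mul _ (by fun_prop), Fin.prod_univ_succ, mul_assoc]
          rfl

theorem lintegral_pi_prod : ∀ {n : ℕ} (f : Fin n → ℝ → ENNReal), (∀ i, Measurable (f i)) →
    ∫⁻ x : Fin n → ℝ, ∏ i, f i (x i) = ∏ i, ∫⁻ y, f i y
  | 0, f, _ => by simp [volume_pi]
  | n + 1, f, hf => by
    rw [lintegral_cons, Fin.prod_univ_succ, ← lintegral_pi_prod _ fun i => hf i.succ]
    simp_rw [Fin.prod_univ_succ, Fin.cons_zero, Fin.cons_succ]
    exact lintegral_prod_mul (f := f 0) (g := fun x : Fin n → ℝ => ∏ i : Fin n, f i.succ (x i))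
      (hf 0).aemeasurable (Finset.measurable_fun_prod _ fun i _ =>
        (hf i.succ).comp (measurable_pi_apply i)).aemeasurable

theorem lintegral_ennexp_mul_sub (v c : ℝ) :
    ∫⁻ t : ℝ, ennexp (v * t - π * Real.exp (t - c)) = ennexp (v * c) * gammaLInt v := by
  rw [← lintegral_add_right_eq_self _ c, gammaLInt, ← lintegral_const_mul _ (by fun_prop)]
  refine lintegral_congr fun t => ?_
  rw [← ennexp_add, add_sub_cancel_right]
  congr 1
  ring

theorem lintegral_ennexp_mul_sub_neg (v c : ℝ) :
    ∫⁻ t : ℝ, ennexp (v * t - π * Real.exp (c - t)) = ennexp (v * c) * gammaLInt (-v) := by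
  rw [← lintegral_sub_left_eq_self _ c, gammaLInt, ← lintegral_const_mul _ (by fun_prop)]
  refine lintegral_congr fun t => ?_
  rw [← ennexp_add, sub_sub_cancel]
  congr 1
  ring

theorem integral_cexp_mul_sub_neg (v : ℂ) (c : ℝ) :
    ∫ t : ℝ, Complex.exp (v * t - (π * Real.exp (c - t) : ℝ)) =
      Complex.exp (v * c) * gammaInt (-v) := by
  rw [← integral_sub_left_eq_self _ _ c, gammaInt, ← integral_const_mul]
  refine integral_congr_ae (.of_forall fun t => ?_)
  simp only
  rw [← Complex.exp_add, sub_sub_cancel]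
  congr 1
  push_cast
  ring

/-! ### Exponential substitution and the gamma function -/

/-- The coordinatewise exponential. -/
def expMap {n : ℕ} (x : Fin n → ℝ) : Fin n → ℝ := fun i => Real.exp (x i)

theorem image_expMap_univ (n : ℕ) : expMap '' (Set.univ : Set (Fin n → ℝ)) = posOrthant n := by
  ext y
  constructor
  · rintro ⟨x, -, rfl⟩ i
    exact Real.exp_pos _
  · intro hy
    exact ⟨fun i => Real.log (y i), trivial, funext fun i => Real.exp_log (hy i)⟩

theorem injective_expMap (n : ℕ) : Function.Injective (expMap (n := n)) := fun _ _ h =>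
  funext fun i => Real.exp_injective (congrFun h i)

theorem hasFDerivAt_expMap {n : ℕ} (x : Fin n → ℝ) :
    HasFDerivAt expMap (Matrix.toLin' (Matrix.diagonal (expMap x))).toContinuousLinearMap x := by
  rw [hasFDerivAt_pi']
  intro i
  have h := (Real.hasDerivAt_exp (x i)).comp_hasFDerivAt x (hasFDerivAt_apply (𝕜 := ℝ) i x)
  refine h.congr_fderiv ?_
  ext v
  simp [Matrix.toLin'_apply, Matrix.mulVec_diagonal, expMap]

theorem abs_det_expMap {n : ℕ} (x : Fin n → ℝ) :
    |(Matrix.toLin' (Matrix.diagonal (expMap x))).toContinuousLinearMap.det| =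
      ∏ i, Real.exp (x i) := by
  rw [ContinuousLinearMap.det, LinearMap.coe_toContinuousLinearMap, LinearMap.det_toLin',
    Matrix.det_diagonal]
  exact abs_of_pos (Finset.prod_pos fun i _ => Real.exp_pos _)

theorem setIntegral_posOrthant {n : ℕ} (f : (Fin n → ℝ) → ℂ) :
    ∫ y in posOrthant n, f y = ∫ x, ((∏ i, Real.exp (x i) : ℝ) : ℂ) * f (expMap x) := by
  rw [← image_expMap_univ, integral_image_eq_integral_abs_det_fderiv_smul volume .univ
    (fun x _ => (hasFDerivAt_expMap x).hasFDerivWithinAt) (injective_expMap n).injOn,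
    setIntegral_univ]
  simp only [abs_det_expMap, Complex.real_smul]

theorem integrableOn_posOrthant_iff {n : ℕ} (f : (Fin n → ℝ) → ℂ) :
    IntegrableOn f (posOrthant n) ↔
      Integrable fun x => ((∏ i, Real.exp (x i) : ℝ) : ℂ) * f (expMap x) := by
  rw [← image_expMap_univ, integrableOn_image_iff_integrableOn_abs_det_fderiv_smul volume .univ
    (fun x _ => (hasFDerivAt_expMap x).hasFDerivWithinAt) (injective_expMap n).injOn,
    integrableOn_univ]
  simp only [abs_det_expMap, Complex.real_smul]

theorem setIntegral_Ioi_eq_integral_exp (f : ℝ → ℂ) :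
    ∫ t in Set.Ioi (0 : ℝ), f t = ∫ x : ℝ, ((Real.exp x : ℝ) : ℂ) * f (Real.exp x) := by
  rw [← Real.range_exp, ← Set.image_univ, integral_image_eq_integral_abs_deriv_smul .univ
    (fun x _ => (Real.hasDerivAt_exp x).hasDerivWithinAt) Real.exp_injective.injOn,
    setIntegral_univ]
  simp [abs_of_pos (Real.exp_pos _)]

theorem integrableOn_Ioi_iff_integrable_exp (f : ℝ → ℂ) :
    IntegrableOn f (Set.Ioi (0 : ℝ)) ↔
      Integrable fun x : ℝ => ((Real.exp x : ℝ) : ℂ) * f (Real.exp x) := by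
  rw [← Real.range_exp, ← Set.image_univ, integrableOn_image_iff_integrableOn_abs_deriv_smul .univ
    (fun x _ => (Real.hasDerivAt_exp x).hasDerivWithinAt) Real.exp_injective.injOn,
    integrableOn_univ]
  simp [abs_of_pos (Real.exp_pos _)]

theorem ofReal_exp_cpow (x : ℝ) (v : ℂ) :
    ((Real.exp x : ℝ) : ℂ) ^ v = Complex.exp (v * x) := by
  rw [Complex.cpow_def_of_ne_zero (by exact_mod_cast (Real.exp_pos x).ne'), ← Complex.ofReal_log
    (Real.exp_pos x).le, Real.log_exp, mul_comm]

theorem gammaInt_eq {v : ℂ} (hv : 0 < v.re) : gammaInt v = Complex.Gammaℝ (2 * v) := by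
  have h := Complex.integral_cpow_mul_exp_neg_mul_Ioi hv Real.pi_pos
  rw [setIntegral_Ioi_eq_integral_exp] at h
  rw [Complex.Gammaℝ_def, gammaInt, show -(2 * v) / 2 = -v by ring, show 2 * v / 2 = v by ring,
    Complex.cpow_neg]
  rw [one_div, Complex.inv_cpow _ _ (by simp [Complex.arg_ofReal_of_nonneg Real.pi_pos.le,
    Real.pi_ne_zero.symm])] at h
  rw [← h]
  refine integral_congr_ae (.of_forall fun x => ?_)
  simp only [ofReal_exp_cpow]
  rw [Complex.ofReal_exp, ← Complex.exp_add, ← Complex.exp_add]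
  congr 1
  push_cast
  ring

theorem integrable_gammaInt {v : ℂ} (hv : 0 < v.re) :
    Integrable fun x : ℝ => Complex.exp (v * x - (π * Real.exp x : ℝ)) := by
  have h : IntegrableOn (fun t : ℝ => (t : ℂ) ^ (v - 1) * Complex.exp (-(π * t)))
      (Set.Ioi (0 : ℝ)) := by
    -- A non-integrable function has integral 0 by convention, but the value of this integral is a
    -- nonvanishing gamma factor.
    by_contra hc
    have h := Complex.integral_cpow_mul_exp_neg_mul_Ioi hv Real.pi_pos
    rw [integral_undef hc] at h
    refine mul_ne_zero ?_ (Complex.Gamma_ne_zero_of_re_pos hv) h.symm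
    simp [Complex.cpow_eq_zero_iff, Real.pi_ne_zero]
  rw [integrableOn_Ioi_iff_integrable_exp] at h
  refine h.congr (.of_forall fun x => ?_)
  simp only [ofReal_exp_cpow]
  rw [Complex.ofReal_exp, ← Complex.exp_add, ← Complex.exp_add]
  congr 1
  push_cast
  ring

theorem gammaLInt_ne_top {v : ℝ} (hv : 0 < v) : gammaLInt v ≠ ⊤ := by
  have h := (integrable_gammaInt (v := v) (by simpa using hv)).2
  rw [hasFiniteIntegral_iff_enorm] at h
  refine ne_of_lt (lt_of_eq_of_lt (lintegral_congr fun x => ?_) h)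
  rw [enorm_cexp, Complex.sub_re, Complex.re_mul_ofReal, Complex.ofReal_re, Complex.ofReal_re]

theorem gammaLInt_ne_zero (v : ℝ) : gammaLInt v ≠ 0 := by
  rw [gammaLInt, Ne, lintegral_eq_zero_iff (by fun_prop)]
  intro h
  obtain ⟨x, hx⟩ := h.exists
  exact ennexp_ne_zero _ hx

/-! ### Finiteness -/

/-- For t ≥ 0 the term e^{t-c} alone forces convergence, for t ≤ 0 the term e^{b-t} does; dropping
the other one leaves two gamma integrals. The summand 1 in the exponent |a| + N + 1 keeps it
positive, so that the gamma integral is finite. -/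
theorem lintegral_bessel_le {a N : ℝ} (hN : 0 ≤ N) (b c : ℝ) :
    ∫⁻ t : ℝ, ennexp (-a * t + N * |t| - π * (Real.exp (b - t) + Real.exp (t - c))) ≤
      2 * gammaLInt (|a| + N + 1) * ennexp ((|a| + N + 1) * (|b| + |c|)) := by
  set M := |a| + N + 1 with hM
  have hM0 : 0 ≤ M := by positivity
  calc _ ≤ ∫⁻ t : ℝ, (ennexp (M * t - π * Real.exp (t - c)) +
          ennexp (-M * t - π * Real.exp (b - t))) := by
        refine lintegral_mono fun t => ?_
        have h1 : -a * t ≤ |a| * |t| := by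
          rw [← abs_mul, neg_mul]
          exact neg_le_abs _
        have e1 := mul_pos Real.pi_pos (Real.exp_pos (b - t))
        have e2 := mul_pos Real.pi_pos (Real.exp_pos (t - c))
        have hMt : |a| * |t| + N * |t| ≤ M * |t| := by
          rw [hM]; nlinarith [abs_nonneg t]
        rcases le_total 0 t with ht | ht
        · refine le_trans (ennexp_le_ennexp ?_) le_self_add
          rw [abs_of_nonneg ht] at *
          linarith
        · refine le_trans (ennexp_le_ennexp ?_) le_add_self
          rw [abs_of_nonpos ht] at *
          linarith
    _ = ennexp (M * c) * gammaLInt M + ennexp (-M * b) * gammaLInt M := by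
        rw [lintegral_add_left (by fun_prop), lintegral_ennexp_mul_sub,
          lintegral_ennexp_mul_sub_neg, neg_neg]
    _ ≤ ennexp (M * (|b| + |c|)) * gammaLInt M + ennexp (M * (|b| + |c|)) * gammaLInt M := by
        gcongr
        · refine ennexp_le_ennexp (mul_le_mul_of_nonneg_left ?_ hM0)
          linarith [le_abs_self c, abs_nonneg b]
        · refine ennexp_le_ennexp ?_
          nlinarith [neg_le_abs b, abs_nonneg c]
    _ = _ := by ring

/-- Once the inner function is replaced by its exponential bound, the integrand is a product over
the coordinates of t, and each factor is a Bessel-type integral. The resulting bound is again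
exponential, which closes the induction; all that is used later is finiteness at every point. -/
theorem exists_todaL_le : ∀ (n : ℕ) (α : Fin n → ℝ), ∃ C : ENNReal, C ≠ ⊤ ∧ ∃ N : ℝ, 0 ≤ N ∧
    ∀ x, todaL n α x ≤ C * ennexp (N * ∑ i, |x i|)
  | 0, _ => ⟨1, ENNReal.one_ne_top, 0, le_rfl, fun x => by simp [todaL, ennexp_zero]⟩
  | n + 1, α => by
    obtain ⟨C, hC, N, hN, h⟩ := exists_todaL_le n (Fin.tail α)
    set M := |α 0| + N + 1 with hM
    have hM0 : 0 < M := by positivity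
    refine ⟨C * (2 * gammaLInt M) ^ n, ENNReal.mul_ne_top hC (ENNReal.pow_ne_top
      (ENNReal.mul_ne_top (by simp) (gammaLInt_ne_top hM0))), |α 0| + 2 * M, by positivity,
      fun x => ?_⟩
    calc todaL (n + 1) α x
        ≤ ∫⁻ t, raiseLKernel (α 0) x t * (C * ennexp (N * ∑ i, |t i|)) := by
          rw [todaL_succ]
          exact lintegral_mono fun t => mul_le_mul_right (h t) _
      _ = C * ennexp (α 0 * ∑ i, x i) * ∫⁻ t : Fin n → ℝ, ∏ i, ennexp (-α 0 * t i + N * |t i| -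
            π * (Real.exp (x i.castSucc - t i) + Real.exp (t i - x i.succ))) := by
          rw [← lintegral_const_mul _ (by fun_prop)]
          refine lintegral_congr fun t => ?_
          have hprod : ∀ g : Fin n → ℝ, ∏ i, ennexp (g i) = ennexp (∑ i, g i) := by
            intro g
            simp only [ennexp]
            rw [← ENNReal.ofReal_prod_of_nonneg fun i _ => (Real.exp_pos _).le, Real.exp_sum]
          rw [hprod, mul_assoc C, ← ennexp_add, mul_left_comm, raiseLKernel, ← ennexp_add]
          congr 2
          simp only [raisePot, Finset.sum_sub_distrib, Finset.sum_add_distrib, ← Finset.mul_sum]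
          ring
      _ ≤ C * ennexp (α 0 * ∑ i, x i) * ∏ i : Fin n, (2 * gammaLInt M *
            ennexp (M * (|x i.castSucc| + |x i.succ|))) := by
          rw [lintegral_pi_prod (fun (i : Fin n) (t : ℝ) => ennexp (-α 0 * t + N * |t| -
            π * (Real.exp (x i.castSucc - t) + Real.exp (t - x i.succ)))) fun i => by fun_prop]
          gcongr with i
          exact lintegral_bessel_le hN _ _
      _ ≤ _ := by
          have hprod : ∀ g : Fin n → ℝ, ∏ i, ennexp (g i) = ennexp (∑ i, g i) := by
            intro g
            simp only [ennexp]
            rw [← ENNReal.ofReal_prod_of_nonneg fun i _ => (Real.exp_pos _).le, Real.exp_sum]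
          rw [Finset.prod_mul_distrib, Finset.prod_const, hprod, Finset.card_univ,
            Fintype.card_fin, mul_mul_mul_comm, ← ennexp_add]
          gcongr
          refine ennexp_le_ennexp ?_
          have e1 := Fin.sum_univ_castSucc fun i => |x i|
          have e2 := Fin.sum_univ_succ fun i => |x i|
          have e3 : α 0 * ∑ i, x i ≤ |α 0| * ∑ i, |x i| := by
            refine (le_abs_self _).trans ?_
            rw [abs_mul]
            exact mul_le_mul_of_nonneg_left (Finset.abs_sum_le_sum_abs _ _) (abs_nonneg _)
          rw [← Finset.mul_sum, Finset.sum_add_distrib, add_mul]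
          have e4 : M * (∑ i : Fin n, |x i.castSucc| + ∑ i : Fin n, |x i.succ|) ≤
              M * (2 * ∑ i, |x i|) := by
            refine mul_le_mul_of_nonneg_left ?_ hM0.le
            linarith [abs_nonneg (x 0), abs_nonneg (x (Fin.last n))]
          linarith

theorem todaL_ne_top {n : ℕ} (α : Fin n → ℝ) (x : Fin n → ℝ) : todaL n α x ≠ ⊤ := by
  obtain ⟨C, hC, N, -, h⟩ := exists_todaL_le n α
  exact ne_top_of_le_ne_top (ENNReal.mul_ne_top hC (ennexp_ne_top _)) (h x)

/-! ### The Baxter eigenvalue equation for complex parameters -/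

theorem integrable_uncurry_of_enorm_le {X Y : Type*} [MeasureSpace X] [MeasureSpace Y]
    [SFinite (volume : Measure X)] [SFinite (volume : Measure Y)] {f : X → Y → ℂ}
    {g : X → Y → ENNReal} (hf : Measurable (Function.uncurry f))
    (hg : Measurable (Function.uncurry g)) (hle : ∀ x y, ‖f x y‖ₑ ≤ g x y)
    (hfin : ∫⁻ x, ∫⁻ y, g x y ≠ ⊤) :
    Integrable (Function.uncurry f) ((volume : Measure X).prod (volume : Measure Y)) := by
  refine ⟨hf.aestronglyMeasurable, ?_⟩
  rw [hasFiniteIntegral_iff_enorm]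
  refine lt_of_le_of_lt (lintegral_mono (g := Function.uncurry g) fun q => hle q.1 q.2) ?_
  rw [lintegral_prod _ hg.aemeasurable]
  exact hfin.lt_top

/-- Class one Whittaker functions are eigenfunctions of the Baxter operators. -/
theorem integral_baxterKernel_mul_toda (u : ℂ) : ∀ (n : ℕ) (α : Fin n → ℂ) (z : Fin n → ℝ),
    (∀ j, 0 < (u + α j).re) →
    ∫ x, baxterKernel u z x * toda n α x = (∏ j, gammaInt (u + α j)) * toda n α z
  | 0, α, z, _ => by simp [toda, baxterKernel, baxterPot, volume_pi, Measure.real]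
  | n + 1, α, z, hu => by
    -- By the nonnegative eigenvalue equation this is the double integral of the majorant in the
    -- first interchange; the second uses the product without its zeroth factor.
    have hfin : (∏ j, gammaLInt (u.re + (α j).re)) * todaL (n + 1) (fun i => (α i).re) z ≠ ⊤ :=
      ENNReal.mul_ne_top (ENNReal.prod_ne_top fun j _ => gammaLInt_ne_top (hu j))
        (todaL_ne_top _ _)
    have hmt := measurable_toda n (Fin.tail α)
    have hmt' := measurable_todaL n (fun i => (Fin.tail α i).re)
    have hk1 : Measurable fun q : (Fin (n + 1) → ℝ) × (Fin n → ℝ) => raiseKernel (α 0) q.1 q.2 :=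
      Continuous.measurable (by fun_prop)
    have hk2 : Measurable fun x : Fin (n + 1) → ℝ => baxterKernel u z x :=
      Continuous.measurable (by fun_prop)
    have hk3 : Measurable fun p : Fin n → ℝ => raiseKernel (α 0) z p :=
      Continuous.measurable (by fun_prop)
    have hk4 : Measurable fun q : (Fin n → ℝ) × (Fin n → ℝ) => baxterKernel u q.1 q.2 :=
      Continuous.measurable (by fun_prop)
    simp_rw [toda_succ]
    calc ∫ x, baxterKernel u z x * ∫ t, raiseKernel (α 0) x t * toda n (Fin.tail α) t
        = ∫ x, ∫ t, baxterKernel u z x * (raiseKernel (α 0) x t * toda n (Fin.tail α) t) := by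
          refine integral_congr_ae (.of_forall fun x => ?_)
          simp only
          rw [integral_const_mul]
      _ = ∫ t, ∫ x, baxterKernel u z x * (raiseKernel (α 0) x t * toda n (Fin.tail α) t) := by
          refine integral_integral_swap (integrable_uncurry_of_enorm_le
            (g := fun x t => baxterLKernel u.re z x * (raiseLKernel (α 0).re x t *
              todaL n (fun i => (Fin.tail α i).re) t)) ?_ ?_ (fun x t => ?_) ?_)
          · unfold Function.uncurry; fun_prop
          · unfold Function.uncurry; fun_prop
          · rw [enorm_mul, enorm_mul, enorm_raiseKernel, enorm_baxterKernel]
            gcongr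
            exact enorm_toda_le _ _ _
          · rw [← lintegral_baxterLKernel_mul_todaL] at hfin
            refine ne_of_eq_of_ne (lintegral_congr fun x => ?_) hfin
            rw [lintegral_const_mul _ (by fun_prop)]
            rfl
      _ = gammaInt (u + α 0) * ∫ t, ∫ p,
            (raiseKernel (α 0) z p * baxterKernel u p t) * toda n (Fin.tail α) t := by
          rw [← integral_const_mul]
          refine integral_congr_ae (.of_forall fun t => ?_)
          simp only
          simp_rw [← mul_assoc]
          rw [integral_mul_const, integral_mul_const, integral_baxterKernel_mul_raiseKernel,
            mul_assoc]
      _ = gammaInt (u + α 0) * ∫ p, ∫ t,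
            (raiseKernel (α 0) z p * baxterKernel u p t) * toda n (Fin.tail α) t := by
          congr 1
          refine (integral_integral_swap (integrable_uncurry_of_enorm_le
            (g := fun p t => (raiseLKernel (α 0).re z p * baxterLKernel u.re p t) *
              todaL n (fun i => (Fin.tail α i).re) t) ?_ ?_ (fun x t => ?_) ?_)).symm
          · unfold Function.uncurry; fun_prop
          · unfold Function.uncurry; fun_prop
          · rw [enorm_mul, enorm_mul, enorm_raiseKernel, enorm_baxterKernel]
            gcongr
            exact enorm_toda_le _ _ _
          · have hfin2 : (∏ j, gammaLInt (u.re + (Fin.tail α j).re)) *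
                todaL (n + 1) (fun i => (α i).re) z ≠ ⊤ :=
              ENNReal.mul_ne_top (ENNReal.prod_ne_top fun j _ => gammaLInt_ne_top (hu j.succ))
                (todaL_ne_top _ _)
            refine ne_of_eq_of_ne ?_ hfin2
            rw [todaL_succ, ← lintegral_const_mul _ (by fun_prop)]
            refine lintegral_congr fun p => ?_
            simp_rw [mul_assoc]
            rw [lintegral_const_mul _ (by fun_prop), lintegral_baxterLKernel_mul_todaL,
              mul_left_comm]
            rfl
      _ = gammaInt (u + α 0) * ∫ p, (∏ j, gammaInt (u + Fin.tail α j)) *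
            (raiseKernel (α 0) z p * toda n (Fin.tail α) p) := by
          congr 1
          refine integral_congr_ae (.of_forall fun p => ?_)
          simp only
          simp_rw [mul_assoc]
          rw [integral_const_mul, integral_baxterKernel_mul_toda u n (Fin.tail α) p fun j => hu j.succ]
          ring
      _ = _ := by
          rw [integral_const_mul, Fin.prod_univ_succ, mul_assoc]
          rfl

/-! ### The auxiliary integrals with values in `ℝ≥0∞` -/

/-- The vector without its last entry. -/
def dropLast {m : ℕ} (Z : Fin (m + 1) → ℝ) : Fin m → ℝ := fun i => Z i.castSucc

/-- The vector `(x, 0, ρ)`. -/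
def extendTwo {m : ℕ} (x : Fin m → ℝ) (ρ : ℝ) : Fin (m + 2) → ℝ :=
  Fin.snoc (α := fun _ => ℝ) (Fin.snoc (α := fun _ => ℝ) x 0) ρ

/-- The exponential of the last entry, or `0` for the empty vector. -/
def lastExp : {m : ℕ} → (Fin m → ℝ) → ℝ
  | 0, _ => 0
  | m + 1, z => Real.exp (z (Fin.last m))

@[fun_prop] theorem continuous_dropLast {m : ℕ} : Continuous (dropLast (m := m)) :=
  continuous_pi fun i => continuous_apply i.castSucc

@[fun_prop] theorem measurable_dropLast {m : ℕ} : Measurable (dropLast (m := m)) :=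
  continuous_dropLast.measurable

@[fun_prop] theorem continuous_lastExp : ∀ {m : ℕ}, Continuous (lastExp (m := m))
  | 0 => continuous_const
  | m + 1 => Real.continuous_exp.comp (continuous_apply (Fin.last m))

@[fun_prop] theorem measurable_lastExp {m : ℕ} : Measurable (lastExp (m := m)) :=
  continuous_lastExp.measurable

@[fun_prop] theorem continuous_extendTwo {m : ℕ} {X : Type*} [TopologicalSpace X]
    {f : X → Fin m → ℝ} {g : X → ℝ} (hf : Continuous f) (hg : Continuous g) :
    Continuous fun p => extendTwo (f p) (g p) :=
  Continuous.finSnoc (Continuous.finSnoc hf continuous_const) hg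

@[fun_prop] theorem measurable_extendTwo {m : ℕ} {X : Type*} [MeasurableSpace X]
    {f : X → Fin m → ℝ} {g : X → ℝ} (hf : Measurable f) (hg : Measurable g) :
    Measurable fun p => extendTwo (f p) (g p) := by
  have h : Continuous fun q : (Fin m → ℝ) × ℝ => extendTwo q.1 q.2 := by fun_prop
  exact h.measurable.comp (hf.prodMk hg)

@[simp] theorem sum_extendTwo {m : ℕ} (x : Fin m → ℝ) (ρ : ℝ) :
    ∑ i, extendTwo x ρ i = ∑ i, x i + ρ := by
  simp [extendTwo, Fin.sum_univ_castSucc]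

theorem sum_eq_sum_dropLast {m : ℕ} (Z : Fin (m + 1) → ℝ) :
    ∑ i, Z i = ∑ i, dropLast Z i + Z (Fin.last m) := Fin.sum_univ_castSucc Z

/-- The entry 0 cuts the chain: only the first m entries of Z interact with x, in the pattern of a
Baxter potential, and ρ interacts with the last entry of Z alone. -/
theorem raisePot_extendTwo {m : ℕ} (x : Fin m → ℝ) (ρ : ℝ) (Z : Fin (m + 1) → ℝ) :
    raisePot (extendTwo x ρ) Z = baxterPot (dropLast Z) x + (lastExp (dropLast Z) +
      Real.exp (-Z (Fin.last m)) + Real.exp (Z (Fin.last m) - ρ)) := by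
  cases m with
  | zero => simp [raisePot, baxterPot, lastExp, extendTwo, Fin.snoc]
  | succ m =>
    rw [baxterPot_succ, raisePot, Finset.sum_add_distrib, Fin.sum_univ_castSucc,
      Fin.sum_univ_castSucc (fun i => Real.exp (Z i - extendTwo x ρ i.succ)),
      Fin.sum_univ_castSucc (fun i : Fin (m + 1) => Real.exp (Z i.castSucc -
        extendTwo x ρ i.castSucc.succ))]
    simp only [extendTwo, dropLast, lastExp, Fin.snoc_castSucc, Fin.succ_last, Fin.snoc_last,
      Fin.succ_castSucc, sub_zero, zero_sub]
    ring

/-- The same cut with the roles exchanged: a Baxter potential at (x, 0, ρ) contains a raising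
potential in x, where Z now has one entry more. -/
theorem baxterPot_extendTwo {m : ℕ} (x : Fin m → ℝ) (ρ : ℝ) (Z : Fin (m + 2) → ℝ) :
    baxterPot (extendTwo x ρ) Z = raisePot (dropLast Z) x + (lastExp (dropLast Z) +
      Real.exp (-Z (Fin.last (m + 1))) + Real.exp (Z (Fin.last (m + 1)) - ρ)) := by
  rw [baxterPot_succ, Fin.sum_univ_castSucc, Fin.sum_univ_castSucc, Fin.sum_univ_castSucc,
    raisePot, Finset.sum_add_distrib]
  simp only [extendTwo, dropLast, lastExp, Fin.snoc_castSucc, Fin.succ_last, Fin.snoc_last,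
    Fin.succ_castSucc, sub_zero, zero_sub]
  ring

section Real

variable {m : ℕ}

/-- The zeta integral in logarithmic coordinates, with an additional parameter `ρ`. -/
def zetaL (σ : ℝ) (α : Fin (m + 2) → ℝ) (β : Fin m → ℝ) (ρ : ℝ) : ENNReal :=
  ∫⁻ x, todaL (m + 2) α (extendTwo x ρ) * todaL m β x * ennexp (σ * ∑ i, x i)

/-- What remains of `zetaL` when the first raising operator has been integrated out. -/
def zetaReducedL (σ : ℝ) (α : Fin (m + 2) → ℝ) (β : Fin m → ℝ) (ρ : ℝ) : ENNReal :=
  ∫⁻ Z, todaL (m + 1) (Fin.tail α) Z * todaL m β (dropLast Z) *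
    ennexp (σ * ∑ i, dropLast Z i + α 0 * (ρ - Z (Fin.last m)) - π * (lastExp (dropLast Z) +
      Real.exp (-Z (Fin.last m)) + Real.exp (Z (Fin.last m) - ρ)))

/-- The companion of `zetaMellinL` on `GL_{m+1} × GL_m`. -/
def companionL (σ ω : ℝ) (α : Fin (m + 1) → ℝ) (β : Fin m → ℝ) : ENNReal :=
  ∫⁻ Z, todaL (m + 1) α Z * todaL m β (dropLast Z) *
    ennexp (σ * ∑ i, dropLast Z i - ω * Z (Fin.last m) - π * (lastExp (dropLast Z) +
      Real.exp (-Z (Fin.last m))))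

/-- The two-sided Laplace transform of `zetaL`. -/
def zetaMellinL (σ ω : ℝ) (α : Fin (m + 2) → ℝ) (β : Fin m → ℝ) : ENNReal :=
  ∫⁻ ρ, ennexp (-ω * ρ) * zetaL σ α β ρ

theorem raise_exponent (σ a ρ : ℝ) (x : Fin m → ℝ) (Z : Fin (m + 1) → ℝ) :
    a * (∑ i, extendTwo x ρ i - ∑ i, Z i) - π * raisePot (extendTwo x ρ) Z + σ * ∑ i, x i =
      (σ + a) * (∑ i, x i - ∑ i, dropLast Z i) - π * baxterPot (dropLast Z) x +
      (σ * ∑ i, dropLast Z i + a * (ρ - Z (Fin.last m)) - π * (lastExp (dropLast Z) +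
      Real.exp (-Z (Fin.last m)) + Real.exp (Z (Fin.last m) - ρ))) := by
  rw [raisePot_extendTwo, sum_extendTwo, sum_eq_sum_dropLast]
  ring

theorem measurable_zetaL (σ : ℝ) (α : Fin (m + 2) → ℝ) (β : Fin m → ℝ) :
    Measurable (zetaL σ α β) :=
  Measurable.lintegral_prod_right' (f := fun q : ℝ × (Fin m → ℝ) =>
    todaL (m + 2) α (extendTwo q.2 q.1) * todaL m β q.2 * ennexp (σ * ∑ i, q.2 i)) (by fun_prop)

/-- After unfolding one raising operator, the x-integral is the Baxter operator with parameter σ + α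
0 applied to the function with parameters β, by `raisePot_extendTwo`; the product of gamma factors
is its eigenvalue. -/
theorem zetaL_eq (σ : ℝ) (α : Fin (m + 2) → ℝ) (β : Fin m → ℝ) (ρ : ℝ) :
    zetaL σ α β ρ = (∏ k, gammaLInt (σ + α 0 + β k)) * zetaReducedL σ α β ρ := by
  calc zetaL σ α β ρ
      = ∫⁻ x, ∫⁻ Z, raiseLKernel (α 0) (extendTwo x ρ) Z * todaL (m + 1) (Fin.tail α) Z *
          (todaL m β x * ennexp (σ * ∑ i, x i)) := by
        refine lintegral_congr fun x => ?_
        rw [todaL_succ, mul_assoc, lintegral_mul_const _ (by fun_prop)]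
    _ = ∫⁻ Z, ∫⁻ x, raiseLKernel (α 0) (extendTwo x ρ) Z * todaL (m + 1) (Fin.tail α) Z *
          (todaL m β x * ennexp (σ * ∑ i, x i)) :=
        lintegral_lintegral_swap (by unfold Function.uncurry; fun_prop)
    _ = _ := by
        rw [zetaReducedL, ← lintegral_const_mul _ (by fun_prop)]
        refine lintegral_congr fun Z => ?_
        have hcomm : ∀ P A B E : ENNReal, P * (A * B * E) = A * E * (P * B) := by
          intros; ring
        rw [hcomm, ← lintegral_baxterLKernel_mul_todaL, ← lintegral_const_mul _ (by fun_prop)]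
        refine lintegral_congr fun x => ?_
        have h := congrArg ennexp (raise_exponent σ (α 0) ρ x Z)
        rw [ennexp_add, ennexp_add] at h
        have hcomm2 : ∀ P A B E : ENNReal, P * A * (B * E) = A * B * (P * E) := by
          intros; ring
        rw [raiseLKernel, baxterLKernel, hcomm2, h]
        ring

/-- In the reduced integral ρ enters only through e^{(α 0 - ω)ρ - π e^{Z_last - ρ}}, so its integral
is a gamma function and replaces α 0 by ω in the exponent of Z_last. -/
theorem zetaMellinL_eq (σ ω : ℝ) (α : Fin (m + 2) → ℝ) (β : Fin m → ℝ) :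
    zetaMellinL σ ω α β = gammaLInt (ω - α 0) * (∏ k, gammaLInt (σ + α 0 + β k)) *
      companionL σ ω (Fin.tail α) β := by
  calc zetaMellinL σ ω α β
      = (∏ k, gammaLInt (σ + α 0 + β k)) * ∫⁻ ρ, ∫⁻ Z, ennexp (-ω * ρ) *
          (todaL (m + 1) (Fin.tail α) Z * todaL m β (dropLast Z) *
          ennexp (σ * ∑ i, dropLast Z i + α 0 * (ρ - Z (Fin.last m)) - π * (lastExp (dropLast Z) +
            Real.exp (-Z (Fin.last m)) + Real.exp (Z (Fin.last m) - ρ)))) := by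
        rw [zetaMellinL, ← lintegral_const_mul _ (Measurable.lintegral_prod_right (by fun_prop))]
        refine lintegral_congr fun ρ => ?_
        rw [zetaL_eq, zetaReducedL, mul_left_comm, lintegral_const_mul _ (by fun_prop)]
    _ = (∏ k, gammaLInt (σ + α 0 + β k)) * ∫⁻ Z, ∫⁻ ρ, ennexp (-ω * ρ) *
          (todaL (m + 1) (Fin.tail α) Z * todaL m β (dropLast Z) *
          ennexp (σ * ∑ i, dropLast Z i + α 0 * (ρ - Z (Fin.last m)) - π * (lastExp (dropLast Z) +
            Real.exp (-Z (Fin.last m)) + Real.exp (Z (Fin.last m) - ρ)))) := by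
        rw [lintegral_lintegral_swap]
        unfold Function.uncurry; fun_prop
    _ = _ := by
        rw [mul_comm (gammaLInt _), mul_assoc, companionL]
        congr 1
        rw [← lintegral_const_mul _ (by fun_prop)]
        refine lintegral_congr fun Z => ?_
        have h := lintegral_ennexp_mul_sub_neg (α 0 - ω) (Z (Fin.last m))
        rw [neg_sub] at h
        have hcomm : ∀ P A B E : ENNReal, P * (A * B * E) = A * B * (E * P) := by
          intros; ring
        have hE : ∀ ρ : ℝ, ennexp (σ * ∑ i, dropLast Z i + α 0 * (ρ - Z (Fin.last m)) -
            π * (lastExp (dropLast Z) + Real.exp (-Z (Fin.last m)) +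
            Real.exp (Z (Fin.last m) - ρ))) * ennexp (-ω * ρ) =
            ennexp (σ * ∑ i, dropLast Z i - α 0 * Z (Fin.last m) - π * (lastExp (dropLast Z) +
              Real.exp (-Z (Fin.last m)))) *
            ennexp ((α 0 - ω) * ρ - π * Real.exp (Z (Fin.last m) - ρ)) := by
          intro ρ
          rw [← ennexp_add, ← ennexp_add]
          congr 1
          ring
        simp_rw [hcomm, hE]
        rw [lintegral_const_mul _ (by fun_prop), lintegral_const_mul _ (by fun_prop), h]
        have e : ennexp (σ * ∑ i, dropLast Z i - α 0 * Z (Fin.last m) - π * (lastExp (dropLast Z) +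
              Real.exp (-Z (Fin.last m)))) * ennexp ((α 0 - ω) * Z (Fin.last m)) =
            ennexp (σ * ∑ i, dropLast Z i - ω * Z (Fin.last m) - π * (lastExp (dropLast Z) +
              Real.exp (-Z (Fin.last m)))) := by
          rw [← ennexp_add]
          congr 1
          ring
        rw [← e]
        ring

theorem baxter_exponent (σ ω b q : ℝ) (u : Fin m → ℝ) (Z : Fin (m + 2) → ℝ) :
    (σ + b) * (∑ i, Z i - ∑ i, extendTwo u q i) - π * baxterPot (extendTwo u q) Z +
      (σ * ∑ i, u i - ω * q) =
      b * (∑ i, dropLast Z i - ∑ i, u i) - π * raisePot (dropLast Z) u +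
      ((-(σ + ω + b)) * q - π * Real.exp (Z (Fin.last (m + 1)) - q)) +
      (σ * ∑ i, dropLast Z i + (σ + b) * Z (Fin.last (m + 1)) - π * (lastExp (dropLast Z) +
        Real.exp (-Z (Fin.last (m + 1))))) := by
  rw [baxterPot_extendTwo, sum_extendTwo, sum_eq_sum_dropLast Z]
  ring

theorem lintegral_companionL (σ ω : ℝ) (α : Fin (m + 2) → ℝ) (β : Fin (m + 1) → ℝ) :
    ∫⁻ Z, ∫⁻ q, todaL (m + 2) α Z * todaL (m + 1) β (dropLast Z) *
          (ennexp ((-(σ + ω + β 0)) * q - π * Real.exp (Z (Fin.last (m + 1)) - q)) *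
          ennexp (σ * ∑ i, dropLast Z i + (σ + β 0) * Z (Fin.last (m + 1)) -
            π * (lastExp (dropLast Z) + Real.exp (-Z (Fin.last (m + 1)))))) =
      gammaLInt (σ + ω + β 0) * companionL σ ω α β := by
    rw [companionL, ← lintegral_const_mul _ (by fun_prop)]
    refine lintegral_congr fun Z => ?_
    rw [lintegral_const_mul _ (by fun_prop), lintegral_mul_const _ (by fun_prop),
      lintegral_ennexp_mul_sub_neg, neg_neg, mul_comm (ennexp _) (gammaLInt _),
      mul_assoc (gammaLInt _), ← ennexp_add, mul_left_comm]
    congr 3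
    ring

/-- Multiplying by the eigenvalue reinstates a Baxter integral over Z at the point (u, 0, q). By
`baxterPot_extendTwo` the u-integral then becomes the raising operator with parameter β 0, which
rebuilds the function with all of β, and the q-integral gives the gamma factor on the left. -/
theorem companionL_succ (σ ω : ℝ) (α : Fin (m + 2) → ℝ) (β : Fin (m + 1) → ℝ) :
    gammaLInt (σ + ω + β 0) * companionL σ ω α β =
      (∏ j, gammaLInt (σ + β 0 + α j)) * zetaMellinL σ ω α (Fin.tail β) := by
  symm
  calc (∏ j, gammaLInt (σ + β 0 + α j)) * zetaMellinL σ ω α (Fin.tail β)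
      = ∫⁻ q, ∫⁻ u, ∫⁻ Z, (baxterLKernel (σ + β 0) (extendTwo u q) Z *
          ennexp (σ * ∑ i, u i - ω * q)) * (todaL (m + 2) α Z * todaL m (Fin.tail β) u) := by
        have hm := measurable_zetaL σ α (Fin.tail β)
        rw [zetaMellinL, ← lintegral_const_mul _ (by fun_prop)]
        refine lintegral_congr fun q => ?_
        rw [zetaL, mul_left_comm, ← lintegral_const_mul _ (by fun_prop),
          ← lintegral_const_mul _ (by fun_prop)]
        refine lintegral_congr fun u => ?_
        have hcomm : ∀ A B C E : ENNReal, E * (A * (B * C)) = E * C * (A * B) := by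
          intros; ring
        rw [mul_assoc (todaL _ _ _), ← mul_assoc (∏ j, _), ← lintegral_baxterLKernel_mul_todaL,
          hcomm, ← mul_assoc, mul_comm, ← mul_assoc, ← lintegral_const_mul _ (by fun_prop)]
        refine lintegral_congr fun Z => ?_
        rw [sub_eq_add_neg, ennexp_add, neg_mul]
        ring
    _ = ∫⁻ q, ∫⁻ Z, ∫⁻ u, (baxterLKernel (σ + β 0) (extendTwo u q) Z *
          ennexp (σ * ∑ i, u i - ω * q)) * (todaL (m + 2) α Z * todaL m (Fin.tail β) u) := by
        refine lintegral_congr fun q => ?_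
        rw [lintegral_lintegral_swap]
        unfold Function.uncurry; fun_prop
    _ = ∫⁻ q, ∫⁻ Z, todaL (m + 2) α Z * todaL (m + 1) β (dropLast Z) *
          (ennexp ((-(σ + ω + β 0)) * q - π * Real.exp (Z (Fin.last (m + 1)) - q)) *
          ennexp (σ * ∑ i, dropLast Z i + (σ + β 0) * Z (Fin.last (m + 1)) -
            π * (lastExp (dropLast Z) + Real.exp (-Z (Fin.last (m + 1)))))) := by
        refine lintegral_congr fun q => lintegral_congr fun Z => ?_
        rw [todaL_succ β, mul_right_comm, ← lintegral_const_mul _ (by fun_prop)]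
        refine lintegral_congr fun u => ?_
        have h := congrArg ennexp (baxter_exponent σ ω (β 0) q u Z)
        rw [ennexp_add, ennexp_add, ennexp_add] at h
        rw [baxterLKernel, h, raiseLKernel]
        ring
    _ = ∫⁻ Z, ∫⁻ q, todaL (m + 2) α Z * todaL (m + 1) β (dropLast Z) *
          (ennexp ((-(σ + ω + β 0)) * q - π * Real.exp (Z (Fin.last (m + 1)) - q)) *
          ennexp (σ * ∑ i, dropLast Z i + (σ + β 0) * Z (Fin.last (m + 1)) -
            π * (lastExp (dropLast Z) + Real.exp (-Z (Fin.last (m + 1)))))) := by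
        rw [lintegral_lintegral_swap]
        unfold Function.uncurry; fun_prop
    _ = _ := lintegral_companionL σ ω α β

theorem companionL_zero (σ ω : ℝ) (α : Fin 1 → ℝ) (β : Fin 0 → ℝ) :
    companionL σ ω α β = gammaLInt (ω - α 0) := by
  rw [companionL, gammaLInt_neg, lintegral_cons]
  have h := lintegral_prod_mul (μ := (volume : Measure ℝ)) (ν := (volume : Measure (Fin 0 → ℝ)))
    (f := fun x => ennexp ((ω - α 0) * (-x) - π * Real.exp (-x))) (g := fun _ => 1)
    (by fun_prop) (by fun_prop)
  simp only [mul_one, lintegral_const, one_mul] at h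
  rw [show (volume : Measure (Fin 0 → ℝ)) Set.univ = 1 by simp [volume_pi], mul_one] at h
  rw [← h]
  refine lintegral_congr fun q => ?_
  have hl : Fin.last 0 = 0 := rfl
  simp only [todaL, raiseLKernel, raisePot, lastExp, volume_pi]
  simp [hl, ← ennexp_add]
  congr 1
  ring

/-- `companionL_succ` and `zetaMellinL_eq` reduce to one α and one β fewer. The gamma factor
multiplying the companion is nonzero, so an infinite companion would make the finite right-hand side
infinite. -/
theorem companionL_ne_top : ∀ {m : ℕ} {σ ω : ℝ} {α : Fin (m + 1) → ℝ} {β : Fin m → ℝ},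
    (∀ j k, 0 < σ + α j + β k) → (∀ j, α j < ω) → companionL σ ω α β ≠ ⊤
  | 0, σ, ω, α, β, _, hω => by
    rw [companionL_zero]
    exact gammaLInt_ne_top (sub_pos.mpr (hω 0))
  | m + 1, σ, ω, α, β, hσ, hω => by
    have h1 : zetaMellinL σ ω α (Fin.tail β) ≠ ⊤ := by
      rw [zetaMellinL_eq]
      refine ENNReal.mul_ne_top (ENNReal.mul_ne_top (gammaLInt_ne_top (sub_pos.mpr (hω 0)))
        (ENNReal.prod_ne_top fun k _ => gammaLInt_ne_top (hσ 0 k.succ))) ?_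
      exact companionL_ne_top (fun j k => hσ j.succ k.succ) fun j => hω j.succ
    have h2 : (∏ j, gammaLInt (σ + β 0 + α j)) * zetaMellinL σ ω α (Fin.tail β) ≠ ⊤ := by
      refine ENNReal.mul_ne_top (ENNReal.prod_ne_top fun j _ => gammaLInt_ne_top ?_) h1
      linarith [hσ j 0]
    rw [← companionL_succ] at h2
    intro h
    rw [h, ENNReal.mul_top (gammaLInt_ne_zero _)] at h2
    exact h2 rfl

theorem zetaMellinL_ne_top {σ ω : ℝ} {α : Fin (m + 2) → ℝ} {β : Fin m → ℝ}
    (hσ : ∀ j k, 0 < σ + α j + β k) (hω : ∀ j, α j < ω) : zetaMellinL σ ω α β ≠ ⊤ := by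
  rw [zetaMellinL_eq]
  refine ENNReal.mul_ne_top (ENNReal.mul_ne_top (gammaLInt_ne_top (sub_pos.mpr (hω 0)))
    (ENNReal.prod_ne_top fun k _ => gammaLInt_ne_top (hσ 0 k))) ?_
  exact companionL_ne_top (fun j k => hσ j.succ k) fun j => hω j.succ

end Real

/-! ### The auxiliary integrals with complex parameters -/

@[fun_prop] theorem measurable_raiseKernel {n : ℕ} (a : ℂ) {X : Type*} [MeasurableSpace X]
    {f : X → Fin (n + 1) → ℝ} {g : X → Fin n → ℝ} (hf : Measurable f) (hg : Measurable g) :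
    Measurable fun p => raiseKernel a (f p) (g p) := by
  have h : Continuous fun q : (Fin (n + 1) → ℝ) × (Fin n → ℝ) => raiseKernel a q.1 q.2 := by
    fun_prop
  have h2 := h.measurable
  change Measurable ((fun q : (Fin (n + 1) → ℝ) × (Fin n → ℝ) => raiseKernel a q.1 q.2) ∘
    fun p => (f p, g p))
  exact h2.comp (hf.prodMk hg)

@[fun_prop] theorem measurable_baxterKernel {n : ℕ} (a : ℂ) {X : Type*} [MeasurableSpace X]
    {f : X → Fin n → ℝ} {g : X → Fin n → ℝ} (hf : Measurable f) (hg : Measurable g) :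
    Measurable fun p => baxterKernel a (f p) (g p) := by
  have h : Continuous fun q : (Fin n → ℝ) × (Fin n → ℝ) => baxterKernel a q.1 q.2 := by
    fun_prop
  have h2 := h.measurable
  change Measurable ((fun q : (Fin n → ℝ) × (Fin n → ℝ) => baxterKernel a q.1 q.2) ∘
    fun p => (f p, g p))
  exact h2.comp (hf.prodMk hg)

theorem mul_sub_pi_mul_exp_le {k : ℝ} (hk : 0 < k) (y : ℝ) :
    k * y - π * Real.exp y ≤ k * Real.log k := by
  have h := Real.add_one_le_exp (y - Real.log k)
  rw [Real.exp_sub, Real.exp_log hk, le_div_iff₀ hk] at h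
  have h2 : Real.exp y ≤ π * Real.exp y :=
    le_mul_of_one_le_left (Real.exp_pos y).le (by linarith [Real.pi_gt_three])
  linarith

/-- With y = r - ρ, the term -π e^y absorbs the linear term (ω - a) y up to a constant. This
compares the reduced integrand at a fixed ρ with the integrand of the companion. -/
theorem reduced_exponent_le {a ω : ℝ} (h : a < ω) (s ρ r E : ℝ) :
    s + a * (ρ - r) - π * (E + Real.exp (-r) + Real.exp (r - ρ)) ≤
      ((ω - a) * Real.log (ω - a) + ω * ρ) + (s - ω * r - π * (E + Real.exp (-r))) := by
  have := mul_sub_pi_mul_exp_le (sub_pos.mpr h) (r - ρ)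
  linarith

section

variable {m : ℕ}

theorem exists_gt_re (α : Fin (m + 1) → ℝ) : ∃ ω : ℝ, ∀ j, α j < ω := by
  obtain ⟨ω, h⟩ := (Set.finite_range α).bddAbove
  exact ⟨ω + 1, fun j => lt_of_le_of_lt (h ⟨j, rfl⟩) (lt_add_one ω)⟩

/-- A finite Laplace transform would give finiteness only for almost every ρ, whereas the value at ρ
= 0 is wanted; hence the pointwise comparison with the companion. -/
theorem zetaReducedL_ne_top {σ : ℝ} {α : Fin (m + 2) → ℝ} {β : Fin m → ℝ}
    (hσ : ∀ j k, 0 < σ + α j + β k) (ρ : ℝ) : zetaReducedL σ α β ρ ≠ ⊤ := by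
  obtain ⟨ω, hω⟩ := exists_gt_re α
  have h : companionL σ ω (Fin.tail α) β ≠ ⊤ :=
    companionL_ne_top (fun j k => hσ j.succ k) fun j => hω j.succ
  refine ne_top_of_le_ne_top (ENNReal.mul_ne_top (ennexp_ne_top
    ((ω - α 0) * Real.log (ω - α 0) + ω * ρ)) h) ?_
  rw [companionL, ← lintegral_const_mul _ (by fun_prop), zetaReducedL]
  refine lintegral_mono fun Z => ?_
  rw [mul_left_comm, ← ennexp_add]
  exact mul_le_mul_right (ennexp_le_ennexp (reduced_exponent_le (hω 0) _ _ _ _)) _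

theorem zetaL_ne_top {σ : ℝ} {α : Fin (m + 2) → ℝ} {β : Fin m → ℝ}
    (hσ : ∀ j k, 0 < σ + α j + β k) (ρ : ℝ) : zetaL σ α β ρ ≠ ⊤ := by
  rw [zetaL_eq]
  exact ENNReal.mul_ne_top (ENNReal.prod_ne_top fun k _ => gammaLInt_ne_top (hσ 0 k))
    (zetaReducedL_ne_top hσ ρ)

/-- The zeta integral in logarithmic coordinates, with an additional parameter `ρ`. -/
def zetaLog (σ : ℂ) (α : Fin (m + 2) → ℂ) (β : Fin m → ℂ) (ρ : ℝ) : ℂ :=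
  ∫ x, toda (m + 2) α (extendTwo x ρ) * toda m β x * Complex.exp (σ * (∑ i, x i : ℝ))

/-- What remains of `zetaLog` when the first raising operator has been integrated out. -/
def zetaReduced (σ : ℂ) (α : Fin (m + 2) → ℂ) (β : Fin m → ℂ) (ρ : ℝ) : ℂ :=
  ∫ Z, toda (m + 1) (Fin.tail α) Z * toda m β (dropLast Z) *
    Complex.exp (σ * (∑ i, dropLast Z i : ℝ) + α 0 * (ρ - Z (Fin.last m) : ℝ) -
      (π * (lastExp (dropLast Z) + Real.exp (-Z (Fin.last m)) +
        Real.exp (Z (Fin.last m) - ρ)) : ℝ))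

/-- The companion of `zetaMellin` on `GL_{m+1} × GL_m`. -/
def companion (σ ω : ℂ) (α : Fin (m + 1) → ℂ) (β : Fin m → ℂ) : ℂ :=
  ∫ Z, toda (m + 1) α Z * toda m β (dropLast Z) *
    Complex.exp (σ * (∑ i, dropLast Z i : ℝ) - ω * (Z (Fin.last m) : ℝ) -
      (π * (lastExp (dropLast Z) + Real.exp (-Z (Fin.last m))) : ℝ))

/-- The two-sided Laplace transform of `zetaLog`. -/
def zetaMellin (σ ω : ℂ) (α : Fin (m + 2) → ℂ) (β : Fin m → ℂ) : ℂ :=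
  ∫ ρ : ℝ, Complex.exp (-ω * ρ) * zetaLog σ α β ρ

theorem enorm_toda_mul_toda_mul_cexp_le {n : ℕ} (α : Fin n → ℂ) (β : Fin m → ℂ) (x : Fin n → ℝ)
    (y : Fin m → ℝ) (z : ℂ) :
    ‖toda n α x * toda m β y * Complex.exp z‖ₑ ≤
      todaL n (fun i => (α i).re) x * todaL m (fun i => (β i).re) y * ennexp z.re := by
  rw [enorm_mul, enorm_mul, enorm_cexp]
  gcongr
  · exact enorm_toda_le _ _ _
  · exact enorm_toda_le _ _ _

theorem enorm_zetaLog_le (σ : ℂ) (α : Fin (m + 2) → ℂ) (β : Fin m → ℂ) (ρ : ℝ) :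
    ‖zetaLog σ α β ρ‖ₑ ≤ zetaL σ.re (fun i => (α i).re) (fun i => (β i).re) ρ := by
  refine (enorm_integral_le_lintegral_enorm _).trans (lintegral_mono fun x => ?_)
  refine (enorm_toda_mul_toda_mul_cexp_le _ _ _ _ _).trans_eq ?_
  rw [Complex.re_mul_ofReal]

theorem integrable_zetaLog {σ : ℂ} {α : Fin (m + 2) → ℂ} {β : Fin m → ℂ}
    (hσ : ∀ j k, 0 < (σ + α j + β k).re) (ρ : ℝ) :
    Integrable fun x => toda (m + 2) α (extendTwo x ρ) * toda m β x *
      Complex.exp (σ * (∑ i, x i : ℝ)) := by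
  refine ⟨Measurable.aestronglyMeasurable (by fun_prop), ?_⟩
  rw [hasFiniteIntegral_iff_enorm]
  refine lt_of_le_of_lt (lintegral_mono fun x => enorm_toda_mul_toda_mul_cexp_le _ _ _ _ _) ?_
  simp only [Complex.re_mul_ofReal]
  exact (zetaL_ne_top hσ ρ).lt_top

/-- The computation of `zetaL_eq`, with Fubini justified by finiteness of `zetaL`. -/
theorem zetaLog_eq {σ : ℂ} {α : Fin (m + 2) → ℂ} {β : Fin m → ℂ}
    (hσ : ∀ j k, 0 < (σ + α j + β k).re) (ρ : ℝ) :
    zetaLog σ α β ρ = (∏ k, gammaInt (σ + α 0 + β k)) * zetaReduced σ α β ρ := by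
  calc zetaLog σ α β ρ
      = ∫ x, ∫ Z, raiseKernel (α 0) (extendTwo x ρ) Z * toda (m + 1) (Fin.tail α) Z *
          (toda m β x * Complex.exp (σ * (∑ i, x i : ℝ))) := by
        refine integral_congr_ae (.of_forall fun x => ?_)
        simp only
        rw [toda_succ, mul_assoc, integral_mul_const]
    _ = ∫ Z, ∫ x, raiseKernel (α 0) (extendTwo x ρ) Z * toda (m + 1) (Fin.tail α) Z *
          (toda m β x * Complex.exp (σ * (∑ i, x i : ℝ))) := by
        refine integral_integral_swap (integrable_uncurry_of_enorm_le
          (g := fun x Z => raiseLKernel (α 0).re (extendTwo x ρ) Z *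
            todaL (m + 1) (fun i => (Fin.tail α i).re) Z *
            (todaL m (fun i => (β i).re) x * ennexp (σ.re * ∑ i, x i))) ?_ ?_
          (fun x Z => ?_) ?_)
        · unfold Function.uncurry; fun_prop
        · unfold Function.uncurry; fun_prop
        · rw [enorm_mul, enorm_mul, enorm_mul, enorm_raiseKernel, enorm_cexp,
            Complex.re_mul_ofReal]
          gcongr
          · exact enorm_toda_le _ _ _
          · exact enorm_toda_le _ _ _
        · refine ne_of_eq_of_ne ?_ (zetaL_ne_top (σ := σ.re) (α := fun i => (α i).re)
            (β := fun i => (β i).re) hσ ρ)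
          refine lintegral_congr fun x => ?_
          rw [todaL_succ, mul_assoc, lintegral_mul_const _ (by fun_prop)]
          rfl
    _ = _ := by
        rw [zetaReduced, ← integral_const_mul]
        refine integral_congr_ae (.of_forall fun Z => ?_)
        have hcomm : ∀ P A B E : ℂ, P * (A * B * E) = A * E * (P * B) := by
          intros; ring
        simp only
        rw [hcomm, ← integral_baxterKernel_mul_toda _ _ _ _ fun k => hσ 0 k, ← integral_const_mul]
        refine integral_congr_ae (.of_forall fun x => ?_)
        have hx : raiseKernel (α 0) (extendTwo x ρ) Z * Complex.exp (σ * (∑ i, x i : ℝ)) =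
            baxterKernel (σ + α 0) (dropLast Z) x *
            Complex.exp (σ * (∑ i, dropLast Z i : ℝ) + α 0 * (ρ - Z (Fin.last m) : ℝ) -
              (π * (lastExp (dropLast Z) + Real.exp (-Z (Fin.last m)) +
              Real.exp (Z (Fin.last m) - ρ)) : ℝ)) := by
          rw [raiseKernel, baxterKernel, ← Complex.exp_add, ← Complex.exp_add, sum_extendTwo,
            sum_eq_sum_dropLast Z, raisePot_extendTwo]
          congr 1
          push_cast
          ring
        simp only
        linear_combination (toda (m + 1) (Fin.tail α) Z * toda m β x) * hx

theorem zetaMellin_eq {σ ω : ℂ} {α : Fin (m + 2) → ℂ} {β : Fin m → ℂ}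
    (hσ : ∀ j k, 0 < (σ + α j + β k).re) (hω : ∀ j, (α j).re < ω.re) :
    zetaMellin σ ω α β = gammaInt (ω - α 0) * (∏ k, gammaInt (σ + α 0 + β k)) *
      companion σ ω (Fin.tail α) β := by
  calc zetaMellin σ ω α β
      = (∏ k, gammaInt (σ + α 0 + β k)) * ∫ ρ : ℝ, ∫ Z, Complex.exp (-ω * ρ) *
          (toda (m + 1) (Fin.tail α) Z * toda m β (dropLast Z) *
          Complex.exp (σ * (∑ i, dropLast Z i : ℝ) + α 0 * (ρ - Z (Fin.last m) : ℝ) -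
              (π * (lastExp (dropLast Z) + Real.exp (-Z (Fin.last m)) +
              Real.exp (Z (Fin.last m) - ρ)) : ℝ))) := by
        rw [zetaMellin, ← integral_const_mul]
        refine integral_congr_ae (.of_forall fun ρ => ?_)
        simp only
        rw [zetaLog_eq hσ, zetaReduced, mul_left_comm, integral_const_mul]
    _ = (∏ k, gammaInt (σ + α 0 + β k)) * ∫ Z, ∫ ρ : ℝ, Complex.exp (-ω * ρ) *
          (toda (m + 1) (Fin.tail α) Z * toda m β (dropLast Z) *
          Complex.exp (σ * (∑ i, dropLast Z i : ℝ) + α 0 * (ρ - Z (Fin.last m) : ℝ) -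
              (π * (lastExp (dropLast Z) + Real.exp (-Z (Fin.last m)) +
              Real.exp (Z (Fin.last m) - ρ)) : ℝ))) := by
        congr 1
        refine integral_integral_swap (integrable_uncurry_of_enorm_le
          (g := fun ρ Z => ennexp (-ω.re * ρ) *
            (todaL (m + 1) (fun i => (Fin.tail α i).re) Z *
            todaL m (fun i => (β i).re) (dropLast Z) *
          ennexp (σ.re * ∑ i, dropLast Z i + (α 0).re * (ρ - Z (Fin.last m)) -
            π * (lastExp (dropLast Z) +
            Real.exp (-Z (Fin.last m)) + Real.exp (Z (Fin.last m) - ρ))))) ?_ ?_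
          (fun ρ Z => ?_) ?_)
        · unfold Function.uncurry; fun_prop
        · unfold Function.uncurry; fun_prop
        · rw [enorm_mul, enorm_cexp, Complex.re_mul_ofReal, Complex.neg_re]
          gcongr
          refine (enorm_toda_mul_toda_mul_cexp_le _ _ _ _ _).trans_eq ?_
          rw [Complex.sub_re, Complex.add_re, Complex.re_mul_ofReal, Complex.re_mul_ofReal,
            Complex.ofReal_re]
        · have h := zetaMellinL_ne_top (σ := σ.re) (ω := ω.re) (α := fun i => (α i).re)
            (β := fun i => (β i).re) hσ hω
          -- The double integral of the majorant, multiplied by nonzero gamma factors, is the finite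
          -- `zetaMellinL`, hence is itself finite.
          refine (ENNReal.lt_top_of_mul_ne_top_right
            (a := ∏ k, gammaLInt (σ.re + (α 0).re + (β k).re)) (ne_of_eq_of_ne ?_ h)
            (Finset.prod_ne_zero_iff.mpr fun k _ => gammaLInt_ne_zero _)).ne
          rw [zetaMellinL, ← lintegral_const_mul _ (Measurable.lintegral_prod_right (by fun_prop))]
          refine lintegral_congr fun ρ => ?_
          rw [zetaL_eq, zetaReducedL, mul_left_comm, lintegral_const_mul _ (by fun_prop)]
          rfl
    _ = _ := by
        rw [mul_comm (gammaInt _), mul_assoc, companion]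
        congr 1
        rw [← integral_const_mul]
        refine integral_congr_ae (.of_forall fun Z => ?_)
        have h := integral_cexp_mul_sub_neg (α 0 - ω) (Z (Fin.last m))
        rw [neg_sub] at h
        have hE : ∀ ρ : ℝ, Complex.exp (-ω * ρ) *
            (toda (m + 1) (Fin.tail α) Z * toda m β (dropLast Z) *
            Complex.exp (σ * (∑ i, dropLast Z i : ℝ) + α 0 * (ρ - Z (Fin.last m) : ℝ) -
              (π * (lastExp (dropLast Z) + Real.exp (-Z (Fin.last m)) +
              Real.exp (Z (Fin.last m) - ρ)) : ℝ))) =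
            (toda (m + 1) (Fin.tail α) Z * toda m β (dropLast Z)) *
            Complex.exp (σ * (∑ i, dropLast Z i : ℝ) - α 0 * (Z (Fin.last m) : ℝ) -
              (π * (lastExp (dropLast Z) + Real.exp (-Z (Fin.last m))) : ℝ)) *
            Complex.exp ((α 0 - ω) * ρ - (π * Real.exp (Z (Fin.last m) - ρ) : ℝ)) := by
          intro ρ
          rw [mul_left_comm, ← Complex.exp_add, mul_assoc (toda _ _ _ * toda _ _ _),
            ← Complex.exp_add]
          congr 2
          push_cast
          ring
        simp only [hE]
        rw [integral_const_mul, h]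
        have e : Complex.exp (σ * (∑ i, dropLast Z i : ℝ) - α 0 * (Z (Fin.last m) : ℝ) -
              (π * (lastExp (dropLast Z) + Real.exp (-Z (Fin.last m))) : ℝ)) *
            Complex.exp ((α 0 - ω) * (Z (Fin.last m) : ℝ)) =
            Complex.exp (σ * (∑ i, dropLast Z i : ℝ) - ω * (Z (Fin.last m) : ℝ) -
              (π * (lastExp (dropLast Z) + Real.exp (-Z (Fin.last m))) : ℝ)) := by
          rw [← Complex.exp_add]
          congr 1
          ring
        rw [← e]
        ring

end

section

variable {m : ℕ}

theorem companion_succ {σ ω : ℂ} {α : Fin (m + 2) → ℂ} {β : Fin (m + 1) → ℂ}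
    (hσ : ∀ j k, 0 < (σ + α j + β k).re) (hω : ∀ j, (α j).re < ω.re) :
    gammaInt (σ + ω + β 0) * companion σ ω α β =
      (∏ j, gammaInt (σ + β 0 + α j)) * zetaMellin σ ω α (Fin.tail β) := by
  have hσβ : ∀ j, 0 < (σ + β 0 + α j).re := fun j => by
    rw [add_right_comm]; exact hσ j 0
  symm
  calc (∏ j, gammaInt (σ + β 0 + α j)) * zetaMellin σ ω α (Fin.tail β)
      = ∫ q : ℝ, ∫ u, ∫ Z, (baxterKernel (σ + β 0) (extendTwo u q) Z *
          Complex.exp (σ * (∑ i, u i : ℝ) - ω * q)) *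
          (toda (m + 2) α Z * toda m (Fin.tail β) u) := by
        rw [zetaMellin, ← integral_const_mul]
        refine integral_congr_ae (.of_forall fun q => ?_)
        simp only
        rw [zetaLog, mul_left_comm, ← integral_const_mul, ← integral_const_mul]
        refine integral_congr_ae (.of_forall fun u => ?_)
        have hcomm : ∀ P A B C E : ℂ, E * (P * (A * B * C)) = (P * A) * (E * (B * C)) := by
          intros; ring
        simp only
        rw [hcomm, ← integral_baxterKernel_mul_toda _ _ _ _ hσβ, ← integral_mul_const]
        refine integral_congr_ae (.of_forall fun Z => ?_)
        simp only
        rw [sub_eq_add_neg, Complex.exp_add, neg_mul]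
        ring
    _ = ∫ q : ℝ, ∫ Z, ∫ u, (baxterKernel (σ + β 0) (extendTwo u q) Z *
          Complex.exp (σ * (∑ i, u i : ℝ) - ω * q)) *
          (toda (m + 2) α Z * toda m (Fin.tail β) u) := by
        refine integral_congr_ae (.of_forall fun q => ?_)
        refine integral_integral_swap (integrable_uncurry_of_enorm_le
          (g := fun u Z => (baxterLKernel (σ.re + (β 0).re) (extendTwo u q) Z *
          ennexp (σ.re * ∑ i, u i - ω.re * q)) * (todaL (m + 2) (fun i => (α i).re) Z *
            todaL m (fun i => (Fin.tail β i).re) u)) ?_ ?_ (fun u Z => ?_) ?_)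
        · unfold Function.uncurry; fun_prop
        · unfold Function.uncurry; fun_prop
        · rw [enorm_mul, enorm_mul, enorm_mul, enorm_baxterKernel, enorm_cexp, Complex.sub_re,
            Complex.re_mul_ofReal, Complex.re_mul_ofReal]
          gcongr
          · exact le_rfl
          · exact enorm_toda_le _ _ _
          · exact enorm_toda_le _ _ _
        · have h : ennexp (-ω.re * q) * ((∏ j, gammaLInt (σ.re + (β 0).re + (α j).re)) *
              zetaL σ.re (fun i => (α i).re) (fun i => (Fin.tail β i).re) q) ≠ ⊤ :=
            ENNReal.mul_ne_top (ennexp_ne_top _) (ENNReal.mul_ne_top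
              (ENNReal.prod_ne_top fun j _ => gammaLInt_ne_top (hσβ j))
              (zetaL_ne_top (fun j k => hσ j k.succ) q))
          refine ne_of_eq_of_ne ?_ h
          rw [zetaL, ← lintegral_const_mul _ (by fun_prop), ← lintegral_const_mul _ (by fun_prop)]
          refine lintegral_congr fun u => ?_
          have hcomm : ∀ P A B C E : ENNReal, E * (P * (A * B * C)) = (P * A) * (E * (B * C)) := by
            intros; ring
          rw [hcomm, ← lintegral_baxterLKernel_mul_todaL, ← lintegral_mul_const _ (by fun_prop)]
          refine lintegral_congr fun Z => ?_
          rw [sub_eq_add_neg, ennexp_add, neg_mul]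
          ring
    _ = ∫ q : ℝ, ∫ Z, toda (m + 2) α Z * toda (m + 1) β (dropLast Z) *
          (Complex.exp ((-(σ + ω + β 0)) * q - (π * Real.exp (Z (Fin.last (m + 1)) - q) : ℝ)) *
          Complex.exp (σ * (∑ i, dropLast Z i : ℝ) + (σ + β 0) * (Z (Fin.last (m + 1)) : ℝ) -
            (π * (lastExp (dropLast Z) + Real.exp (-Z (Fin.last (m + 1)))) : ℝ))) := by
        refine integral_congr_ae (.of_forall fun q => integral_congr_ae (.of_forall fun Z => ?_))
        simp only
        rw [toda_succ β, mul_right_comm, ← integral_const_mul]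
        refine integral_congr_ae (.of_forall fun u => ?_)
        have h : baxterKernel (σ + β 0) (extendTwo u q) Z *
            Complex.exp (σ * (∑ i, u i : ℝ) - ω * q) = raiseKernel (β 0) (dropLast Z) u *
            (Complex.exp ((-(σ + ω + β 0)) * q - (π * Real.exp (Z (Fin.last (m + 1)) - q) : ℝ)) *
            Complex.exp (σ * (∑ i, dropLast Z i : ℝ) + (σ + β 0) * (Z (Fin.last (m + 1)) : ℝ) -
              (π * (lastExp (dropLast Z) + Real.exp (-Z (Fin.last (m + 1)))) : ℝ))) := by
          rw [raiseKernel, baxterKernel, ← Complex.exp_add, ← Complex.exp_add, ← Complex.exp_add,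
            sum_extendTwo, sum_eq_sum_dropLast Z, baxterPot_extendTwo]
          congr 1
          push_cast
          ring
        simp only
        rw [h]
        ring
    _ = ∫ Z, ∫ q : ℝ, toda (m + 2) α Z * toda (m + 1) β (dropLast Z) *
          (Complex.exp ((-(σ + ω + β 0)) * q - (π * Real.exp (Z (Fin.last (m + 1)) - q) : ℝ)) *
          Complex.exp (σ * (∑ i, dropLast Z i : ℝ) + (σ + β 0) * (Z (Fin.last (m + 1)) : ℝ) -
            (π * (lastExp (dropLast Z) + Real.exp (-Z (Fin.last (m + 1)))) : ℝ))) := by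
        refine (integral_integral_swap (integrable_uncurry_of_enorm_le
          (g := fun Z q => todaL (m + 2) (fun i => (α i).re) Z *
            todaL (m + 1) (fun i => (β i).re) (dropLast Z) *
          (ennexp ((-(σ.re + ω.re + (β 0).re)) * q - π * Real.exp (Z (Fin.last (m + 1)) - q)) *
          ennexp (σ.re * ∑ i, dropLast Z i + (σ.re + (β 0).re) * Z (Fin.last (m + 1)) -
            π * (lastExp (dropLast Z) + Real.exp (-Z (Fin.last (m + 1)))))))
          ?_ ?_ (fun Z q => ?_) ?_)).symm
        · unfold Function.uncurry; fun_prop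
        · unfold Function.uncurry; fun_prop
        · rw [← Complex.exp_add, ← ennexp_add]
          refine (enorm_toda_mul_toda_mul_cexp_le _ _ _ _ _).trans_eq ?_
          simp only [Complex.add_re, Complex.sub_re, Complex.re_mul_ofReal, Complex.neg_re,
            Complex.ofReal_re]
        · rw [lintegral_companionL σ.re ω.re (fun i => (α i).re) (fun i => (β i).re)]
          refine ENNReal.mul_ne_top (gammaLInt_ne_top ?_) (companionL_ne_top hσ hω)
          have h1 := hσ 0 0
          have h2 := hω 0
          simp only [Complex.add_re] at h1
          linarith
    _ = _ := by
        rw [companion, ← integral_const_mul]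
        refine integral_congr_ae (.of_forall fun Z => ?_)
        simp only
        rw [integral_const_mul, integral_mul_const, integral_cexp_mul_sub_neg, neg_neg,
          mul_comm (Complex.exp _) (gammaInt _), mul_assoc (gammaInt _), ← Complex.exp_add,
          mul_left_comm]
        congr 3
        ring

theorem companion_zero (σ ω : ℂ) (α : Fin 1 → ℂ) (β : Fin 0 → ℂ) :
    companion σ ω α β = gammaInt (ω - α 0) := by
  rw [companion, gammaInt_neg, integral_cons]
  have h := integral_prod_mul (μ := (volume : Measure ℝ)) (ν := (volume : Measure (Fin 0 → ℝ)))
    (f := fun x : ℝ => Complex.exp ((ω - α 0) * (-x : ℝ) - (π * Real.exp (-x) : ℝ)))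
    (g := fun _ => (1 : ℂ))
  rw [show ∫ _ : Fin 0 → ℝ, (1 : ℂ) = 1 by simp [volume_pi, Measure.real], mul_one] at h
  rw [← h]
  refine integral_congr_ae (.of_forall fun q => ?_)
  have hl : Fin.last 0 = 0 := rfl
  simp only [toda, raiseKernel, raisePot, lastExp, volume_pi]
  simp [hl, ← Complex.exp_add, Measure.real]
  congr 1
  ring

/-! ### Closed forms of the companion and of the Laplace transform -/

/-- Each induction step removes α 0 and β 0 together. The denominators stay on the left, so that no
nonvanishing is needed. -/
theorem companion_mul_prod : ∀ {m : ℕ} {σ ω : ℂ} {α : Fin (m + 1) → ℂ} {β : Fin m → ℂ},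
    (∀ j k, 0 < (σ + α j + β k).re) → (∀ j, (α j).re < ω.re) →
    companion σ ω α β * ∏ k, gammaInt (σ + ω + β k) =
      (∏ j, ∏ k, gammaInt (σ + α j + β k)) * ∏ j, gammaInt (ω - α j)
  | 0, σ, ω, α, β, _, _ => by simp [companion_zero]
  | m + 1, σ, ω, α, β, hσ, hω => by
    have ih := companion_mul_prod (m := m) (σ := σ) (ω := ω) (α := Fin.tail α) (β := Fin.tail β)
      (fun j k => hσ j.succ k.succ) fun j => hω j.succ
    have h1 := companion_succ hσ hω
    rw [zetaMellin_eq (β := Fin.tail β) (fun j k => hσ j k.succ) hω] at h1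
    have h2 : ∏ j, ∏ k, gammaInt (σ + α j + β k) = (∏ j, gammaInt (σ + β 0 + α j)) *
        ((∏ k, gammaInt (σ + α 0 + Fin.tail β k)) *
          ∏ j, ∏ k, gammaInt (σ + Fin.tail α j + Fin.tail β k)) := by
      have h5 : ∏ j, ∏ k, gammaInt (σ + α j + Fin.tail β k) =
          (∏ k, gammaInt (σ + α 0 + Fin.tail β k)) *
            ∏ j, ∏ k, gammaInt (σ + Fin.tail α j + Fin.tail β k) := Fin.prod_univ_succ _
      rw [← h5, ← Finset.prod_mul_distrib]
      refine Finset.prod_congr rfl fun j _ => ?_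
      rw [Fin.prod_univ_succ, add_right_comm σ (α j)]
      rfl
    have h3 : ∏ k, gammaInt (σ + ω + β k) = gammaInt (σ + ω + β 0) *
      ∏ k, gammaInt (σ + ω + Fin.tail β k) := Fin.prod_univ_succ _
    have h4 : ∏ j, gammaInt (ω - α j) = gammaInt (ω - α 0) * ∏ j, gammaInt (ω - Fin.tail α j) :=
      Fin.prod_univ_succ _
    rw [h2, h3, h4]
    linear_combination (∏ k, gammaInt (σ + ω + Fin.tail β k)) * h1 +
      (∏ j, gammaInt (σ + β 0 + α j)) * gammaInt (ω - α 0) *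
      (∏ k, gammaInt (σ + α 0 + Fin.tail β k)) * ih

theorem zetaMellin_mul_prod {σ ω : ℂ} {α : Fin (m + 2) → ℂ} {β : Fin m → ℂ}
    (hσ : ∀ j k, 0 < (σ + α j + β k).re) (hω : ∀ j, (α j).re < ω.re) :
    zetaMellin σ ω α β * ∏ k, gammaInt (σ + ω + β k) =
      (∏ j, ∏ k, gammaInt (σ + α j + β k)) * ∏ j, gammaInt (ω - α j) := by
  have ih := companion_mul_prod (m := m) (σ := σ) (ω := ω) (α := Fin.tail α) (β := β)
      (fun j k => hσ j.succ k) fun j => hω j.succ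
  have h2 : ∏ j, ∏ k, gammaInt (σ + α j + β k) = (∏ k, gammaInt (σ + α 0 + β k)) *
    ∏ j, ∏ k, gammaInt (σ + Fin.tail α j + β k) := Fin.prod_univ_succ _
  have h4 : ∏ j, gammaInt (ω - α j) = gammaInt (ω - α 0) * ∏ j, gammaInt (ω - Fin.tail α j) :=
    Fin.prod_univ_succ _
  rw [zetaMellin_eq hσ hω, h2, h4]
  linear_combination gammaInt (ω - α 0) * (∏ k, gammaInt (σ + α 0 + β k)) * ih

/-! ### Inversion -/

/-- Pointwise Fourier inversion needs continuity. On |ρ - ρ₀| < 1 the integrand is dominated by a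
fixed multiple of the companion integrand, through `reduced_exponent_le`. -/
theorem continuous_zetaReduced {σ : ℂ} {α : Fin (m + 2) → ℂ} {β : Fin m → ℂ}
    (hσ : ∀ j k, 0 < (σ + α j + β k).re) : Continuous (zetaReduced σ α β) := by
  rw [continuous_iff_continuousAt]
  intro ρ₀
  obtain ⟨ω, hω⟩ := exists_gt_re fun j => (α j).re
  set k := ω - (α 0).re with hk
  have hfin : companionL σ.re ω (fun i => (Fin.tail α i).re) (fun i => (β i).re) ≠ ⊤ :=
    companionL_ne_top (fun j k => hσ j.succ k) fun j => hω j.succ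
  set G : (Fin (m + 1) → ℝ) → ENNReal := fun Z => ennexp (k * Real.log k + (ω * ρ₀ + |ω|)) *
    (todaL (m + 1) (fun i => (Fin.tail α i).re) Z *
    todaL m (fun i => (β i).re) (dropLast Z) * ennexp (σ.re * ∑ i, dropLast Z i -
    ω * Z (Fin.last m) - π * (lastExp (dropLast Z) + Real.exp (-Z (Fin.last m))))) with hG
  have hGm : Measurable G := by fun_prop
  have hGfin : ∫⁻ Z, G Z ≠ ⊤ := by
    rw [hG, lintegral_const_mul _ (by fun_prop)]
    exact ENNReal.mul_ne_top (ennexp_ne_top _) hfin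
  have hGtop : ∀ Z, G Z ≠ ⊤ := fun Z => ENNReal.mul_ne_top (ennexp_ne_top _)
    (ENNReal.mul_ne_top (ENNReal.mul_ne_top (todaL_ne_top _ _) (todaL_ne_top _ _))
      (ennexp_ne_top _))
  refine continuousAt_of_dominated (bound := fun Z => (G Z).toReal)
    (.of_forall fun ρ => Measurable.aestronglyMeasurable (by fun_prop)) ?_
    (integrable_toReal_of_lintegral_ne_top hGm.aemeasurable hGfin) (.of_forall fun Z => ?_)
  · filter_upwards [Metric.ball_mem_nhds ρ₀ one_pos] with ρ hρ
    refine .of_forall fun Z => ?_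
    rw [← ENNReal.ofReal_le_iff_le_toReal (hGtop Z), ofReal_norm]
    refine (enorm_toda_mul_toda_mul_cexp_le _ _ _ _ _).trans ?_
    rw [hG]
    simp only
    rw [mul_left_comm, ← ennexp_add]
    refine mul_le_mul_right (ennexp_le_ennexp ?_) _
    simp only [Complex.add_re, Complex.sub_re, Complex.re_mul_ofReal, Complex.ofReal_re]
    refine (reduced_exponent_le (hω 0) _ _ _ _).trans ?_
    have h1 : ω * ρ ≤ ω * ρ₀ + |ω| := by
      have h2 : ω * (ρ - ρ₀) ≤ |ω| * |ρ - ρ₀| := (le_abs_self _).trans_eq (abs_mul _ _)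
      have h3 : |ω| * |ρ - ρ₀| ≤ |ω| * 1 :=
        mul_le_mul_of_nonneg_left (by simpa [Real.dist_eq] using hρ.le) (abs_nonneg _)
      linarith
    linarith
  · refine Continuous.continuousAt ?_
    fun_prop

theorem continuous_zetaLog {σ : ℂ} {α : Fin (m + 2) → ℂ} {β : Fin m → ℂ}
    (hσ : ∀ j k, 0 < (σ + α j + β k).re) : Continuous (zetaLog σ α β) := by
  have h : zetaLog σ α β = fun ρ => (∏ k, gammaInt (σ + α 0 + β k)) * zetaReduced σ α β ρ :=
    funext (zetaLog_eq hσ)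
  rw [h]
  exact continuous_const.mul (continuous_zetaReduced hσ)

theorem integrable_cexp_mul_zetaLog {σ ω : ℂ} {α : Fin (m + 2) → ℂ} {β : Fin m → ℂ}
    (hσ : ∀ j k, 0 < (σ + α j + β k).re) (hω : ∀ j, (α j).re < ω.re) :
    Integrable fun ρ : ℝ => Complex.exp (-ω * ρ) * zetaLog σ α β ρ := by
  refine ⟨Continuous.aestronglyMeasurable (Continuous.mul (by fun_prop)
    (continuous_zetaLog hσ)), ?_⟩
  rw [hasFiniteIntegral_iff_enorm]
  refine lt_of_le_of_lt (lintegral_mono fun ρ => ?_)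
    (zetaMellinL_ne_top (σ := σ.re) (ω := ω.re) (α := fun i => (α i).re)
      (β := fun i => (β i).re) hσ hω).lt_top
  rw [enorm_mul, enorm_cexp, Complex.re_mul_ofReal, Complex.neg_re]
  exact mul_le_mul_right (enorm_zetaLog_le _ _ _ _) _

/-- On the line ω = c + 2πiξ the Laplace transform is the Fourier transform of e^{-cρ} `zetaLog`;
invert at ρ = 0, where the exponential factors are 1. -/
theorem zetaLog_zero_eq_integral {σ : ℂ} {α : Fin (m + 2) → ℂ} {β : Fin m → ℂ} {c : ℝ}
    (hσ : ∀ j k, 0 < (σ + α j + β k).re) (hc : ∀ j, (α j).re < c)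
    (hint : Integrable fun ξ : ℝ => zetaMellin σ (c + 2 * π * ξ * Complex.I) α β) :
    zetaLog σ α β 0 = ∫ ξ : ℝ, zetaMellin σ (c + 2 * π * ξ * Complex.I) α β := by
  set g : ℝ → ℂ := fun ρ => Complex.exp (-(c : ℂ) * ρ) * zetaLog σ α β ρ with hg
  have hgc : Continuous g := Continuous.mul (by fun_prop) (continuous_zetaLog hσ)
  have hgi : Integrable g := integrable_cexp_mul_zetaLog hσ (by simpa using hc)
  have hF : FourierTransform.fourier g =
      fun ξ : ℝ => zetaMellin σ (c + 2 * π * ξ * Complex.I) α β := by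
    ext ξ
    rw [Real.fourier_real_eq_integral_exp_smul, zetaMellin]
    refine integral_congr_ae (.of_forall fun ρ => ?_)
    simp only [hg, smul_eq_mul]
    rw [← mul_assoc, ← Complex.exp_add]
    congr 2
    push_cast
    ring
  have h := hgi.fourierInv_fourier_eq (by rw [hF]; exact hint) (v := 0) hgc.continuousAt
  rw [Real.fourierInv_eq', hF] at h
  simpa [hg] using h.symm

end

/-! ### Bounds for the gamma function in vertical strips -/

theorem norm_betaIntegral_le {z : ℂ} (b : ℝ) :
    ‖Complex.betaIntegral z b‖ ≤ ‖Complex.betaIntegral (z.re : ℂ) b‖ := by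
  have h0 : ∀ u : ℂ, Complex.betaIntegral u b =
      ∫ x in Set.Ioo (0 : ℝ) 1, (x : ℂ) ^ (u - 1) * (1 - (x : ℂ)) ^ ((b : ℂ) - 1) := fun u => by
    rw [Complex.betaIntegral, intervalIntegral.integral_of_le zero_le_one,
      integral_Ioc_eq_integral_Ioo]
  have h1 : ∀ x ∈ Set.Ioo (0 : ℝ) 1, ∀ u : ℂ,
      ‖(x : ℂ) ^ (u - 1) * (1 - (x : ℂ)) ^ ((b : ℂ) - 1)‖ =
        x ^ (u.re - 1) * (1 - x) ^ (b - 1) := by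
    rintro x ⟨hx0, hx1⟩ u
    rw [norm_mul, Complex.norm_cpow_eq_rpow_re_of_pos hx0, ← Complex.ofReal_one,
      ← Complex.ofReal_sub, Complex.norm_cpow_eq_rpow_re_of_pos (sub_pos.mpr hx1)]
    simp
  have h2 : Complex.betaIntegral (z.re : ℂ) b =
      ((∫ x in Set.Ioo (0 : ℝ) 1, x ^ (z.re - 1) * (1 - x) ^ (b - 1) : ℝ) : ℂ) := by
    rw [h0]
    refine Eq.trans ?_ integral_complex_ofReal
    refine setIntegral_congr_fun measurableSet_Ioo fun x hx => ?_
    simp only [Complex.ofReal_mul]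
    rw [Complex.ofReal_cpow hx.1.le, Complex.ofReal_cpow (sub_pos.mpr hx.2).le]
    push_cast
    rfl
  rw [h2, Complex.norm_real, h0]
  refine (norm_integral_le_integral_norm _).trans (le_trans (le_of_eq ?_) (le_abs_self _))
  exact setIntegral_congr_fun measurableSet_Ioo fun x hx => h1 x hx z

/-- Dividing the two beta integral formulas compares Γ on two vertical lines at the same height.
Bounds can thus be moved to the left from a convenient line, without Stirling's formula. -/
theorem norm_Gamma_mul_le {z : ℂ} (hz : 0 < z.re) {b : ℝ} (hb : 0 < b) :
    ‖Complex.Gamma z‖ * Real.Gamma (z.re + b) ≤ Real.Gamma z.re * ‖Complex.Gamma (z + b)‖ := by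
  have h1 := Complex.Gamma_mul_Gamma_eq_betaIntegral hz (t := b) (by simpa using hb)
  have h2 := Complex.Gamma_mul_Gamma_eq_betaIntegral (s := z.re) (by simpa using hz) (t := b)
    (by simpa using hb)
  have h3 := congrArg norm h1
  have h4 := congrArg norm h2
  rw [← Complex.ofReal_add, Complex.Gamma_ofReal, Complex.Gamma_ofReal, Complex.Gamma_ofReal] at h4
  rw [Complex.Gamma_ofReal] at h3
  simp only [norm_mul, Complex.norm_real, Real.norm_eq_abs] at h3 h4
  have hGb := Real.Gamma_pos_of_pos hb
  have hGz := Real.Gamma_pos_of_pos hz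
  have hGzb := Real.Gamma_pos_of_pos (add_pos hz hb)
  rw [abs_of_pos hGb] at h3 h4
  rw [abs_of_pos hGz, abs_of_pos hGzb] at h4
  refine le_of_mul_le_mul_right ?_ hGb
  calc ‖Complex.Gamma z‖ * Real.Gamma (z.re + b) * Real.Gamma b
      = ‖Complex.Gamma (z + b)‖ * ‖Complex.betaIntegral z b‖ * Real.Gamma (z.re + b) := by
        rw [← h3]; ring
    _ ≤ ‖Complex.Gamma (z + b)‖ * ‖Complex.betaIntegral (z.re : ℂ) b‖ * Real.Gamma (z.re + b) := by
        gcongr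
        exact norm_betaIntegral_le b
    _ = _ := by linear_combination (-‖Complex.Gamma (z + b)‖) * h4

/-- On the critical line the reflection formula gives |Γ|² = π / cosh (πt) exactly. -/
theorem norm_Gamma_half_add_le (t : ℝ) :
    ‖Complex.Gamma (1 / 2 + t * Complex.I)‖ ≤ √(2 * π) * Real.exp (-(π / 2) * |t|) := by
  have h := Complex.Gamma_mul_Gamma_one_sub (1 / 2 + t * Complex.I)
  have h1 : (1 : ℂ) - (1 / 2 + t * Complex.I) = (starRingEnd ℂ) (1 / 2 + t * Complex.I) := by
    simp only [map_add, map_mul, Complex.conj_I, Complex.conj_ofReal, map_div₀, map_one,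
      Complex.conj_ofNat]
    ring
  have h2 : Complex.sin (π * (1 / 2 + t * Complex.I)) = (Real.cosh (π * t) : ℂ) := by
    rw [show (π : ℂ) * (1 / 2 + t * Complex.I) = (π * t : ℝ) * Complex.I + π / 2 by push_cast; ring,
      Complex.sin_add_pi_div_two, Complex.cos_mul_I, Complex.ofReal_cosh]
  rw [h1, Complex.Gamma_conj, Complex.mul_conj, h2, ← Complex.ofReal_div, Complex.ofReal_inj,
    Complex.normSq_eq_norm_sq] at h
  refine le_of_sq_le_sq ?_ (by positivity)
  rw [h, mul_pow, Real.sq_sqrt (by positivity), ← Real.exp_nat_mul,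
    div_le_iff₀ (Real.cosh_pos _), ← Real.cosh_abs, Real.cosh_eq, abs_mul, abs_of_pos Real.pi_pos]
  have h3 : Real.exp ((2 : ℕ) * (-(π / 2) * |t|)) * Real.exp (π * |t|) = 1 := by
    rw [← Real.exp_add, ← Real.exp_zero]
    congr 1
    push_cast
    ring
  have h4 := mul_pos (Real.exp_pos ((2 : ℕ) * (-(π / 2) * |t|))) (Real.exp_pos (-(π * |t|)))
  nlinarith [Real.pi_pos]

/-- The functional equation costs a linear factor in |t|, absorbed by applying the induction
hypothesis at the midpoint of θ and π/2; δ is the gap between this midpoint and θ. -/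
theorem exists_norm_Gamma_half_nat_le : ∀ (N : ℕ) {θ : ℝ}, θ < π / 2 →
    ∃ C : ℝ, 0 < C ∧ ∀ t : ℝ, ‖Complex.Gamma (N + 1 / 2 + t * Complex.I)‖ ≤
      C * Real.exp (-θ * |t|)
  | 0, θ, hθ => by
    refine ⟨√(2 * π), by positivity, fun t => ?_⟩
    rw [Nat.cast_zero, zero_add]
    refine (norm_Gamma_half_add_le t).trans ?_
    gcongr
  | N + 1, θ, hθ => by
    obtain ⟨C, hC, h⟩ := exists_norm_Gamma_half_nat_le N (θ := (θ + π / 2) / 2) (by linarith)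
    set δ := (π / 2 - θ) / 2 with hδ
    have hδ0 : 0 < δ := by rw [hδ]; linarith
    refine ⟨(N + 1 + δ⁻¹) * C, by positivity, fun t => ?_⟩
    have hz : (N + 1 / 2 + t * Complex.I : ℂ) ≠ 0 := by
      intro h0
      have := congrArg Complex.re h0
      simp at this
      have h2 : (0 : ℝ) ≤ N := Nat.cast_nonneg N
      linarith
    rw [show ((N + 1 : ℕ) + 1 / 2 + t * Complex.I : ℂ) = (N + 1 / 2 + t * Complex.I) + 1 by
      push_cast; ring, Complex.Gamma_add_one _ hz, norm_mul]
    have h1 : ‖(N + 1 / 2 + t * Complex.I : ℂ)‖ ≤ N + 1 + |t| := by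
      refine (norm_add_le _ _).trans ?_
      rw [norm_mul, Complex.norm_I, mul_one, Complex.norm_real, Real.norm_eq_abs,
        show (N + 1 / 2 : ℂ) = ((N + 1 / 2 : ℝ) : ℂ) by push_cast; rfl, Complex.norm_real,
        Real.norm_of_nonneg (by positivity)]
      linarith
    have h2 : N + 1 + |t| ≤ (N + 1 + δ⁻¹) * Real.exp (δ * |t|) := by
      have e1 := Real.add_one_le_exp (δ * |t|)
      have e2 : 1 ≤ Real.exp (δ * |t|) := Real.one_le_exp (by positivity)
      have e3 : |t| ≤ δ⁻¹ * Real.exp (δ * |t|) := by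
        rw [inv_mul_eq_div, le_div_iff₀ hδ0]
        linarith
      have e4 : (N + 1 : ℝ) * 1 ≤ (N + 1) * Real.exp (δ * |t|) := by gcongr
      linarith
    calc _ ≤ ((N + 1 + δ⁻¹) * Real.exp (δ * |t|)) *
          (C * Real.exp (-((θ + π / 2) / 2) * |t|)) :=
          mul_le_mul (h1.trans h2) (h t) (norm_nonneg _) (by positivity)
      _ = (N + 1 + δ⁻¹) * C * (Real.exp (δ * |t|) * Real.exp (-((θ + π / 2) / 2) * |t|)) := by ring
      _ = _ := by
        rw [← Real.exp_add]
        congr 2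
        rw [hδ]
        ring

theorem exists_norm_Gamma_le {θ : ℝ} (hθ : θ < π / 2) {A : ℝ} (hA : 0 < A) (B : ℝ) :
    ∃ C : ℝ, 0 < C ∧ ∀ z : ℂ, A ≤ z.re → z.re ≤ B →
      ‖Complex.Gamma z‖ ≤ C * Real.exp (-θ * |z.im|) := by
  obtain ⟨N, hN⟩ := exists_nat_gt B
  obtain ⟨C, hC, h⟩ := exists_norm_Gamma_half_nat_le N hθ
  have hcont : ContinuousOn Real.Gamma (Set.Icc A B) := fun x hx =>
    (Real.differentiableAt_Gamma fun m hm => by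
      have h1 : (0 : ℝ) ≤ m := Nat.cast_nonneg m
      linarith [hx.1]).continuousAt.continuousWithinAt
  obtain ⟨D, hD⟩ := isCompact_Icc.bddAbove_image hcont
  have hG : 0 < Real.Gamma (N + 1 / 2) := Real.Gamma_pos_of_pos (by positivity)
  refine ⟨max D 1 * C / Real.Gamma (N + 1 / 2), by positivity, fun z h1 h2 => ?_⟩
  -- The shift b is chosen so that z + b lies on the line Re = N + 1/2, where the decay is known.
  have hb : 0 < (N + 1 / 2 : ℝ) - z.re := by linarith
  have h3 := norm_Gamma_mul_le (hA.trans_le h1) hb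
  rw [add_sub_cancel] at h3
  have h4 : z + ((N + 1 / 2 - z.re : ℝ) : ℂ) = N + 1 / 2 + z.im * Complex.I := by
    push_cast
    linear_combination -Complex.re_add_im z
  rw [h4] at h3
  rw [mul_div_right_comm, div_mul_eq_mul_div, div_mul_eq_mul_div, le_div_iff₀ hG, mul_assoc]
  refine h3.trans (mul_le_mul ?_ (h _) (norm_nonneg _) (by positivity))
  exact (hD ⟨z.re, ⟨h1, h2⟩, rfl⟩).trans (le_max_left _ _)

theorem norm_sin_le (w : ℂ) : ‖Complex.sin w‖ ≤ Real.exp |w.im| := by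
  rw [Complex.sin, norm_div, norm_mul, Complex.norm_I, mul_one, Complex.norm_ofNat,
    div_le_iff₀ two_pos]
  refine (norm_sub_le _ _).trans ?_
  rw [Complex.norm_exp, Complex.norm_exp]
  have h1 : (-w * Complex.I).re = w.im := by simp
  have h2 : (w * Complex.I).re = -w.im := by simp
  rw [h1, h2]
  linarith [Real.exp_le_exp.mpr (le_abs_self w.im), Real.exp_le_exp.mpr (neg_le_abs w.im)]

/-- For Re z ≤ 1/2 reflection writes 1/Γ(z) as Γ(1 - z) sin(πz)/π, where the sine grows like e^{π|Im
z|} and Γ(1 - z) decays. The strip is then widened by the functional equation, which does no harm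
when |Im z| ≥ 1; the remaining rectangle is compact and 1/Γ is entire. -/
theorem exists_norm_inv_Gamma_le_aux {θ : ℝ} (hθ : θ < π / 2) (A : ℝ) :
    ∀ N : ℕ, ∃ C : ℝ, 0 < C ∧ ∀ z : ℂ, A ≤ z.re → z.re ≤ 1 / 2 + N →
      ‖(Complex.Gamma z)⁻¹‖ ≤ C * Real.exp ((π - θ) * |z.im|)
  | 0 => by
    obtain ⟨C, hC, h⟩ := exists_norm_Gamma_le hθ (A := 1 / 2) (by norm_num) (1 - A)
    refine ⟨C, hC, fun z h1 h2 => ?_⟩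
    rw [Nat.cast_zero, add_zero] at h2
    have hne : Complex.Gamma (1 - z) ≠ 0 :=
      Complex.Gamma_ne_zero_of_re_pos (by simp; linarith)
    have h3 : (Complex.Gamma z)⁻¹ = Complex.Gamma (1 - z) * (Complex.sin (π * z) / π) := by
      rw [← inv_div, ← Complex.Gamma_mul_Gamma_one_sub, mul_inv, mul_left_comm,
        mul_inv_cancel₀ hne, mul_one]
    have h4 := h (1 - z) (by simp; linarith) (by simp; linarith)
    have h5 := norm_sin_le (π * z)
    rw [Complex.im_ofReal_mul, abs_mul, abs_of_pos Real.pi_pos] at h5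
    rw [show |(1 - z).im| = |z.im| by simp] at h4
    rw [h3, norm_mul, norm_div, Complex.norm_real, Real.norm_of_nonneg Real.pi_pos.le]
    calc _ ≤ (C * Real.exp (-θ * |z.im|)) * (Real.exp (π * |z.im|) / 1) := by
          gcongr
          linarith [Real.pi_gt_three]
      _ = _ := by
          rw [div_one, mul_assoc, ← Real.exp_add]
          congr 2
          ring
  | N + 1 => by
    obtain ⟨C, hC, h⟩ := exists_norm_inv_Gamma_le_aux hθ (A - 1) N
    have hK : IsCompact (Set.Icc A (1 / 2 + (N + 1 : ℕ)) ×ℂ Set.Icc (-1 : ℝ) 1) :=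
      isCompact_Icc.reProdIm isCompact_Icc
    obtain ⟨D, hD⟩ := hK.exists_bound_of_continuousOn
      Complex.differentiable_one_div_Gamma.continuous.continuousOn
    refine ⟨max C D, lt_max_of_lt_left hC, fun z h1 h2 => ?_⟩
    rcases le_total |z.im| 1 with him | him
    · have h3 := hD z (by
        rw [Complex.mem_reProdIm]
        exact ⟨⟨h1, h2⟩, abs_le.mp him⟩)
      have h4 : (1 : ℝ) ≤ Real.exp ((π - θ) * |z.im|) :=
        Real.one_le_exp (mul_nonneg (by linarith [Real.pi_pos]) (abs_nonneg _))
      calc _ ≤ max C D * 1 := by rw [mul_one]; exact h3.trans (le_max_right _ _)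
        _ ≤ _ := by
          have : 0 ≤ max C D := hC.le.trans (le_max_left _ _)
          gcongr
    · have h3 := h (z - 1) (by simp; linarith) (by simp at h2 ⊢; linarith)
      have hz : z - 1 ≠ 0 := by
        intro h0
        have := congrArg Complex.im h0
        simp at this
        rw [this] at him
        simp at him
        linarith
      have h4 : (Complex.Gamma z)⁻¹ = (z - 1)⁻¹ * (Complex.Gamma (z - 1))⁻¹ := by
        rw [← mul_inv, ← Complex.Gamma_add_one _ hz, sub_add_cancel]
      have h5 : ‖(z - 1)⁻¹‖ ≤ 1 := by
        rw [norm_inv]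
        refine inv_le_one_of_one_le₀ (him.trans ?_)
        simpa using Complex.abs_im_le_norm (z - 1)
      rw [h4, norm_mul]
      have h6 : |(z - 1).im| = |z.im| := by simp
      rw [h6] at h3
      calc _ ≤ 1 * (C * Real.exp ((π - θ) * |z.im|)) := by gcongr
        _ ≤ _ := by
          rw [one_mul]
          gcongr
          exact le_max_left _ _

theorem exists_norm_inv_Gamma_le {θ : ℝ} (hθ : θ < π / 2) (A B : ℝ) :
    ∃ C : ℝ, 0 < C ∧ ∀ z : ℂ, A ≤ z.re → z.re ≤ B →
      ‖(Complex.Gamma z)⁻¹‖ ≤ C * Real.exp ((π - θ) * |z.im|) := by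
  obtain ⟨N, hN⟩ := exists_nat_gt B
  obtain ⟨C, hC, h⟩ := exists_norm_inv_Gamma_le_aux hθ A N
  exact ⟨C, hC, fun z h1 h2 => h z h1 (by linarith)⟩

/-! ### The Barnes integral -/

theorem exists_norm_Gammaℝ_le {θ : ℝ} (hθ : θ < π / 2) {A : ℝ} (hA : 0 < A) (B : ℝ) :
    ∃ C : ℝ, 0 < C ∧ ∀ z : ℂ, A ≤ z.re → z.re ≤ B →
      ‖Complex.Gammaℝ z‖ ≤ C * Real.exp (-(θ / 2) * |z.im|) := by
  obtain ⟨C, hC, h⟩ := exists_norm_Gamma_le hθ (half_pos hA) (B / 2)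
  refine ⟨C, hC, fun z h1 h2 => ?_⟩
  have h3 := h (z / 2) (by simp; linarith) (by simp; linarith)
  have h4 : ‖(π : ℂ) ^ (-z / 2)‖ ≤ 1 := by
    rw [Complex.norm_cpow_eq_rpow_re_of_pos Real.pi_pos]
    refine Real.rpow_le_one_of_one_le_of_nonpos (by linarith [Real.pi_gt_three]) ?_
    simp
    linarith
  have h5 : |(z / 2).im| = |z.im| / 2 := by simp [abs_div]
  rw [h5] at h3
  rw [Complex.Gammaℝ_def, norm_mul]
  calc _ ≤ 1 * (C * Real.exp (-θ * (|z.im| / 2))) := by gcongr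
    _ = _ := by rw [one_mul]; congr 2; ring

theorem exists_norm_inv_Gammaℝ_le {θ : ℝ} (hθ : θ < π / 2) (A B : ℝ) :
    ∃ C : ℝ, 0 < C ∧ ∀ z : ℂ, A ≤ z.re → z.re ≤ B →
      ‖(Complex.Gammaℝ z)⁻¹‖ ≤ C * Real.exp ((π - θ) / 2 * |z.im|) := by
  obtain ⟨C, hC, h⟩ := exists_norm_inv_Gamma_le hθ (A / 2) (B / 2)
  refine ⟨π ^ (B / 2) * C, by positivity, fun z h1 h2 => ?_⟩
  have h3 := h (z / 2) (by simp; linarith) (by simp; linarith)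
  have h4 : ‖((π : ℂ) ^ (-z / 2))⁻¹‖ ≤ π ^ (B / 2) := by
    rw [norm_inv, Complex.norm_cpow_eq_rpow_re_of_pos Real.pi_pos, ← Real.rpow_neg Real.pi_pos.le]
    refine Real.rpow_le_rpow_of_exponent_le (by linarith [Real.pi_gt_three]) ?_
    simp
    linarith
  have h5 : |(z / 2).im| = |z.im| / 2 := by simp [abs_div]
  rw [h5] at h3
  rw [Complex.Gammaℝ_def, mul_inv, norm_mul]
  calc _ ≤ π ^ (B / 2) * (C * Real.exp ((π - θ) * (|z.im| / 2))) := by gcongr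
    _ = _ := by rw [mul_assoc]; congr 3; ring

section

variable {m : ℕ} (a : Fin (m + 2) → ℂ) (a' : Fin m → ℂ) {c : ℝ}

/-- Each numerator factor decays like e^{-π|t|/4} and each reciprocal factor grows like e^{π|t|/4},
up to ε; the two surplus numerators leave e^{-π|t|/2}. Uniformity for bounded s serves holomorphy.
-/
theorem exists_norm_barnesIntegrand_le (hc : ∀ j, (a j).re < c) (R : ℝ) :
    ∃ C : ℝ, ∀ s : ℂ, ‖s‖ ≤ R → ∀ t : ℝ,
      ‖barnesIntegrand a a' s ((c : ℂ) + t * Complex.I)‖ ≤ C * Real.exp (-(π / 4) * |t|) := by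
  -- The total loss over the 2m + 2 factors is (m + 1)ε = π/4, half of the available decay.
  set ε := π / (4 * (m + 1)) with hε
  have hε0 : 0 < ε := by positivity
  set θ := π / 2 - ε with hθ
  have hθ0 : 0 ≤ θ := by
    have : ε ≤ π / 4 := by
      rw [hε]
      gcongr
      have : (0 : ℝ) ≤ m := Nat.cast_nonneg m
      linarith
    linarith [Real.pi_pos]
  have hθ2 : θ < π / 2 := by linarith
  have h1 : ∀ j, ∃ C : ℝ, 0 < C ∧ ∀ t : ℝ,
      ‖Complex.Gammaℝ ((c : ℂ) + t * Complex.I - a j)‖ ≤ C * Real.exp (-(θ / 2) * |t|) := by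
    intro j
    obtain ⟨C, hC, h⟩ := exists_norm_Gammaℝ_le hθ2 (sub_pos.mpr (hc j)) (c - (a j).re)
    refine ⟨C * Real.exp (θ / 2 * |(a j).im|), by positivity, fun t => ?_⟩
    refine (h _ (by simp) (by simp)).trans ?_
    rw [mul_assoc, ← Real.exp_add]
    gcongr
    have h2 : |t| ≤ |((c : ℂ) + t * Complex.I - a j).im| + |(a j).im| := by
      have : t = ((c : ℂ) + t * Complex.I - a j).im + (a j).im := by simp
      conv_lhs => rw [this]
      exact abs_add_le _ _
    nlinarith
  have h2 : ∀ k, ∃ C : ℝ, 0 < C ∧ ∀ s : ℂ, ‖s‖ ≤ R → ∀ t : ℝ,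
      ‖(Complex.Gammaℝ (s + ((c : ℂ) + t * Complex.I) + a' k))⁻¹‖ ≤
        C * Real.exp ((π - θ) / 2 * |t|) := by
    intro k
    obtain ⟨C, hC, h⟩ := exists_norm_inv_Gammaℝ_le hθ2 (-R + c + (a' k).re) (R + c + (a' k).re)
    refine ⟨C * Real.exp ((π - θ) / 2 * (R + |(a' k).im|)), by positivity, fun s hs t => ?_⟩
    have h3 := abs_le.mp ((Complex.abs_re_le_norm s).trans hs)
    refine (h _ (by simp; linarith) (by simp; linarith)).trans ?_
    rw [mul_assoc, ← Real.exp_add, ← mul_add]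
    have h4 : 0 ≤ (π - θ) / 2 := by linarith [Real.pi_pos]
    gcongr
    have h5 : (s + ((c : ℂ) + t * Complex.I) + a' k).im = s.im + t + (a' k).im := by simp
    rw [h5]
    refine (abs_add_three _ _ _).trans ?_
    have := (Complex.abs_im_le_norm s).trans hs
    linarith
  choose C1 hC1 h1 using h1
  choose C2 hC2 h2 using h2
  refine ⟨(∏ j, C1 j) * ∏ k, C2 k, fun s hs t => ?_⟩
  rw [barnesIntegrand, div_eq_mul_inv, ← Finset.prod_inv_distrib, norm_mul, norm_prod, norm_prod]
  calc _ ≤ (∏ j, C1 j * Real.exp (-(θ / 2) * |t|)) *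
        ∏ k, C2 k * Real.exp ((π - θ) / 2 * |t|) := by
        refine mul_le_mul (Finset.prod_le_prod (fun _ _ => norm_nonneg _) fun j _ => h1 j t)
          (Finset.prod_le_prod (fun _ _ => norm_nonneg _) fun k _ => h2 k s hs t)
          (Finset.prod_nonneg fun _ _ => norm_nonneg _)
          (Finset.prod_nonneg fun j _ => mul_nonneg (hC1 j).le (Real.exp_pos _).le)
    _ = (∏ j, C1 j) * (∏ k, C2 k) * Real.exp (((m + 2 : ℕ) * (-(θ / 2)) +
          m * ((π - θ) / 2)) * |t|) := by
        rw [Finset.prod_mul_distrib, Finset.prod_mul_distrib, Finset.prod_const, Finset.prod_const,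
          Finset.card_univ, Finset.card_univ, Fintype.card_fin, Fintype.card_fin,
          ← Real.exp_nat_mul, ← Real.exp_nat_mul, mul_mul_mul_comm, ← Real.exp_add]
        congr 2
        ring
    _ = _ := by
        congr 3
        rw [hθ, hε]
        push_cast
        field_simp
        ring

theorem integrable_exp_neg_mul_abs {b : ℝ} (hb : 0 < b) :
    Integrable fun t : ℝ => Real.exp (-b * |t|) := by
  rw [← integrableOn_univ, ← Set.Iic_union_Ioi (a := (0 : ℝ)), integrableOn_union]
  constructor
  · refine (integrableOn_exp_mul_Iic hb 0).congr_fun (fun t ht => ?_) measurableSet_Iic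
    simp only
    rw [abs_of_nonpos ht, neg_mul_neg]
  · refine (integrableOn_exp_mul_Ioi (neg_lt_zero.mpr hb) 0).congr_fun (fun t ht => ?_)
      measurableSet_Ioi
    simp only
    rw [abs_of_pos ht]

theorem continuous_barnesIntegrand (hc : ∀ j, (a j).re < c) :
    Continuous fun q : ℝ × ℂ => barnesIntegrand a a' q.2 ((c : ℂ) + q.1 * Complex.I) := by
  simp only [barnesIntegrand, div_eq_mul_inv, ← Finset.prod_inv_distrib]
  refine (continuous_finsetProd _ fun j _ => ?_).mul (continuous_finsetProd _ fun k _ => ?_)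
  · rw [continuous_iff_continuousAt]
    intro q
    have hpos : 0 < ((c : ℂ) + q.1 * Complex.I - a j).re := by simpa using hc j
    have h1 : ContinuousAt Complex.Gammaℝ ((c : ℂ) + q.1 * Complex.I - a j) := by
      have h2 := Complex.differentiable_Gammaℝ_inv.continuous.continuousAt
        (x := (c : ℂ) + q.1 * Complex.I - a j)
      have h3 := h2.inv₀ (inv_ne_zero (Complex.Gammaℝ_ne_zero_of_re_pos hpos))
      exact h3.congr (.of_forall fun z => inv_inv (Complex.Gammaℝ z))
    exact ContinuousAt.comp (f := fun q : ℝ × ℂ => (c : ℂ) + q.1 * Complex.I - a j) h1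
      (by fun_prop)
  · exact Complex.differentiable_Gammaℝ_inv.continuous.comp
      (g := fun s => (Complex.Gammaℝ s)⁻¹) (by fun_prop)

theorem integrable_barnesIntegrand (hc : ∀ j, (a j).re < c) (s : ℂ) :
    Integrable fun t : ℝ => barnesIntegrand a a' s ((c : ℂ) + t * Complex.I) := by
  obtain ⟨C, h⟩ := exists_norm_barnesIntegrand_le a a' hc ‖s‖
  have hcont : Continuous fun t : ℝ => barnesIntegrand a a' s ((c : ℂ) + t * Complex.I) :=
    (continuous_barnesIntegrand a a' hc).comp (g := fun q : ℝ × ℂ =>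
      barnesIntegrand a a' q.2 ((c : ℂ) + q.1 * Complex.I)) (f := fun t => (t, s)) (by fun_prop)
  exact ((integrable_exp_neg_mul_abs (b := π / 4) (by positivity)).const_mul C).mono'
    hcont.aestronglyMeasurable (.of_forall fun t => h s le_rfl t)

theorem differentiable_barnesIntegrand (w : ℂ) :
    Differentiable ℂ fun s => barnesIntegrand a a' s w := by
  simp only [barnesIntegrand, div_eq_mul_inv, ← Finset.prod_inv_distrib]
  refine (differentiable_const _).mul (Differentiable.fun_finsetProd fun k _ => ?_)
  exact Complex.differentiable_Gammaℝ_inv.comp (g := fun s => (Complex.Gammaℝ s)⁻¹) (by fun_prop)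

theorem differentiable_barnesIntegral (hc : ∀ j, (a j).re < c) :
    Differentiable ℂ fun s => barnesIntegral a a' c s := by
  have key : Differentiable ℂ fun s : ℂ =>
      ∫ t : ℝ, barnesIntegrand a a' s ((c : ℂ) + t * Complex.I) := by
    intro s₀
    -- The derivative is bounded on the unit ball about s₀ by Cauchy's estimate on unit circles,
    -- which stay within ‖s₀‖ + 2.
    obtain ⟨C, h⟩ := exists_norm_barnesIntegrand_le a a' hc (‖s₀‖ + 2)
    have hcont := continuous_barnesIntegrand a a' hc
    refine (hasDerivAt_integral_of_dominated_loc_of_deriv_le (Metric.ball_mem_nhds s₀ one_pos)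
      (F' := fun s t => deriv (fun s => barnesIntegrand a a' s ((c : ℂ) + t * Complex.I)) s)
      (bound := fun t => C * Real.exp (-(π / 4) * |t|)) (.of_forall fun s => ?_)
      (integrable_barnesIntegrand a a' hc s₀) ?_ (.of_forall fun t s hs => ?_)
      ((integrable_exp_neg_mul_abs (by positivity)).const_mul C)
      (.of_forall fun t s _ =>
        (differentiable_barnesIntegrand a a' _ s).hasDerivAt)).2.differentiableAt
    · exact (integrable_barnesIntegrand a a' hc s).1
    · have h1 := measurable_deriv_with_param
        (f := fun (t : ℝ) (s : ℂ) => barnesIntegrand a a' s ((c : ℂ) + t * Complex.I)) hcont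
      exact (h1.comp (measurable_id.prodMk measurable_const)).aestronglyMeasurable
    · refine (Complex.norm_deriv_le_of_forall_mem_sphere_norm_le one_pos
        (differentiable_barnesIntegrand a a' _).diffContOnCl fun z hz => h z ?_ t).trans_eq
        (div_one _)
      have h1 : ‖z - s‖ = 1 := by simpa using hz
      have h2 : ‖s - s₀‖ < 1 := by simpa [dist_eq_norm] using hs
      calc ‖z‖ = ‖(z - s) + (s - s₀) + s₀‖ := by congr 1; ring
        _ ≤ ‖z - s‖ + ‖s - s₀‖ + ‖s₀‖ := norm_add₃_le
        _ ≤ _ := by linarith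
  simp only [barnesIntegral, integral_mul_const]
  exact (key.mul_const _).const_mul _

end

/-! ### The recursive integrals in logarithmic coordinates -/

theorem integral_fin_one (f : (Fin 1 → ℝ) → ℂ) : ∫ t, f t = ∫ x : ℝ, f fun _ => x :=
  ((volume_preserving_funUnique (Fin 1) ℝ).symm.integral_comp' f).symm

theorem toda_one (α : Fin 1 → ℂ) (x : Fin 1 → ℝ) :
    toda 1 α x = Complex.exp (α 0 * (x 0 : ℝ)) := by
  simp [toda, raiseKernel, raisePot, volume_pi, Measure.real]

/-- Summation by parts: it collects the powers of the y_j in the recursive integral into the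
exponent of the raising kernel. -/
theorem sum_sub_mul_sub : ∀ (N : ℕ) (ξ : Fin (N + 1) → ℂ),
    ∑ j : Fin N, ((N : ℂ) - (j : ℕ)) * (ξ j.castSucc - ξ j.succ) =
      (N + 1) * ξ 0 - ∑ i, ξ i
  | 0, ξ => by simp
  | N + 1, ξ => by
    have h := sum_sub_mul_sub N (Fin.tail ξ)
    have h2 : ∑ i, ξ i = ξ 0 + ∑ i, Fin.tail ξ i := Fin.sum_univ_succ ξ
    have h3 : ∑ j : Fin N, (((N + 1 : ℕ) : ℂ) - (j.succ : ℕ)) *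
        (ξ j.succ.castSucc - ξ j.succ.succ) =
        ∑ j : Fin N, ((N : ℂ) - (j : ℕ)) * (Fin.tail ξ j.castSucc - Fin.tail ξ j.succ) := by
      refine Finset.sum_congr rfl fun j _ => ?_
      rw [Fin.val_succ]
      push_cast
      simp only [Fin.tail, Fin.succ_castSucc]
      ring
    rw [Fin.sum_univ_succ, h3, h, h2]
    simp only [Fin.tail, Fin.castSucc_zero, Fin.val_zero]
    push_cast
    ring

theorem two_mul_sum_sub : ∀ N : ℕ, 2 * ∑ j : Fin N, ((N : ℂ) - (j : ℕ)) = N * (N + 1)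
  | 0 => by simp
  | N + 1 => by
    have h := two_mul_sum_sub N
    have h3 : ∑ j : Fin N, (((N + 1 : ℕ) : ℂ) - (j.succ : ℕ)) = ∑ j : Fin N, ((N : ℂ) - (j : ℕ)) := by
      refine Finset.sum_congr rfl fun j _ => ?_
      rw [Fin.val_succ]
      push_cast
      ring
    rw [Fin.sum_univ_succ, h3]
    simp only [Fin.val_zero]
    push_cast
    linear_combination h

theorem whatW_one_eq (a : Fin 2 → ℂ) (ξ : Fin 2 → ℝ) :
    whatW 1 a (fun j => Real.exp ((ξ j.castSucc - ξ j.succ) / 2)) =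
      Complex.exp (-(∑ i, a i / 2) * (ξ (Fin.last 1) : ℝ)) * toda 2 (fun i => a i / 2) ξ := by
  have hl : Fin.last 1 = 1 := rfl
  rw [whatW, besselK, setIntegral_Ioi_eq_integral_exp, toda_succ, integral_fin_one,
    ← integral_sub_left_eq_self _ _ ((ξ 0 + ξ 1) / 2), ← integral_const_mul, ← integral_const_mul,
    ← integral_const_mul]
  refine integral_congr_ae (.of_forall fun τ => ?_)
  simp only [toda_one, raiseKernel, raisePot, ofReal_exp_cpow, Fin.sum_univ_two, hl, Fin.tail,
    Finset.univ_unique, Finset.sum_singleton, Fin.default_eq_zero,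
    Fin.castSucc_zero, Fin.succ_zero_eq_one]
  rw [Complex.ofReal_exp, Complex.ofReal_exp, mul_left_comm (Complex.exp _)]
  have h2 : ∀ A B C D : ℂ, 2 * A * (1 / 2 * (B * (C * D))) = A * B * C * D := by
    intros; ring
  have hs : ∑ i, ξ i = ξ 0 + ξ 1 := Fin.sum_univ_two ξ
  have he : -(2 * π * Real.exp ((ξ 0 - ξ 1) / 2) / 2) * (Real.exp ((ξ 0 + ξ 1) / 2 - τ) +
      1 / Real.exp ((ξ 0 + ξ 1) / 2 - τ)) =
      -(π * (Real.exp (ξ 0 - τ) + Real.exp (τ - ξ 1))) := by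
    rw [one_div, ← Real.exp_neg, show ξ 0 - τ = (ξ 0 - ξ 1) / 2 + ((ξ 0 + ξ 1) / 2 - τ) by ring,
      show τ - ξ 1 = (ξ 0 - ξ 1) / 2 + -((ξ 0 + ξ 1) / 2 - τ) by ring, Real.exp_add, Real.exp_add]
    ring
  rw [h2, ← Complex.exp_add, ← Complex.exp_add, ← Complex.exp_add, ← Complex.exp_add,
    ← Complex.exp_add, he, hs]
  congr 1
  push_cast
  ring

/-- The left side depends only on the differences of the ξ_j, and the exponential removes the
central character from `toda`. With t_j = e^{τ_j} and ζ_j = ξ_{j+1} - log π - τ_j, the Gaussian-type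
factors of the recursion become the raising potential, and the square roots turn the arguments of
the inner function into differences of the ζ_j. -/
theorem whatW_eq : ∀ (n : ℕ) (a : Fin (n + 1) → ℂ) (ξ : Fin (n + 1) → ℝ),
    whatW n a (fun j => Real.exp ((ξ j.castSucc - ξ j.succ) / 2)) =
      Complex.exp (-(∑ i, a i / 2) * (ξ (Fin.last n) : ℝ)) * toda (n + 1) (fun i => a i / 2) ξ
  | 0, a, ξ => by
    rw [toda_one, ← Complex.exp_add]
    simp [whatW]
  | 1, a, ξ => whatW_one_eq a ξ
  | n + 2, a, ξ => by
    have hn : (n + 2 : ℂ) ≠ 0 := by exact_mod_cast (Nat.succ_ne_zero (n + 1))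
    rw [whatW, setIntegral_posOrthant, toda_succ,
      ← integral_sub_left_eq_self (fun t => raiseKernel (a 0 / 2) ξ t *
        toda (n + 2) (Fin.tail fun i => a i / 2) t) volume
        (fun j : Fin (n + 2) => ξ j.succ - Real.log π),
      ← integral_const_mul]
    refine integral_congr_ae (.of_forall fun τ => ?_)
    set ζ : Fin (n + 2) → ℝ := (fun j : Fin (n + 2) => ξ j.succ - Real.log π) - τ with hζ
    have hζj : ∀ j, ζ j = ξ j.succ - Real.log π - τ j := fun j => rfl
    have harg : (fun j : Fin (n + 1) => Real.exp ((ξ j.succ.castSucc - ξ j.succ.succ) / 2) *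
        √(expMap τ j.succ / expMap τ j.castSucc)) =
        fun j => Real.exp ((ζ j.castSucc - ζ j.succ) / 2) := by
      funext j
      rw [expMap, expMap, ← Real.exp_sub, ← Real.exp_half, ← Real.exp_add, hζj, hζj,
        Fin.succ_castSucc]
      congr 1
      ring
    have hpi : Real.exp (Real.log π) = π := Real.exp_log Real.pi_pos
    have hpim : ∀ x, π * Real.exp x = Real.exp (Real.log π + x) := fun x => by
      rw [Real.exp_add, hpi]
    have hpiy : ∀ j : Fin (n + 2), π * Real.exp ((ξ j.castSucc - ξ j.succ) / 2) =
        Real.exp (Real.log π + (ξ j.castSucc - ξ j.succ) / 2) := fun j => hpim _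
    have htilde : ∀ j, tildeParam a j / 2 = Fin.tail (fun i => a i / 2) j + a 0 / (2 * (n + 2)) := by
      intro j
      simp only [tildeParam, Fin.tail]
      push_cast
      field_simp
    have hsum : ∑ j, tildeParam a j / 2 = ∑ i, a i / 2 := by
      simp_rw [htilde]
      rw [Finset.sum_add_distrib, Finset.sum_const, Finset.card_univ, Fintype.card_fin,
        Fin.sum_univ_succ (fun i => a i / 2), add_comm]
      congr 1
      rw [nsmul_eq_mul]
      push_cast
      field_simp
    have hfac : ∀ j : Fin (n + 2),
        ((Real.exp (-((π * Real.exp ((ξ j.castSucc - ξ j.succ) / 2)) ^ 2 * expMap τ j) -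
          1 / expMap τ j) : ℝ) : ℂ) *
        ((π * Real.exp ((ξ j.castSucc - ξ j.succ) / 2) : ℝ) : ℂ) ^
          (((n + 2 : ℂ) - (j : ℕ)) * a 0 / (n + 2 : ℂ)) *
        ((expMap τ j : ℝ) : ℂ) ^ ((n + 3 : ℂ) * a 0 / (2 * (n + 2 : ℂ))) =
        Complex.exp (-(π * (Real.exp (ξ j.castSucc - ζ j) + Real.exp (ζ j - ξ j.succ)) : ℝ) +
          ((((n + 2 : ℕ) : ℂ) - (j : ℕ)) * (a 0 / (n + 2)) * Real.log π +
          (((n + 2 : ℕ) : ℂ) - (j : ℕ)) * ((ξ j.castSucc : ℂ) - ξ j.succ) * (a 0 / (2 * (n + 2))) +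
          (n + 3 : ℂ) * a 0 / (2 * (n + 2 : ℂ)) * τ j)) := by
      intro j
      have e1 : (π * Real.exp ((ξ j.castSucc - ξ j.succ) / 2)) ^ 2 * expMap τ j =
          π * Real.exp (ξ j.castSucc - ζ j) := by
        rw [hpiy, ← Real.exp_nat_mul, expMap, ← Real.exp_add, hpim, hζj]
        congr 1
        push_cast
        ring
      have e2 : 1 / expMap τ j = π * Real.exp (ζ j - ξ j.succ) := by
        rw [expMap, one_div, ← Real.exp_neg, hpim, hζj]
        congr 1
        ring
      rw [e1, e2, hpiy, expMap, ofReal_exp_cpow, ofReal_exp_cpow, Complex.ofReal_exp,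
        ← Complex.exp_add, ← Complex.exp_add]
      congr 1
      push_cast
      field_simp
      ring
    have hlast : ((π * expMap τ (Fin.last (n + 1)) : ℝ) : ℂ) ^ (-(∑ i, a i) / 2) =
        Complex.exp (-(∑ i, a i) / 2 * (Real.log π + τ (Fin.last (n + 1)) : ℝ)) := by
      rw [← ofReal_exp_cpow, Real.exp_add, hpi, expMap]
    have hone : ((∏ i, Real.exp (τ i) : ℝ) : ℂ) *
        ∏ j : Fin (n + 2), ((1 / expMap τ j : ℝ) : ℂ) = 1 := by
      rw [← Complex.ofReal_prod, ← Complex.ofReal_mul, ← Finset.prod_mul_distrib,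
        Finset.prod_eq_one fun j _ => ?_, Complex.ofReal_one]
      rw [expMap, mul_one_div, div_self (Real.exp_pos _).ne']
    have ih := whatW_eq (n + 1) (tildeParam a) ζ
    -- Passing from a to `tildeParam a` is the tail shifted by a constant, that is, a twist by a
    -- power of the determinant.
    have hshift := toda_add_const (n + 2) (Fin.tail fun i => a i / 2) (a 0 / (2 * (n + 2))) ζ
    simp only [htilde] at ih
    rw [hshift] at ih
    simp only
    rw [harg, ih, Finset.prod_congr rfl fun j _ => hfac j, hlast, ← Complex.exp_sum]
    have hre : ∀ E W P L I : ℂ, E * (W * P * L * I) = (E * I) * (W * P * L) := by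
      intros; ring
    rw [hre, hone, one_mul, raiseKernel]
    have hre2 : ∀ A B T P L : ℂ, A * (B * T) * P * L = (A * B * P * L) * T := by
      intros; ring
    rw [hre2, ← mul_assoc, ← Complex.exp_add, ← Complex.exp_add, ← Complex.exp_add,
      ← Complex.exp_add]
    congr 2
    simp only [← htilde]
    rw [hsum, Finset.sum_add_distrib, Finset.sum_add_distrib, Finset.sum_add_distrib,
      Finset.sum_neg_distrib, ← Complex.ofReal_sum, ← Finset.mul_sum, ← raisePot,
      ← Finset.sum_mul, ← Finset.sum_mul, ← Finset.sum_mul, sum_sub_mul_sub (n + 2) fun i => (ξ i : ℂ),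
      ← Finset.mul_sum]
    have h5 := two_mul_sum_sub (n + 2)
    have h6 : ((∑ j, ζ j : ℝ) : ℂ) = ∑ i, (ξ i : ℂ) - ξ 0 - (n + 2) * Real.log π - ∑ j, (τ j : ℂ) := by
      simp only [hζj, Finset.sum_sub_distrib, Fin.sum_univ_succ (fun i => (ξ i : ℂ))]
      push_cast
      simp
    have h7 := hζj (Fin.last (n + 1))
    have h8 : ∑ i, a i / 2 = (∑ i, a i) / 2 := by rw [Finset.sum_div]
    rw [h8, h7, Complex.ofReal_sub (∑ i, ξ i), h6, Fin.succ_last]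
    have h9 : ∑ j : Fin (n + 2), (((n + 2 : ℕ) : ℂ) - (j : ℕ)) = (n + 2) * (n + 3) / 2 := by
      push_cast at h5 ⊢
      linear_combination h5 / 2
    rw [h9]
    push_cast
    field_simp
    ring

/-! ### Uniqueness of the Iwasawa decomposition -/

theorem torusEntry_pos {n : ℕ} {y : Fin n → ℝ} (hy : ∀ i, 0 < y i) (i : Fin n) :
    0 < torusEntry y i := Finset.prod_pos fun k _ => hy k

theorem torusEntry_injective {n : ℕ} {y y' : Fin n → ℝ} (hy : ∀ i, 0 < y i)
    (h : torusEntry y = torusEntry y') : y = y' := by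
  funext i
  induction i using WellFoundedGT.induction with
  | ind i ih =>
    have h1 := congrFun h i
    rw [torusEntry, torusEntry, ← Finset.Ioi_insert i, Finset.prod_insert (by simp),
      Finset.prod_insert (by simp)] at h1
    have h2 : ∏ k ∈ Finset.Ioi i, y' k = ∏ k ∈ Finset.Ioi i, y k :=
      Finset.prod_congr rfl fun k hk => (ih k (Finset.mem_Ioi.mp hk)).symm
    rw [h2] at h1
    exact mul_right_cancel₀ (Finset.prod_pos fun k _ => hy k).ne' h1

theorem coe_alpha {n : ℕ} {y : Fin n → ℝ} (hy : ∀ i, 0 < y i) :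
    (alpha y : Matrix (Fin n) (Fin n) ℝ) = Matrix.diagonal (torusEntry y) := by
  rw [alpha, dif_pos hy]
  rfl

theorem coe_orthToGL {n : ℕ} (k : Matrix.orthogonalGroup (Fin n) ℝ) :
    (orthToGL k : Matrix (Fin n) (Fin n) ℝ) = k := rfl

/-- An upper triangular matrix with positive diagonal is determined up to right multiplication
by orthogonal matrices. -/
theorem upperTriangular_eq_of_mul_orthogonal {n : ℕ} {A B Q : Matrix (Fin n) (Fin n) ℝ}
    (hA : A.BlockTriangular id) (hB : B.BlockTriangular id) (hA' : ∀ i, 0 < A i i)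
    (hB' : ∀ i, 0 < B i i) (hQ : Q * Q.transpose = 1) (hAB : A = B * Q) : A = B := by
  have hdet : B.det ≠ 0 := by
    rw [Matrix.det_of_isUpperTriangular hB]
    exact (Finset.prod_pos fun i _ => hB' i).ne'
  have hdetA : A.det ≠ 0 := by
    rw [Matrix.det_of_isUpperTriangular hA]
    exact (Finset.prod_pos fun i _ => hA' i).ne'
  let _ := Matrix.invertibleOfIsUnitDet B (isUnit_iff_ne_zero.mpr hdet)
  let _ := Matrix.invertibleOfIsUnitDet A (isUnit_iff_ne_zero.mpr hdetA)
  have hBi : B⁻¹.BlockTriangular id := Matrix.blockTriangular_inv_of_blockTriangular hB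
  have hAi : A⁻¹.BlockTriangular id := Matrix.blockTriangular_inv_of_blockTriangular hA
  -- Both Q and its transpose are upper triangular, so Q is diagonal; orthogonality and the positive
  -- diagonals then force Q = 1.
  have hQ1 : Q = B⁻¹ * A := by rw [hAB, Matrix.inv_mul_cancel_left_of_invertible]
  have hQ2 : Q.transpose = A⁻¹ * B := by
    have h1 : B = A * Q.transpose := by rw [hAB, Matrix.mul_assoc, hQ, Matrix.mul_one]
    conv_rhs => rw [h1]
    rw [Matrix.inv_mul_cancel_left_of_invertible]
  have hQt : Q.BlockTriangular id := by rw [hQ1]; exact hBi.mul hA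
  have hQt2 : Q.transpose.BlockTriangular id := by rw [hQ2]; exact hAi.mul hB
  have hoff : ∀ i j, i ≠ j → Q i j = 0 := by
    intro i j hij
    rcases lt_or_gt_of_ne hij with h | h
    · exact hQt2 h
    · exact hQt h
  have hdiag : ∀ i, Q i i = 1 := by
    intro i
    have h1 : A i i = B i i * Q i i := by
      conv_lhs => rw [hAB]
      rw [Matrix.mul_apply, Finset.sum_eq_single i (fun k _ hk => by rw [hoff k i hk, mul_zero])
        (by simp)]
    have h2 : Q i i * Q i i = 1 := by
      have h3 := congrFun (congrFun hQ i) i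
      rwa [Matrix.mul_apply, Finset.sum_eq_single i
        (fun k _ hk => by rw [hoff i k hk.symm, zero_mul]) (by simp), Matrix.transpose_apply,
        Matrix.one_apply_eq] at h3
    have h4 : 0 < Q i i := by
      have := hA' i
      rw [h1] at this
      exact (pos_iff_pos_of_mul_pos this).mp (hB' i)
    nlinarith
  have hone : Q = 1 := by
    ext i j
    by_cases hij : i = j
    · rw [hij, hdiag, Matrix.one_apply_eq]
    · rw [hoff i j hij, Matrix.one_apply_ne hij]
  rw [hAB, hone, Matrix.mul_one]

/-- `radialExtension` selects a decomposition by choice; uniqueness makes its value computable from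
any known decomposition. -/
theorem IsIwasawa.unique {n : ℕ} {g x x' : GL (Fin n) ℝ} {y y' : Fin n → ℝ}
    (h : IsIwasawa g x y) (h' : IsIwasawa g x' y') : x = x' ∧ y = y' := by
  obtain ⟨⟨hx1, hx2⟩, hy, k, hk⟩ := h
  obtain ⟨⟨hx1', hx2'⟩, hy', k', hk'⟩ := h'
  have hentry : ∀ (x : GL (Fin n) ℝ) {y : Fin n → ℝ}, (∀ i, 0 < y i) → ∀ i j,
      ((x * alpha y : GL (Fin n) ℝ) : Matrix (Fin n) (Fin n) ℝ) i j =
        (x : Matrix (Fin n) (Fin n) ℝ) i j * torusEntry y j := by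
    intro x y hy i j
    rw [Units.val_mul, coe_alpha hy, Matrix.mul_diagonal]
  have hEq : ((x * alpha y : GL (Fin n) ℝ) : Matrix (Fin n) (Fin n) ℝ) =
      ((x' * alpha y' : GL (Fin n) ℝ) : Matrix (Fin n) (Fin n) ℝ) := by
    refine upperTriangular_eq_of_mul_orthogonal
      (Q := ((k' * k⁻¹ : Matrix.orthogonalGroup (Fin n) ℝ) : Matrix (Fin n) (Fin n) ℝ))
      (fun i j hij => ?_) (fun i j hij => ?_) (fun i => ?_) (fun i => ?_) ?_ ?_
    · rw [hentry x hy, hx2 i j hij, zero_mul]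
    · rw [hentry x' hy', hx2' i j hij, zero_mul]
    · rw [hentry x hy, hx1, one_mul]
      exact torusEntry_pos hy i
    · rw [hentry x' hy', hx1', one_mul]
      exact torusEntry_pos hy' i
    · exact (Matrix.mem_orthogonalGroup_iff (Fin n) ℝ).mp (k' * k⁻¹).2
    · have h1 : x * alpha y = x' * alpha y' * orthToGL (k' * k⁻¹) := by
        have h2 : orthToGL (k' * k⁻¹) = orthToGL k' * (orthToGL k)⁻¹ := by
          simp [orthToGL]
        rw [h2, ← mul_assoc, ← hk', hk, mul_inv_cancel_right]
      rw [h1, Units.val_mul _ (orthToGL _), coe_orthToGL]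
  have hyy : y = y' := by
    refine torusEntry_injective hy (funext fun i => ?_)
    have h1 := congrFun (congrFun hEq i) i
    rwa [hentry x hy, hentry x' hy', hx1, hx1', one_mul, one_mul] at h1
  refine ⟨?_, hyy⟩
  subst hyy
  exact mul_right_cancel (Units.ext hEq)

theorem radialExtension_eq {n : ℕ} (χ : GL (Fin n) ℝ → ℂ) (w : (Fin n → ℝ) → ℂ)
    {g x : GL (Fin n) ℝ} {y : Fin n → ℝ} (h : IsIwasawa g x y) :
    radialExtension χ w g = χ x * w y := by
  have hex : ∃ p : GL (Fin n) ℝ × (Fin n → ℝ), IsIwasawa g p.1 p.2 := ⟨(x, y), h⟩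
  rw [radialExtension, dif_pos hex]
  obtain ⟨h1, h2⟩ := hex.choose_spec.unique h
  rw [h1, h2]

theorem psi_one {n : ℕ} : psi (1 : GL (Fin n) ℝ) = 1 := by
  rw [psi, Finset.sum_eq_zero fun i _ => ?_, mul_zero, Complex.exp_zero]
  split_ifs with h
  · rw [Units.val_one, Matrix.one_apply_ne, Complex.ofReal_zero]
    intro h2
    have := congrArg Fin.val h2
    simp at this
  · rfl

theorem isUpperUnipotent_one {n : ℕ} : IsUpperUnipotent (1 : GL (Fin n) ℝ) :=
  ⟨fun i => by simp, fun i j hij => by simp [hij.ne']⟩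

theorem isIwasawa_cosetRep {m : ℕ} {y : Fin m → ℝ} (hy : ∀ i, 0 < y i)
    (k : Matrix.orthogonalGroup (Fin m) ℝ) : IsIwasawa (cosetRep (y, k)) 1 y :=
  ⟨isUpperUnipotent_one, hy, k, by rw [one_mul, cosetRep]⟩

theorem torusEntry_append_castAdd {m d : ℕ} (y : Fin m → ℝ) (i : Fin m) :
    torusEntry (Fin.append y fun _ : Fin d => (1 : ℝ)) (Fin.castAdd d i) = torusEntry y i := by
  rw [torusEntry, torusEntry, ← Finset.filter_le_eq_Ici, ← Finset.filter_le_eq_Ici,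
    Finset.prod_filter, Finset.prod_filter, Fin.prod_univ_add]
  simp only [Fin.le_def, Fin.val_castAdd, Fin.append_left, Fin.append_right, ite_self,
    Finset.prod_const_one, mul_one]

theorem torusEntry_append_natAdd {m d : ℕ} (y : Fin m → ℝ) (i : Fin d) :
    torusEntry (Fin.append y fun _ : Fin d => (1 : ℝ)) (Fin.natAdd m i) = 1 := by
  rw [torusEntry, ← Finset.filter_le_eq_Ici, Finset.prod_filter, Fin.prod_univ_add]
  have h (j : Fin m) : ¬ Fin.natAdd m i ≤ Fin.castAdd d j := by
    rw [Fin.le_def]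
    simp
    omega
  simp [h]

theorem isIwasawa_blockEmbed {m d : ℕ} {y : Fin m → ℝ} (hy : ∀ i, 0 < y i)
    (k : Matrix.orthogonalGroup (Fin m) ℝ) :
    IsIwasawa (blockEmbed d (cosetRep (y, k))) 1 (Fin.append y fun _ : Fin d => (1 : ℝ)) := by
  have hy' : ∀ i, 0 < Fin.append y (fun _ : Fin d => (1 : ℝ)) i := fun i => by
    refine Fin.addCases (fun j => ?_) (fun j => ?_) i
    · simpa using hy j
    · simp
  have hk := (Matrix.mem_orthogonalGroup_iff (Fin m) ℝ).mp k.2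
  set K : Matrix (Fin (m + d)) (Fin (m + d)) ℝ := (Matrix.fromBlocks
    (k : Matrix (Fin m) (Fin m) ℝ) 0 0 (1 : Matrix (Fin d) (Fin d) ℝ)).reindex
      finSumFinEquiv finSumFinEquiv with hK
  have hKo : K ∈ Matrix.orthogonalGroup (Fin (m + d)) ℝ := by
    rw [Matrix.mem_orthogonalGroup_iff, hK, Matrix.transpose_reindex,
      Matrix.reindex_apply, Matrix.reindex_apply, Matrix.submatrix_mul_equiv,
      Matrix.fromBlocks_transpose, Matrix.fromBlocks_multiply]
    simp [hk]
  refine ⟨isUpperUnipotent_one, hy', ⟨K, hKo⟩, Units.ext ?_⟩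
  rw [one_mul, Units.val_mul, coe_alpha hy', coe_orthToGL]
  have hD : Matrix.diagonal (torusEntry (Fin.append y fun _ : Fin d => (1 : ℝ))) =
      (Matrix.fromBlocks (Matrix.diagonal (torusEntry y)) 0 0
        (1 : Matrix (Fin d) (Fin d) ℝ)).reindex finSumFinEquiv finSumFinEquiv := by
    rw [← Matrix.diagonal_one, Matrix.fromBlocks_diagonal, Matrix.reindex_apply,
      Matrix.submatrix_diagonal_equiv]
    congr 1
    funext i
    refine Fin.addCases (fun j => ?_) (fun j => ?_) i
    · simp [torusEntry_append_castAdd]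
    · simp [torusEntry_append_natAdd]
  change _ = _ * K
  rw [hD, hK, Matrix.reindex_apply, Matrix.reindex_apply, Matrix.submatrix_mul_equiv,
    Matrix.fromBlocks_multiply]
  simp only [Matrix.mul_zero, Matrix.zero_mul, add_zero, zero_add, Matrix.mul_one]
  rw [← coe_alpha hy, ← coe_orthToGL, ← Units.val_mul]
  rfl

theorem abs_det_cosetRep {m : ℕ} {y : Fin m → ℝ} (hy : ∀ i, 0 < y i)
    (k : Matrix.orthogonalGroup (Fin m) ℝ) :
    |(cosetRep (y, k) : Matrix (Fin m) (Fin m) ℝ).det| = ∏ i, torusEntry y i := by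
  have h1 : |(k : Matrix (Fin m) (Fin m) ℝ).det| = 1 := by
    have h2 := congrArg Matrix.det ((Matrix.mem_orthogonalGroup_iff (Fin m) ℝ).mp k.2)
    rw [Matrix.det_mul, Matrix.det_transpose, Matrix.det_one] at h2
    rcases mul_self_eq_one_iff.mp h2 with h | h <;> simp [h]
  rw [cosetRep, Units.val_mul, coe_alpha hy, coe_orthToGL, Matrix.det_mul, Matrix.det_diagonal,
    abs_mul, h1, mul_one, abs_of_pos (Finset.prod_pos fun i _ => torusEntry_pos hy i)]

theorem zetaIntegrand_cosetRep {m d : ℕ} (a : Fin (m + d) → ℂ) (a' : Fin m → ℂ) (s : ℂ)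
    {y : Fin m → ℝ} (hy : ∀ i, 0 < y i) (k : Matrix.orthogonalGroup (Fin m) ℝ) :
    zetaIntegrand (whittaker a) (whittakerBar a') s (cosetRep (y, k)) =
      whitRadial (m + d) a (Fin.append y fun _ => 1) * whitRadial m a' y *
        ((∏ i, torusEntry y i : ℝ) : ℂ) ^ (s - (d : ℂ) / 2) := by
  rw [zetaIntegrand, whittaker, whittakerBar, radialExtension_eq _ _ (isIwasawa_blockEmbed hy k),
    radialExtension_eq _ _ (isIwasawa_cosetRep hy k), abs_det_cosetRep hy, psi_one, psi_one,
    inv_one, one_mul, one_mul]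

/-! ### Logarithmic coordinates on the torus -/

/-- The torus coordinates `y` with `y_i ⋯ y_n = exp (ξ_i / 2)`. -/
def rootCoord {n : ℕ} (ξ : Fin n → ℝ) : Fin n → ℝ := fun j =>
  Real.exp ((ξ j - Fin.snoc (α := fun _ => ℝ) ξ 0 j.succ) / 2)

theorem rootCoord_pos {n : ℕ} (ξ : Fin n → ℝ) (j : Fin n) : 0 < rootCoord ξ j := Real.exp_pos _

theorem rootCoord_castSucc {n : ℕ} (ξ : Fin (n + 1) → ℝ) (j : Fin n) :
    rootCoord ξ j.castSucc = Real.exp ((ξ j.castSucc - ξ j.succ) / 2) := by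
  rw [rootCoord, Fin.succ_castSucc, Fin.snoc_castSucc]

theorem rootCoord_last {n : ℕ} (ξ : Fin (n + 1) → ℝ) :
    rootCoord ξ (Fin.last n) = Real.exp (ξ (Fin.last n) / 2) := by
  rw [rootCoord, Fin.succ_last, Fin.snoc_last, sub_zero]

theorem torusEntry_rootCoord {n : ℕ} (ξ : Fin n → ℝ) (i : Fin n) :
    torusEntry (rootCoord ξ) i = Real.exp (ξ i / 2) := by
  induction i using WellFoundedGT.induction with
  | ind i ih =>
    cases n with
    | zero => exact i.elim0
    | succ n =>
      rw [torusEntry, ← Finset.Ioi_insert i, Finset.prod_insert (by simp)]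
      induction i using Fin.lastCases with
      | last =>
        have : Finset.Ioi (Fin.last n) = ∅ := by
          ext j
          simp [Fin.le_last]
        rw [this, Finset.prod_empty, mul_one, rootCoord_last]
      | cast j =>
        have : Finset.Ioi j.castSucc = Finset.Ici j.succ := by
          ext k
          rw [Finset.mem_Ioi, Finset.mem_Ici, Fin.castSucc_lt_iff_succ_le]
        have h2 := ih j.succ (Fin.castSucc_lt_succ)
        rw [torusEntry] at h2
        rw [this, h2, rootCoord_castSucc, ← Real.exp_add]
        congr 1
        ring

theorem append_rootCoord {m : ℕ} (ξ : Fin m → ℝ) :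
    (Fin.append (rootCoord ξ) fun _ : Fin 2 => (1 : ℝ)) = rootCoord (extendTwo ξ 0) := by
  have hpos : ∀ i, 0 < Fin.append (rootCoord ξ) (fun _ : Fin 2 => (1 : ℝ)) i := fun i => by
    refine Fin.addCases (fun j => ?_) (fun j => ?_) i
    · simpa using rootCoord_pos ξ j
    · simp
  refine torusEntry_injective hpos (funext fun i => ?_)
  rw [torusEntry_rootCoord]
  refine Fin.addCases (fun j => ?_) (fun j => ?_) i
  · rw [torusEntry_append_castAdd, torusEntry_rootCoord]
    congr 2
    exact (Eq.trans (Fin.snoc_castSucc (α := fun _ => ℝ) _ _ j.castSucc)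
      (Fin.snoc_castSucc (α := fun _ => ℝ) _ _ j)).symm
  · rw [torusEntry_append_natAdd]
    have : extendTwo ξ 0 (Fin.natAdd m j) = 0 := by
      fin_cases j
      · exact Eq.trans (Fin.snoc_castSucc (α := fun _ => ℝ) _ _ (Fin.last m))
          (Fin.snoc_last (α := fun _ => ℝ) _ _)
      · exact Fin.snoc_last (α := fun _ => ℝ) _ _
    rw [this, zero_div, Real.exp_zero]

/-- The factor y_N^{|a|} cancels the central exponential of `whatW_eq`. -/
theorem whitRadial_rootCoord : ∀ {N : ℕ} (a : Fin N → ℂ) (ξ : Fin N → ℝ),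
    whitRadial N a (rootCoord ξ) =
      ((∏ j : Fin N, (rootCoord ξ j) ^
        ((((j : ℕ) : ℝ) + 1) * ((N : ℝ) - ((j : ℕ) + 1)) / 2) : ℝ) : ℂ) *
      toda N (fun i => a i / 2) ξ
  | 0, a, ξ => by simp [whitRadial, toda]
  | n + 1, a, ξ => by
    have h := whatW_eq n a ξ
    have h1 : (fun j : Fin n => rootCoord ξ j.castSucc) =
        fun j => Real.exp ((ξ j.castSucc - ξ j.succ) / 2) := funext (rootCoord_castSucc ξ)
    rw [whitRadial, h1, h, rootCoord_last, ofReal_exp_cpow, mul_assoc, ← mul_assoc (Complex.exp _),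
      ← Complex.exp_add, Fin.prod_univ_castSucc]
    have h2 : (∑ i, a i) * ((ξ (Fin.last n) / 2 : ℝ) : ℂ) +
        -(∑ i, a i / 2) * (ξ (Fin.last n) : ℝ) = 0 := by
      rw [← Finset.sum_div]
      push_cast
      ring
    rw [h2, Complex.exp_zero, one_mul]
    congr 2
    -- The exponent j(N - j)/2 vanishes at j = N, so the product may run over all N coordinates.
    have h3 : ((((Fin.last n : Fin (n + 1)) : ℕ) : ℝ) + 1) *
        (((n + 1 : ℕ) : ℝ) - (((Fin.last n : Fin (n + 1)) : ℕ) + 1)) / 2 = 0 := by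
      rw [Fin.val_last]
      push_cast
      ring
    rw [h3, Real.rpow_zero, mul_one]
    refine Finset.prod_congr rfl fun j _ => ?_
    congr 1
    rw [Fin.val_castSucc]
    push_cast
    ring

/-! ### The zeta integral in logarithmic coordinates -/

/-- The density of the invariant measure on `X_m \ GL_m(ℝ)` in the torus coordinates. -/
def torusDensity {m : ℕ} (y : Fin m → ℝ) : ℝ :=
  ∏ j : Fin m, (y j) ^ (-((((j : ℕ) : ℝ) + 1) * ((m : ℝ) - ((j : ℕ) + 1)))) / y j

theorem measurable_torusDensity {m : ℕ} : Measurable (torusDensity (m := m)) := by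
  unfold torusDensity
  fun_prop

theorem torusDensity_nonneg {m : ℕ} {y : Fin m → ℝ} (hy : ∀ i, 0 < y i) : 0 ≤ torusDensity y :=
  Finset.prod_nonneg fun j _ => div_nonneg (Real.rpow_nonneg (hy j).le _) (hy j).le

theorem measurableSet_posOrthant (m : ℕ) : MeasurableSet (posOrthant m) := by
  have : posOrthant m = ⋂ i, {y : Fin m → ℝ | 0 < y i} := by
    ext y
    simp [posOrthant]
  rw [this]
  exact MeasurableSet.iInter fun i => measurableSet_lt measurable_const (measurable_pi_apply i)

theorem orthHaar_univ (m : ℕ) : orthHaar m Set.univ = 1 :=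
  Measure.haarMeasure_self (K₀ := ⊤)

/-- For integrands independent of the orthogonal component, O(m) contributes only its total mass
2^m. -/
theorem integrable_quotientMeasure {m : ℕ} {f : (Fin m → ℝ) × Matrix.orthogonalGroup (Fin m) ℝ → ℂ}
    {F : (Fin m → ℝ) → ℂ} (hf : ∀ y, (∀ i, 0 < y i) → ∀ k, f (y, k) = F y)
    (hF : IntegrableOn (fun y => (torusDensity y : ℂ) * F y) (posOrthant m)) :
    Integrable f (quotientMeasure m) ∧
      ∫ p, f p ∂(quotientMeasure m) =
        2 ^ m * ∫ y in posOrthant m, (torusDensity y : ℂ) * F y := by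
  have hfin : IsFiniteMeasure ((2 : ENNReal) ^ m • orthHaar m) :=
    ⟨by simp [orthHaar_univ]⟩
  have hmass : ((2 : ENNReal) ^ m • orthHaar m).real Set.univ = 2 ^ m := by
    simp [Measure.real, orthHaar_univ]
  have hmeas : Measurable fun y : Fin m → ℝ => ENNReal.ofReal (torusDensity y) :=
    measurable_torusDensity.ennreal_ofReal
  set ν : Measure (Fin m → ℝ) := (volume.restrict (posOrthant m)).withDensity
    fun y => ENNReal.ofReal (torusDensity y) with hν
  have hq : quotientMeasure m = ν.prod ((2 : ENNReal) ^ m • orthHaar m) := rfl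
  have hae : f =ᵐ[quotientMeasure m] fun p => F p.1 := by
    have h1 : ∀ᵐ y ∂ν, y ∈ posOrthant m :=
      (withDensity_absolutelyContinuous _ _).ae_le (ae_restrict_mem (measurableSet_posOrthant m))
    rw [hq]
    filter_upwards [Measure.quasiMeasurePreserving_fst.ae h1] with p hp
    exact hf p.1 hp p.2
  have hreal : ∀ᵐ y ∂(volume.restrict (posOrthant m)),
      (torusDensity y : ℂ) * F y = (ENNReal.ofReal (torusDensity y)).toReal • F y := by
    filter_upwards [ae_restrict_mem (measurableSet_posOrthant m)] with y hy
    rw [ENNReal.toReal_ofReal (torusDensity_nonneg hy), Complex.real_smul]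
  have hFν : Integrable F ν :=
    (integrable_withDensity_iff_integrable_smul' hmeas
      (.of_forall fun _ => ENNReal.ofReal_lt_top)).mpr (Integrable.congr hF hreal)
  refine ⟨?_, ?_⟩
  · rw [integrable_congr hae, hq]
    exact hFν.comp_fst _
  · rw [integral_congr_ae hae, hq, integral_fun_fst, hmass, integral_congr_ae hreal, hν,
      integral_withDensity_eq_integral_toReal_smul hmeas
        (.of_forall fun _ => ENNReal.ofReal_lt_top), Complex.real_smul]
    push_cast
    rfl

/-! ### The linear change of torus coordinates and its Jacobian -/

theorem prod_torusEntry {m : ℕ} (y : Fin m → ℝ) :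
    ∏ i, torusEntry y i = ∏ j : Fin m, y j ^ ((j : ℕ) + 1) := by
  simp only [torusEntry]
  rw [Finset.prod_comm' (t' := Finset.univ) (s' := fun k => Finset.Iic k) (by simp)]
  simp

/-- The matrix of the linear map `η ↦ ξ`, `ξ_j = 2 (η_j + ⋯ + η_m)`, which inverts `rootCoord` in
logarithmic coordinates. -/
def partialSumMatrix (m : ℕ) : Matrix (Fin m) (Fin m) ℝ := fun j k => if j ≤ k then 2 else 0

theorem det_partialSumMatrix (m : ℕ) : (partialSumMatrix m).det = 2 ^ m := by
  rw [Matrix.det_of_isUpperTriangular]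
  · simp [partialSumMatrix]
  · intro i j hij
    exact if_neg (not_le.mpr hij)

theorem rootCoord_partialSum {m : ℕ} (η : Fin m → ℝ) :
    rootCoord (Matrix.toLin' (partialSumMatrix m) η) = expMap η := by
  refine torusEntry_injective (rootCoord_pos _) (funext fun i => ?_)
  rw [torusEntry_rootCoord, torusEntry, Matrix.toLin'_apply, Matrix.mulVec, dotProduct]
  simp only [expMap]
  rw [← Real.exp_sum, ← Finset.filter_le_eq_Ici, Finset.sum_filter, Finset.sum_div]
  congr 1
  refine Finset.sum_congr rfl fun k _ => ?_
  by_cases h : i ≤ k <;> simp [partialSumMatrix, h]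

theorem map_partialSum (m : ℕ) :
    Measure.map (Matrix.toLin' (partialSumMatrix m)) volume =
      ENNReal.ofReal ((2 ^ m)⁻¹) • volume := by
  rw [Real.map_matrix_volume_pi_eq_smul_volume_pi (by rw [det_partialSumMatrix]; positivity),
    det_partialSumMatrix, abs_of_pos (by positivity)]

/-- The integrand of the zeta integral in the torus coordinates. -/
def zetaRadial {m : ℕ} (a : Fin (m + 2) → ℂ) (a' : Fin m → ℂ) (s : ℂ) (y : Fin m → ℝ) : ℂ :=
  whitRadial (m + 2) a (Fin.append y fun _ => 1) * whitRadial m a' y *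
    ((∏ i, torusEntry y i : ℝ) : ℂ) ^ (s - ((2 : ℕ) : ℂ) / 2)

theorem prod_rpow_rootCoord_extendTwo {m : ℕ} (ξ : Fin m → ℝ) :
    ∏ j : Fin (m + 2), (rootCoord (extendTwo ξ 0) j) ^
        ((((j : ℕ) : ℝ) + 1) * (((m + 2 : ℕ) : ℝ) - ((j : ℕ) + 1)) / 2) =
      ∏ j : Fin m, (rootCoord ξ j) ^ ((((j : ℕ) : ℝ) + 1) * ((m : ℝ) + 2 - ((j : ℕ) + 1)) / 2) := by
  rw [← append_rootCoord, Fin.prod_univ_add]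
  simp

/-- The powers of y_j from the Jacobian, the invariant density and the two modular factors add up to
y_j^j, that is, to one power of the determinant. This turns the exponent s - 1 into s. -/
theorem density_mul_zetaRadial {m : ℕ} (a : Fin (m + 2) → ℂ) (a' : Fin m → ℂ) (s : ℂ)
    (ξ : Fin m → ℝ) :
    ((∏ j, rootCoord ξ j : ℝ) : ℂ) *
        ((torusDensity (rootCoord ξ) : ℂ) * zetaRadial a a' s (rootCoord ξ)) =
      toda (m + 2) (fun j => a j / 2) (extendTwo ξ 0) * toda m (fun j => a' j / 2) ξ *
        Complex.exp (s / 2 * (∑ i, ξ i : ℝ)) := by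
  have hT : ∏ i, torusEntry (rootCoord ξ) i = Real.exp ((∑ i, ξ i) / 2) := by
    simp_rw [torusEntry_rootCoord]
    rw [← Real.exp_sum, Finset.sum_div]
  have hreal : (∏ j, rootCoord ξ j) * torusDensity (rootCoord ξ) *
      (∏ j : Fin m, (rootCoord ξ j) ^ ((((j : ℕ) : ℝ) + 1) * ((m : ℝ) + 2 - ((j : ℕ) + 1)) / 2)) *
      (∏ j : Fin m, (rootCoord ξ j) ^ ((((j : ℕ) : ℝ) + 1) * ((m : ℝ) - ((j : ℕ) + 1)) / 2)) =
      Real.exp ((∑ i, ξ i) / 2) := by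
    rw [← hT, prod_torusEntry, torusDensity, ← Finset.prod_mul_distrib, ← Finset.prod_mul_distrib,
      ← Finset.prod_mul_distrib]
    refine Finset.prod_congr rfl fun j _ => ?_
    have hy := rootCoord_pos ξ j
    rw [mul_div_cancel₀ _ hy.ne', ← Real.rpow_add hy, ← Real.rpow_add hy, ← Real.rpow_natCast]
    congr 1
    push_cast
    ring
  rw [zetaRadial, append_rootCoord, whitRadial_rootCoord, whitRadial_rootCoord,
    prod_rpow_rootCoord_extendTwo, hT, ofReal_exp_cpow]
  have hc := congrArg (fun r : ℝ => (r : ℂ)) hreal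
  simp only [Complex.ofReal_mul] at hc
  have he : Complex.exp (s / 2 * (∑ i, ξ i : ℝ)) = (Real.exp ((∑ i, ξ i) / 2) : ℝ) *
      Complex.exp ((s - ((2 : ℕ) : ℂ) / 2) * ((∑ i, ξ i) / 2 : ℝ)) := by
    rw [Complex.ofReal_exp, ← Complex.exp_add]
    congr 1
    push_cast
    ring
  rw [he, ← hc]
  ring

theorem zetaConverges_and_eq_zetaLog {m : ℕ} {a : Fin (m + 2) → ℂ} {a' : Fin m → ℂ} {s : ℂ}
    (hs : ∀ j k, 0 < (s + a j + a' k).re) :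
    ZetaConverges a a' s ∧
      zetaIntegral a a' s = zetaLog (s / 2) (fun j => a j / 2) (fun j => a' j / 2) 0 := by
  have hσ : ∀ j k, 0 < (s / 2 + a j / 2 + a' k / 2).re := fun j k => by
    have h : s / 2 + a j / 2 + a' k / 2 = ((1 / 2 : ℝ) : ℂ) * (s + a j + a' k) := by
      push_cast
      ring
    rw [h, Complex.re_ofReal_mul]
    exact mul_pos (by norm_num) (hs j k)
  have hZ := integrable_zetaLog (α := fun j => a j / 2) (β := fun j => a' j / 2) hσ 0
  set Z : (Fin m → ℝ) → ℂ := fun x => toda (m + 2) (fun j => a j / 2) (extendTwo x 0) *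
    toda m (fun j => a' j / 2) x * Complex.exp (s / 2 * (∑ i, x i : ℝ)) with hZdef
  have hZm : Measurable Z := by
    fun_prop
  have hU : Measurable (Matrix.toLin' (partialSumMatrix m)) :=
    (LinearMap.continuous_of_finiteDimensional _).measurable
  have hpt : ∀ η : Fin m → ℝ, ((∏ i, Real.exp (η i) : ℝ) : ℂ) *
      ((torusDensity (expMap η) : ℂ) * zetaRadial a a' s (expMap η)) =
        Z (Matrix.toLin' (partialSumMatrix m) η) := fun η => by
    rw [hZdef]
    simp only
    rw [← density_mul_zetaRadial, rootCoord_partialSum]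
    rfl
  have hint : IntegrableOn (fun y => (torusDensity y : ℂ) * zetaRadial a a' s y)
      (posOrthant m) := by
    rw [integrableOn_posOrthant_iff]
    simp only [hpt]
    refine (integrable_map_measure hZm.aestronglyMeasurable hU.aemeasurable).mp ?_
    rw [map_partialSum]
    exact hZ.smul_measure ENNReal.ofReal_ne_top
  have hf : ∀ y : Fin m → ℝ, (∀ i, 0 < y i) → ∀ k, zetaIntegrand (whittaker a)
      (whittakerBar a') s (cosetRep (y, k)) = zetaRadial a a' s y :=
    fun y hy k => zetaIntegrand_cosetRep a a' s hy k
  obtain ⟨h1, h2⟩ := integrable_quotientMeasure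
    (f := fun p => zetaIntegrand (whittaker a) (whittakerBar a') s (cosetRep p)) hf hint
  refine ⟨h1, h2.trans ?_⟩
  rw [setIntegral_posOrthant]
  simp only [hpt]
  -- The Jacobian 2^{-m}, due to the squares in the definition of the logarithmic coordinates,
  -- cancels the mass 2^m of O(m).
  rw [← integral_map hU.aemeasurable hZm.aestronglyMeasurable, map_partialSum,
    integral_smul_measure, ENNReal.toReal_ofReal (by positivity), Complex.real_smul,
    ← mul_assoc, Complex.ofReal_inv, Complex.ofReal_pow, Complex.ofReal_ofNat,
    mul_inv_cancel₀ (pow_ne_zero m two_ne_zero), one_mul]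
  rfl

/-! ### Identification with the Barnes integral -/

/-- Since `gammaInt v` is Γ_ℝ(2v) for Re v > 0, halving all parameters produces the stated factors.
The denominators Γ_ℝ(s + w + a'_k) have arguments with positive real part, because Re w exceeds
every Re a_j, so they can be divided out. -/
theorem zetaMellin_eq_barnesIntegrand {m : ℕ} {a : Fin (m + 2) → ℂ} {a' : Fin m → ℂ} {s w : ℂ}
    (hs : ∀ j k, 0 < (s + a j + a' k).re) (hw : ∀ j, (a j).re < w.re) :
    zetaMellin (s / 2) (w / 2) (fun j => a j / 2) (fun j => a' j / 2) =
      (∏ j, ∏ k, Complex.Gammaℝ (s + a j + a' k)) * barnesIntegrand a a' s w := by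
  have hre : ∀ z : ℂ, (z / 2).re = z.re / 2 := fun z => Complex.div_ofNat_re z 2
  have h := zetaMellin_mul_prod (σ := s / 2) (ω := w / 2) (α := fun j => a j / 2)
    (β := fun j => a' j / 2) (fun j k => by
      rw [← add_div, ← add_div, hre]
      linarith [hs j k]) (fun j => by
      rw [hre, hre]
      linarith [hw j])
  have hsw : ∀ k, 0 < (s + w + a' k).re := fun k => by
    have h1 := hs 0 k
    have h2 := hw 0
    simp only [Complex.add_re] at h1 ⊢
    linarith
  have e1 : ∀ k, gammaInt (s / 2 + w / 2 + a' k / 2) = Complex.Gammaℝ (s + w + a' k) := fun k => by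
    rw [gammaInt_eq, ← add_div, ← add_div, mul_div_cancel₀ _ two_ne_zero]
    rw [← add_div, ← add_div, hre]
    linarith [hsw k]
  have e2 : ∀ j k, gammaInt (s / 2 + a j / 2 + a' k / 2) = Complex.Gammaℝ (s + a j + a' k) :=
    fun j k => by
      rw [gammaInt_eq, ← add_div, ← add_div, mul_div_cancel₀ _ two_ne_zero]
      rw [← add_div, ← add_div, hre]
      linarith [hs j k]
  have e3 : ∀ j, gammaInt (w / 2 - a j / 2) = Complex.Gammaℝ (w - a j) := fun j => by
    rw [gammaInt_eq, ← sub_div, mul_div_cancel₀ _ two_ne_zero]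
    rw [← sub_div, hre, Complex.sub_re]
    linarith [hw j]
  simp only [e1, e2, e3] at h
  rw [barnesIntegrand, ← mul_div_assoc, ← h, mul_div_cancel_right₀]
  exact Finset.prod_ne_zero_iff.mpr fun k _ => Complex.Gammaℝ_ne_zero_of_re_pos (hsw k)

theorem zetaLog_zero_eq_barnesIntegral {m : ℕ} {a : Fin (m + 2) → ℂ} {a' : Fin m → ℂ} {s : ℂ}
    (hs : ∀ j k, 0 < (s + a j + a' k).re) {c : ℝ} (hc : ∀ j, (a j).re < c) :
    zetaLog (s / 2) (fun j => a j / 2) (fun j => a' j / 2) 0 =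
      (∏ j, ∏ k, Complex.Gammaℝ (s + a j + a' k)) * barnesIntegral a a' c s := by
  have hre : ∀ z : ℂ, (z / 2).re = z.re / 2 := fun z => Complex.div_ofNat_re z 2
  have hmel : ∀ ξ : ℝ, zetaMellin (s / 2) (((c / 2 : ℝ) : ℂ) + 2 * π * ξ * Complex.I)
      (fun j => a j / 2) (fun j => a' j / 2) =
      (∏ j, ∏ k, Complex.Gammaℝ (s + a j + a' k)) *
        barnesIntegrand a a' s (c + ((4 * π * ξ : ℝ) : ℂ) * Complex.I) := fun ξ => by
    rw [← zetaMellin_eq_barnesIntegrand hs fun j => by simpa using hc j]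
    congr 1
    push_cast
    ring
  -- With ω = w/2, the inversion line ω = c/2 + 2πiξ is w = c + it with t = 4πξ; the Jacobian 1/(4π)
  -- is the constant in front of the Barnes integral.
  have hπ : (4 * π : ℝ) ≠ 0 := by positivity
  have hint := (integrable_barnesIntegrand a a' hc s).comp_mul_left' hπ
  rw [zetaLog_zero_eq_integral (c := c / 2) (fun j k => ?_) (fun j => ?_) ?_]
  · simp only [hmel]
    rw [integral_const_mul, Measure.integral_comp_mul_left
      (fun t : ℝ => barnesIntegrand a a' s (c + (t : ℂ) * Complex.I)), barnesIntegral,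
      integral_mul_const, abs_of_pos (by positivity), Complex.real_smul]
    generalize ∫ t : ℝ, barnesIntegrand a a' s (c + (t : ℂ) * Complex.I) = B
    push_cast
    field_simp
  · simp only [hmel]
    exact hint.const_mul _
  · rw [← add_div, ← add_div, hre]
    linarith [hs j k]
  · rw [hre]
    linarith [hc j]

end GLZeta

end

theorem theorem2p3 (m : ℕ) (hm : 1 ≤ m) (a : Fin (m + 2) → ℂ) (a' : Fin m → ℂ) :
    (∀ c : ℝ, (∀ j, (a j).re < c) →
      (∀ s : ℂ, MeasureTheory.Integrable fun t : ℝ =>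
        GLZeta.barnesIntegrand a a' s ((c : ℂ) + t * Complex.I)) ∧
      Differentiable ℂ (fun s : ℂ => GLZeta.barnesIntegral a a' c s)) ∧
    ∀ s : ℂ, (∀ j k, 0 < (s + a j + a' k).re) →
      GLZeta.ZetaConverges a a' s ∧
      ∀ c : ℝ, (∀ j, (a j).re < c) →
        GLZeta.zetaIntegral a a' s =
          (∏ j, ∏ k, Complex.Gammaℝ (s + a j + a' k)) * GLZeta.barnesIntegral a a' c s := by
  refine ⟨fun c hc => ⟨fun s => GLZeta.integrable_barnesIntegrand a a' hc s,
    GLZeta.differentiable_barnesIntegral a a' hc⟩, fun s hs => ?_⟩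
  obtain ⟨h1, h2⟩ := GLZeta.zetaConverges_and_eq_zetaLog hs
  exact ⟨h1, fun c hc => h2.trans (GLZeta.zetaLog_zero_eq_barnesIntegral hs hc)⟩
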